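/- Context-free language recognition is the following problem: given a context-free grammar $G$ (finitely many terminals, nonterminals and rules; right-hand sides are arbitrary strings) and a string $w$ of terminals, decide whether $w\in L(G)$. The model is the word RAM: a fixed number of registers and a memory of words, unit-cost instructions (constants, addition, truncated subtraction, multiplication, integer division, indirect load and store, tests for zero), the input being stored in memory with one number per word: the string length, the numbers of terminals, of nonterminals and of rules, the initial nonterminal, the rules symbol by symbol, and the letters of the string. Space is the number of memory words, including those holding the input. There are a single word-RAM program $P$ and absolute constants $c\in\mathbb N$ and $C$ such that $P$ decides context-free language recognition, i.e. on every input $(G,w)$ it halts with the correct answer, given a sufficiently large memory of sufficiently long words, and such that the following holds for every context-free grammar $G$. Let $g$ be the number of nonterminals of $G$. There is an $n_0$ (depending on $G$) such that for every string $w$ of length $n\ge n_0$ the program, run on $(G,w)$ with words of $c\lceil\log_2 n\rceil$ bits, halts with the correct answer after at most $$C\,\frac{g\,n^3}{\log_2 n}\ \text{ steps, using at most }\ C\,\frac{g\,n^2}{\log_2 n}\ \text{ words of memory.}$$ In short: context-free language recognition is solved simultaneously in time $O(gn^3/\log n)$ and space $O(gn^2/\log n)$ as $n\to\infty$, with implied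 constants independent of the grammar. -/

import Mathlib

/-! ## A word random access machine

The machine has a memory of `S` words of `W` bits each, a fixed number of registers of `W` bits each
(those that the program mentions), and structured programs over the usual unit-cost instructions. -/

namespace WordRAM

/-- Arithmetic instructions on words. Subtraction is truncated at `0`, division is integer division
(with quotient `0` for the divisor `0`). -/
inductive ArithOp
  | add
  | sub
  | mul
  | div

/-- The value of an arithmetic instruction. -/
def ArithOp.eval : ArithOp → ℕ → ℕ → ℕ
  | .add, a, b => a + b
  | .sub, a, b => a - b
  | .mul, a, b => a * b
  | .div, a, b => a / b

/-- Programs. Registers are named by natural numbers; a program mentions only finitely many. -/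
inductive Cmd
  /-- do nothing -/
  | skip
  /-- `x := k` -/
  | const (x k : ℕ)
  /-- `x := y op z` -/
  | arith (x : ℕ) (op : ArithOp) (y z : ℕ)
  /-- `x := mem[y]` -/
  | load (x y : ℕ)
  /-- `mem[x] := y` -/
  | store (x y : ℕ)
  /-- sequential composition -/
  | seq (p q : Cmd)
  /-- if the register `x` is nonzero then `p` else `q` -/
  | cond (x : ℕ) (p q : Cmd)
  /-- while the register `x` is nonzero do `p` -/
  | loop (x : ℕ) (p : Cmd)

/-- The contents of the registers and of the memory. -/
structure State where
  /-- contents of the registers -/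
  reg : ℕ → ℕ
  /-- contents of the memory cells -/
  mem : ℕ → ℕ

/-- Write the value `v` into the register `x`. -/
def State.setReg (σ : State) (x v : ℕ) : State :=
  { σ with reg := Function.update σ.reg x v }

/-- Write the value `v` into the memory cell `a`. -/
def State.setMem (σ : State) (a v : ℕ) : State :=
  { σ with mem := Function.update σ.mem a v }

/-- `Exec W S p σ t σ'`: on the machine with `S` memory words of `W` bits, the program `p` started in
the state `σ` halts after exactly `t` steps in the state `σ'`. Every instruction and every test of a
register costs one step. There is no rule for an instruction whose result does not fit in a word, or
that addresses a cell outside the memory: a program that attempts one of these does not halt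
properly. -/
inductive Exec (W S : ℕ) : Cmd → State → ℕ → State → Prop
  | skip (σ : State) : Exec W S .skip σ 1 σ
  | const (σ : State) (x k : ℕ) (hk : k < 2 ^ W) : Exec W S (.const x k) σ 1 (σ.setReg x k)
  | arith (σ : State) (x : ℕ) (op : ArithOp) (y z : ℕ)
      (hv : op.eval (σ.reg y) (σ.reg z) < 2 ^ W) :
      Exec W S (.arith x op y z) σ 1 (σ.setReg x (op.eval (σ.reg y) (σ.reg z)))
  | load (σ : State) (x y : ℕ) (ha : σ.reg y < S) :
      Exec W S (.load x y) σ 1 (σ.setReg x (σ.mem (σ.reg y)))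
  | store (σ : State) (x y : ℕ) (ha : σ.reg x < S) :
      Exec W S (.store x y) σ 1 (σ.setMem (σ.reg x) (σ.reg y))
  | seq {p q : Cmd} {σ₁ σ₂ σ₃ : State} {t₁ t₂ : ℕ}
      (hp : Exec W S p σ₁ t₁ σ₂) (hq : Exec W S q σ₂ t₂ σ₃) :
      Exec W S (.seq p q) σ₁ (t₁ + t₂) σ₃
  | cond_true {x : ℕ} {p q : Cmd} {σ σ' : State} {t : ℕ}
      (hx : σ.reg x ≠ 0) (hp : Exec W S p σ t σ') : Exec W S (.cond x p q) σ (1 + t) σ'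
  | cond_false {x : ℕ} {p q : Cmd} {σ σ' : State} {t : ℕ}
      (hx : σ.reg x = 0) (hq : Exec W S q σ t σ') : Exec W S (.cond x p q) σ (1 + t) σ'
  | loop_done {x : ℕ} {p : Cmd} {σ : State} (hx : σ.reg x = 0) : Exec W S (.loop x p) σ 1 σ
  | loop_step {x : ℕ} {p : Cmd} {σ₁ σ₂ σ₃ : State} {t₁ t₂ : ℕ}
      (hx : σ₁.reg x ≠ 0) (hp : Exec W S p σ₁ t₁ σ₂) (hl : Exec W S (.loop x p) σ₂ t₂ σ₃) :
      Exec W S (.loop x p) σ₁ (1 + t₁ + t₂) σ₃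

/-- The machine is deterministic: the running time and the final state are determined by the program
and the initial state. -/
theorem Exec.deterministic {W S : ℕ} {p : Cmd} {σ σ₁ σ₂ : State} {t₁ t₂ : ℕ}
    (h₁ : Exec W S p σ t₁ σ₁) (h₂ : Exec W S p σ t₂ σ₂) : t₁ = t₂ ∧ σ₁ = σ₂ := by
  induction h₁ generalizing t₂ σ₂ with
  | skip | const | arith | load | store => cases h₂; exact ⟨rfl, rfl⟩
  | seq _ _ ihp ihq =>
    cases h₂ with
    | seq hp hq =>
      obtain ⟨rfl, rfl⟩ := ihp hp
      obtain ⟨rfl, rfl⟩ := ihq hq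
      exact ⟨rfl, rfl⟩
  | cond_true hx _ ih =>
    cases h₂ with
    | cond_true _ hp => obtain ⟨rfl, rfl⟩ := ih hp; exact ⟨rfl, rfl⟩
    | cond_false hx' _ => exact absurd hx' hx
  | cond_false hx _ ih =>
    cases h₂ with
    | cond_true hx' _ => exact absurd hx hx'
    | cond_false _ hq => obtain ⟨rfl, rfl⟩ := ih hq; exact ⟨rfl, rfl⟩
  | loop_done hx =>
    cases h₂ with
    | loop_done _ => exact ⟨rfl, rfl⟩
    | loop_step hx' _ _ => exact absurd hx hx'
  | loop_step hx _ _ ihp ihl =>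
    cases h₂ with
    | loop_done hx' => exact absurd hx' hx
    | loop_step _ hp hl =>
      obtain ⟨rfl, rfl⟩ := ihp hp
      obtain ⟨rfl, rfl⟩ := ihl hl
      exact ⟨rfl, rfl⟩

/-- The initial state: the input occupies the first memory cells, everything else is `0`. -/
def State.init (input : List ℕ) : State where
  reg := fun _ => 0
  mem := fun a => input.getD a 0

/-- On the machine with `S` memory words of `W` bits (the words that hold the input are counted in
`S`), the program `p` halts on the given input after exactly `t` steps with the value `out` in
register `0`. -/
def Cmd.Computes (p : Cmd) (W S : ℕ) (input : List ℕ) (t out : ℕ) : Prop :=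
  input.length ≤ S ∧ (∀ v ∈ input, v < 2 ^ W) ∧
    ∃ σ : State, Exec W S p (State.init input) t σ ∧ σ.reg 0 = out

end WordRAM

/-! ## Context-free grammars as input -/

/-- A presentation of a context-free grammar with finitely many terminals and nonterminals: a
numbering of the terminals, a numbering of the nonterminals, and a list of the rules in any order. -/
structure GrammarPresentation {T : Type} (G : ContextFreeGrammar T) where
  /-- number of terminals -/
  numT : ℕ
  /-- number of nonterminals -/
  numN : ℕ
  /-- numbering of the terminals -/
  terminal : T ≃ Fin numT
  /-- numbering of the nonterminals -/
  nonterminal : G.NT ≃ Fin numN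
  /-- the rules, in any order -/
  ruleList : List (ContextFreeRule T G.NT)
  nodup : ruleList.Nodup
  mem_iff : ∀ r, r ∈ ruleList ↔ r ∈ G.rules

namespace GrammarPresentation

variable {T : Type} {G : ContextFreeGrammar T}

/-- Terminals are encoded by even numbers, nonterminals by odd ones. -/
def encodeSymbol (p : GrammarPresentation G) : Symbol T G.NT → ℕ
  | .terminal a => 2 * (p.terminal a : ℕ)
  | .nonterminal A => 2 * (p.nonterminal A : ℕ) + 1

/-- A rule is encoded by its left-hand side, the length of its right-hand side, and the symbols of
the right-hand side. -/
def encodeRule (p : GrammarPresentation G) (r : ContextFreeRule T G.NT) : List ℕ :=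
  (p.nonterminal r.input : ℕ) :: r.output.length :: r.output.map p.encodeSymbol

/-- An instance of the recognition problem, one number per word: the length of the string, the number
of terminals, the number of nonterminals, the initial nonterminal, the number of rules, then the
rules, then the letters of the string. -/
def encode (p : GrammarPresentation G) (w : List T) : List ℕ :=
  [w.length, p.numT, p.numN, (p.nonterminal G.initial : ℕ), p.ruleList.length] ++
    p.ruleList.flatMap p.encodeRule ++ w.map (fun a => (p.terminal a : ℕ))

end GrammarPresentation

/-! ## A small imperative language with expressions, compiled to the word RAM -/

namespace Imp

open WordRAM

/-! The algorithm is bottom-up tabulation in the manner of Cocke, Younger and Kasami, with every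
Boolean matrix cut into `s × s` blocks, one block per word, where `s²` is about `(log n) / 16`. With
`M = n / s + 1`, the matrix of pairs `(i, j)` such that a given nonterminal derives the part of the
string between `i` and `j` takes `M²` words; for `g` nonterminals this is the space bound. There are
only `B = 2 ^ s² ≤ n ^ (1/16)` block values, so a table of all `B³` values of `z ∨ x · y` makes a
Boolean multiply-add of blocks a single lookup.

The grammar is not normalised. A right-hand side is read through its prefixes: a prefix is extended
by one symbol with one multiply-add. The blocks of prefixes are kept for the current row of blocks
only, so they are a lower-order term of the space. Rows are filled from the last to the first, and
each row from the diagonal to the right. The block `(I, J)` collects products through the blocks `K`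
between `I` and `J`. For `I < K < J` both factors are final, and one pass over the rules is enough.
For `K = I` and `K = J` the block feeds back into itself (empty and chain rules), so passes are
repeated until nothing changes. Words only gain bits, hence their numerical sum bounds the number of
rounds by about `(W0 + g) * B`, where `W0` is the size of the encoded grammar.

The passes through all `K` cost `W0 * M³`, about `W0 * n³ / s³`. For `n` large in terms of the
grammar, `W0 ≤ s`, and this is at most of order `n³ / s²`, that is `n³ / log n`: the third factor
`s` pays for the grammar. The saturation adds at most `M² * n` up to a constant, because `B` is a
small power of `n`.

Soundness of all blocks is invariant under each update; completeness of a saturated block is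
`Inst.complete_of_closed`, an induction on derivations, and `derN_iff` connects these derivations
with the language. The program is written in a small language whose compilation keeps the exact
number of steps (`Run.simulate`), and is verified with timed Hoare triples (`Tri`). The bounds are
`Inst.Long.s2_mul_totalTime_le`, `Inst.Long.s2_mul_S_le` and `Inst.Long.fits`. -/

/-- Expressions over variables in `V`. -/
inductive Ex (V : Type)
  | var (x : V)
  | num (k : ℕ)
  | op (o : ArithOp) (a b : Ex V)
  | mem (a : Ex V)

/-- Statements over variables in `V`. -/
inductive Pr (V : Type)
  | skip
  | set (x : V) (e : Ex V)
  | sto (a e : Ex V)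
  | seq (p q : Pr V)
  | ite (e : Ex V) (p q : Pr V)
  | whl (e : Ex V) (p : Pr V)

/-- States: values of the variables and contents of the memory. -/
structure St (V : Type) where
  reg : V → ℕ
  mem : ℕ → ℕ

variable {V : Type}

instance : Add (Ex V) := ⟨.op .add⟩
instance : Sub (Ex V) := ⟨.op .sub⟩
instance : Mul (Ex V) := ⟨.op .mul⟩
instance : Div (Ex V) := ⟨.op .div⟩
instance (k : ℕ) : OfNat (Ex V) k := ⟨.num k⟩
instance : Coe V (Ex V) := ⟨.var⟩

/-- Assignment to a variable. -/
def St.set [DecidableEq V] (s : St V) (x : V) (v : ℕ) : St V :=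
  { s with reg := Function.update s.reg x v }

/-- Assignment to a memory cell. -/
def St.sto (s : St V) (a v : ℕ) : St V :=
  { s with mem := Function.update s.mem a v }

@[simp] theorem St.set_mem [DecidableEq V] (s : St V) (x : V) (v : ℕ) : (s.set x v).mem = s.mem := rfl

@[simp] theorem St.set_reg [DecidableEq V] (s : St V) (x y : V) (v : ℕ) :
    (s.set x v).reg y = if y = x then v else s.reg y := by
  simp [St.set, Function.update_apply]

@[simp] theorem St.sto_reg (s : St V) (a v : ℕ) : (s.sto a v).reg = s.reg := rfl

@[simp] theorem St.sto_mem (s : St V) (a v : ℕ) :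
    (s.sto a v).mem = Function.update s.mem a v := rfl

/-- The value of an expression. -/
def Ex.eval (s : St V) : Ex V → ℕ
  | .var x => s.reg x
  | .num k => k
  | .op o a b => o.eval (a.eval s) (b.eval s)
  | .mem a => s.mem (a.eval s)

/-- The evaluation of the expression causes neither an overflow nor an access outside the memory. -/
def Ex.ok (W S : ℕ) (s : St V) : Ex V → Prop
  | .var _ => True
  | .num k => k < 2 ^ W
  | .op .add a b => a.ok W S s ∧ b.ok W S s ∧ a.eval s + b.eval s < 2 ^ W
  | .op .mul a b => a.ok W S s ∧ b.ok W S s ∧ a.eval s * b.eval s < 2 ^ W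
  | .op .sub a b => a.ok W S s ∧ b.ok W S s
  | .op .div a b => a.ok W S s ∧ b.ok W S s
  | .mem a => a.ok W S s ∧ a.eval s < S

/-- The number of machine steps spent on an expression. -/
def Ex.cost : Ex V → ℕ
  | .var _ => 2
  | .num _ => 1
  | .op _ a b => a.cost + b.cost + 1
  | .mem a => a.cost + 1

section
variable (s : St V) (W S : ℕ) (x : V) (k : ℕ) (a b : Ex V)

@[simp] theorem Ex.eval_var : (Ex.var x).eval s = s.reg x := rfl
@[simp] theorem Ex.eval_num : (no_index (OfNat.ofNat k) : Ex V).eval s = OfNat.ofNat k := rfl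
@[simp] theorem Ex.eval_add : (a + b).eval s = a.eval s + b.eval s := rfl
@[simp] theorem Ex.eval_sub : (a - b).eval s = a.eval s - b.eval s := rfl
@[simp] theorem Ex.eval_mul : (a * b).eval s = a.eval s * b.eval s := rfl
@[simp] theorem Ex.eval_div : (a / b).eval s = a.eval s / b.eval s := rfl
@[simp] theorem Ex.eval_mem : (Ex.mem a).eval s = s.mem (a.eval s) := rfl

@[simp] theorem Ex.ok_var : (Ex.var x).ok W S s ↔ True := Iff.rfl
@[simp] theorem Ex.ok_num : (no_index (OfNat.ofNat k) : Ex V).ok W S s ↔ OfNat.ofNat k < 2 ^ W :=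
  Iff.rfl
@[simp] theorem Ex.ok_add :
    (a + b).ok W S s ↔ a.ok W S s ∧ b.ok W S s ∧ a.eval s + b.eval s < 2 ^ W := Iff.rfl
@[simp] theorem Ex.ok_mul :
    (a * b).ok W S s ↔ a.ok W S s ∧ b.ok W S s ∧ a.eval s * b.eval s < 2 ^ W := Iff.rfl
@[simp] theorem Ex.ok_sub : (a - b).ok W S s ↔ a.ok W S s ∧ b.ok W S s := Iff.rfl
@[simp] theorem Ex.ok_div : (a / b).ok W S s ↔ a.ok W S s ∧ b.ok W S s := Iff.rfl
@[simp] theorem Ex.ok_mem : (Ex.mem a).ok W S s ↔ a.ok W S s ∧ a.eval s < S := Iff.rfl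

end

/-- Big-step semantics with step counting. -/
inductive Run [DecidableEq V] (W S : ℕ) : Pr V → St V → ℕ → St V → Prop
  | skip (s : St V) : Run W S .skip s 1 s
  | set (s : St V) (x : V) (e : Ex V) (h : e.ok W S s) :
      Run W S (.set x e) s e.cost (s.set x (e.eval s))
  | sto (s : St V) (a e : Ex V) (ha : a.ok W S s) (he : e.ok W S s) (hS : a.eval s < S) :
      Run W S (.sto a e) s (a.cost + e.cost + 1) (s.sto (a.eval s) (e.eval s))
  | seq {p q : Pr V} {s₁ s₂ s₃ : St V} {t₁ t₂ : ℕ} (hp : Run W S p s₁ t₁ s₂)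
      (hq : Run W S q s₂ t₂ s₃) : Run W S (.seq p q) s₁ (t₁ + t₂) s₃
  | ite_true {e : Ex V} {p q : Pr V} {s s' : St V} {t : ℕ} (he : e.ok W S s) (h : e.eval s ≠ 0)
      (hp : Run W S p s t s') : Run W S (.ite e p q) s (e.cost + 1 + t) s'
  | ite_false {e : Ex V} {p q : Pr V} {s s' : St V} {t : ℕ} (he : e.ok W S s) (h : e.eval s = 0)
      (hq : Run W S q s t s') : Run W S (.ite e p q) s (e.cost + 1 + t) s'
  | whl_done {e : Ex V} {p : Pr V} {s : St V} (he : e.ok W S s) (h : e.eval s = 0) :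
      Run W S (.whl e p) s (e.cost + 1) s
  | whl_step {e : Ex V} {p : Pr V} {s s₁ s₂ : St V} {t₁ t₂ : ℕ} (he : e.ok W S s)
      (h : e.eval s ≠ 0) (hp : Run W S p s t₁ s₁) (hl : Run W S (.whl e p) s₁ t₂ s₂) :
      Run W S (.whl e p) s (e.cost + 1 + t₁ + t₂) s₂

/-! ### Compilation -/

/-- Code that writes the value of the expression into register `dst`; variables live in the even
registers, and the odd registers from `2 * d + 1` on are used for temporary values. -/
def Ex.code (ν : V → ℕ) : Ex V → ℕ → ℕ → Cmd
  -- The machine has no move instruction, so a variable is copied by adding a zero; hence the cost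
  -- 2.
  | .var x, d, dst => .seq (.const (2 * d + 1) 0) (.arith dst .add (2 * d + 1) (2 * ν x))
  | .num k, _, dst => .const dst k
  | .op o a b, d, dst =>
      .seq (.seq (a.code ν d (2 * d + 1)) (b.code ν (d + 1) (2 * d + 3)))
        (.arith dst o (2 * d + 1) (2 * d + 3))
  | .mem a, d, dst => .seq (a.code ν d (2 * d + 1)) (.load dst (2 * d + 1))

/-- Code for a statement. -/
def Pr.code (ν : V → ℕ) : Pr V → Cmd
  | .skip => .skip
  | .set x e => e.code ν 0 (2 * ν x)
  | .sto a e => .seq (.seq (a.code ν 0 1) (e.code ν 1 3)) (.store 1 3)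
  | .seq p q => .seq (p.code ν) (q.code ν)
  | .ite e p q => .seq (e.code ν 0 1) (.cond 1 (p.code ν) (q.code ν))
  | .whl e p => .seq (e.code ν 0 1) (.loop 1 (.seq (p.code ν) (e.code ν 0 1)))

/-- The machine state `σ`, all of whose words are below `2 ^ W`, represents the state `s`. -/
structure Rep (ν : V → ℕ) (W : ℕ) (σ : State) (s : St V) : Prop where
  reg : ∀ x, σ.reg (2 * ν x) = s.reg x
  mem : σ.mem = s.mem
  reg_lt : ∀ x, σ.reg x < 2 ^ W
  mem_lt : ∀ a, σ.mem a < 2 ^ W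

theorem setReg_reg (σ : State) (x v y : ℕ) :
    (σ.setReg x v).reg y = if y = x then v else σ.reg y := by
  simp [State.setReg, Function.update_apply]

/-- Temporaries are used like a stack: at depth `d` only the odd registers from `2 * d + 1` on and
`dst` are written, so the second operand, evaluated at depth `d + 1`, cannot destroy the first. -/
theorem Ex.code_spec (ν : V → ℕ) {W S : ℕ} (s : St V) (e : Ex V) (d dst : ℕ) (σ : State)
    (hσ : Rep ν W σ s) (hok : e.ok W S s) :
    ∃ σ', Exec W S (e.code ν d dst) σ e.cost σ' ∧ σ'.mem = σ.mem ∧ σ'.reg dst = e.eval s ∧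
      (∀ x, x ≠ dst → (x % 2 = 0 ∨ x < 2 * d + 1) → σ'.reg x = σ.reg x) ∧
      ∀ x, σ'.reg x < 2 ^ W := by
  have key : ∀ (σ₁ : State) (y v : ℕ), (∀ x, σ₁.reg x < 2 ^ W) → v < 2 ^ W →
      ∀ x, (σ₁.setReg y v).reg x < 2 ^ W := by
    intro σ₁ y v h₁ hv x
    rw [setReg_reg]; split_ifs
    · exact hv
    · exact h₁ x
  induction e generalizing d dst σ with
  | var x =>
    have h0 : ArithOp.add.eval ((σ.setReg (2 * d + 1) 0).reg (2 * d + 1))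
        ((σ.setReg (2 * d + 1) 0).reg (2 * ν x)) = s.reg x := by
      have : 2 * ν x ≠ 2 * d + 1 := by omega
      simp [ArithOp.eval, setReg_reg, this, hσ.reg]
    have hb : s.reg x < 2 ^ W := hσ.reg x ▸ hσ.reg_lt _
    refine ⟨_, .seq (.const _ _ _ (by positivity)) (.arith _ _ _ _ _ (by rw [h0]; exact hb)), rfl,
      ?_, ?_, ?_⟩
    · rw [h0]; simp [setReg_reg, Ex.eval]
    · intro y hy hy'
      have : y ≠ 2 * d + 1 := by omega
      simp [setReg_reg, hy, this]
    · rw [h0]; exact key _ _ _ (key _ _ _ hσ.reg_lt (by positivity)) hb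
  | num k =>
    refine ⟨_, .const _ _ _ hok, rfl, by simp [setReg_reg, Ex.eval], ?_, key _ _ _ hσ.reg_lt hok⟩
    intro y hy _; simp [setReg_reg, hy]
  | op o a b iha ihb =>
    have hoka : a.ok W S s := by cases o <;> exact hok.1
    have hokb : b.ok W S s := by cases o <;> first | exact hok.2.1 | exact hok.2
    obtain ⟨σ₁, e₁, m₁, r₁, f₁, b₁⟩ := iha d (2 * d + 1) σ hσ hoka
    have hσ₁ : Rep ν W σ₁ s := by
      refine ⟨fun x => ?_, m₁.trans hσ.mem, b₁, m₁ ▸ hσ.mem_lt⟩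
      rw [f₁ _ (by omega) (by omega), hσ.reg]
    obtain ⟨σ₂, e₂, m₂, r₂, f₂, b₂⟩ := ihb (d + 1) (2 * d + 3) σ₁ hσ₁ hokb
    have r₁' : σ₂.reg (2 * d + 1) = a.eval s := by rw [f₂ _ (by omega) (by omega), r₁]
    have ha : a.eval s < 2 ^ W := r₁' ▸ b₂ _
    have hv : o.eval (σ₂.reg (2 * d + 1)) (σ₂.reg (2 * d + 3)) < 2 ^ W := by
      rw [r₁', r₂]
      cases o with
      | add => exact hok.2.2
      | mul => exact hok.2.2
      | sub => exact lt_of_le_of_lt (Nat.sub_le _ _) ha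
      | div => exact lt_of_le_of_lt (Nat.div_le_self _ _) ha
    refine ⟨_, .seq (.seq e₁ e₂) (.arith _ _ _ _ _ hv), m₂.trans m₁, ?_, ?_, key _ _ _ b₂ hv⟩
    · rw [r₁', r₂]; simp [setReg_reg, Ex.eval]
    · intro y hy hy'
      rw [setReg_reg, if_neg hy, f₂ _ (by omega) (by omega), f₁ _ (by omega) (by omega)]
  | mem a iha =>
    obtain ⟨σ₁, e₁, m₁, r₁, f₁, b₁⟩ := iha d (2 * d + 1) σ hσ hok.1
    refine ⟨_, .seq e₁ (.load _ _ _ (by rw [r₁]; exact hok.2)), m₁, ?_, ?_, ?_⟩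
    · simp [setReg_reg, Ex.eval, r₁, m₁, hσ.mem]
    · intro y hy hy'
      rw [setReg_reg, if_neg hy, f₁ _ (by omega) (by omega)]
    · exact key _ _ _ b₁ (m₁ ▸ hσ.mem_lt _)

theorem Ex.code_rep {ν : V → ℕ} {W S : ℕ} {s : St V} {e : Ex V} {σ : State}
    (hσ : Rep ν W σ s) (hok : e.ok W S s) :
    ∃ σ', Exec W S (e.code ν 0 1) σ e.cost σ' ∧ Rep ν W σ' s ∧ σ'.reg 1 = e.eval s := by
  obtain ⟨σ₁, e₁, m₁, r₁, f₁, b₁⟩ := e.code_spec ν s 0 1 σ hσ hok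
  refine ⟨σ₁, e₁, ⟨fun x => ?_, m₁.trans hσ.mem, b₁, m₁ ▸ hσ.mem_lt⟩, r₁⟩
  rw [f₁ _ (by omega) (by omega), hσ.reg]

/-- The compiled code simulates the program, with the same number of steps. -/
theorem Run.simulate [DecidableEq V] {ν : V → ℕ} (hν : Function.Injective ν) {W S : ℕ} {p : Pr V}
    {s s' : St V} {t : ℕ} (h : Run W S p s t s') {σ : State} (hσ : Rep ν W σ s) :
    ∃ σ', Exec W S (p.code ν) σ t σ' ∧ Rep ν W σ' s' := by
  induction h generalizing σ with
  | skip s => exact ⟨σ, .skip _, hσ⟩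
  | set s x e h =>
    obtain ⟨σ₁, e₁, m₁, r₁, f₁, b₁⟩ := e.code_spec ν s 0 (2 * ν x) σ hσ h
    refine ⟨σ₁, e₁, fun y => ?_, m₁.trans hσ.mem, b₁, m₁ ▸ hσ.mem_lt⟩
    by_cases hy : y = x
    · subst hy; simp [r₁]
    · have : 2 * ν y ≠ 2 * ν x := fun h => hy (hν (by omega))
      rw [f₁ _ this (by omega), hσ.reg]; simp [hy]
  | sto s a e ha he hS =>
    obtain ⟨σ₁, e₁, hσ₁, r₁⟩ := a.code_rep hσ ha
    obtain ⟨σ₂, e₂, m₂, r₂, f₂, b₂⟩ := e.code_spec ν s 1 3 σ₁ hσ₁ he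
    have r₁' : σ₂.reg 1 = a.eval s := by rw [f₂ _ (by omega) (by omega), r₁]
    refine ⟨_, .seq (.seq e₁ e₂) (.store _ _ _ (by rw [r₁']; exact hS)), fun x => ?_, ?_, b₂, ?_⟩
    · change σ₂.reg _ = s.reg x
      rw [f₂ _ (by omega) (by omega), hσ₁.reg]
    · simp [State.setMem, r₁', r₂, m₂, hσ₁.mem]
    · intro x
      simp only [State.setMem, Function.update_apply]
      split_ifs
      · exact b₂ _
      · exact m₂ ▸ hσ₁.mem_lt _
  | seq _ _ ihp ihq =>
    obtain ⟨σ₁, e₁, h₁⟩ := ihp hσ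
    obtain ⟨σ₂, e₂, h₂⟩ := ihq h₁
    exact ⟨σ₂, .seq e₁ e₂, h₂⟩
  | ite_true he h _ ih =>
    obtain ⟨σ₁, e₁, h₁, r₁⟩ := Ex.code_rep hσ he
    obtain ⟨σ₂, e₂, h₂⟩ := ih h₁
    refine ⟨σ₂, ?_, h₂⟩
    rw [add_assoc]
    exact .seq e₁ (.cond_true (by rwa [r₁]) e₂)
  | ite_false he h _ ih =>
    obtain ⟨σ₁, e₁, h₁, r₁⟩ := Ex.code_rep hσ he
    obtain ⟨σ₂, e₂, h₂⟩ := ih h₁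
    refine ⟨σ₂, ?_, h₂⟩
    rw [add_assoc]
    exact .seq e₁ (.cond_false (by rwa [r₁]) e₂)
  | whl_done he h =>
    obtain ⟨σ₁, e₁, h₁, r₁⟩ := Ex.code_rep hσ he
    exact ⟨σ₁, .seq e₁ (.loop_done (by rwa [r₁])), h₁⟩
  | @whl_step e p s s₁ s₂ t₁ t₂ he h _ _ ihp ihl =>
    obtain ⟨σ₁, e₁, h₁, r₁⟩ := Ex.code_rep hσ he
    obtain ⟨σ₂, e₂, h₂⟩ := ihp h₁
    obtain ⟨σ₃, e₃, h₃⟩ := ihl h₂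
    refine ⟨σ₃, ?_, h₃⟩
    -- The remaining loop is compiled as an evaluation of the test followed by `loop`. Splitting it
    -- lets that evaluation become the end of the round just made.
    cases e₃ with
    | @seq _ _ _ σm _ ta tb hc hl =>
      have : e.cost + 1 + t₁ + (ta + tb) = e.cost + (1 + (t₁ + ta) + tb) := by ring
      rw [this]
      exact .seq e₁ (.loop_step (by rwa [r₁]) (.seq e₂ hc) hl)

/-! ### Reasoning about programs -/

variable [DecidableEq V]

/-- The program may assign to the variable. -/
def Pr.writes (x : V) : Pr V → Bool
  | .skip => false
  | .set y _ => decide (x = y)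
  | .sto _ _ => false
  | .seq p q => p.writes x || q.writes x
  | .ite _ p q => p.writes x || q.writes x
  | .whl _ p => p.writes x

/-- `Pr.writes` is a Boolean computation, so `rfl` carries a variable across a program that does not
assign to it. For this reason specifications mention only what changes, and the rules for `Tri` hand
the frame condition to each continuation. -/
theorem Run.frame {W S : ℕ} {p : Pr V} {s s' : St V} {t : ℕ} (h : Run W S p s t s') {x : V}
    (hx : p.writes x = false) : s'.reg x = s.reg x := by
  induction h with
  | skip => rfl
  | set s y e h =>
    have : x ≠ y := by simpa [Pr.writes] using hx
    simp [this]
  | sto => rfl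
  | seq _ _ ihp ihq =>
    simp only [Pr.writes, Bool.or_eq_false_iff] at hx
    rw [ihq hx.2, ihp hx.1]
  | ite_true _ _ _ ih =>
    simp only [Pr.writes, Bool.or_eq_false_iff] at hx
    exact ih hx.1
  | ite_false _ _ _ ih =>
    simp only [Pr.writes, Bool.or_eq_false_iff] at hx
    exact ih hx.2
  | whl_done => rfl
  | whl_step _ _ _ _ ihp ihl => rw [ihl hx, ihp hx]

/-- Started in `s`, the program halts after at most `T` steps in a state that satisfies `Q`. -/
def Tri (W S : ℕ) (p : Pr V) (s : St V) (T : ℕ) (Q : St V → Prop) : Prop :=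
  ∃ t ≤ T, ∃ s', Run W S p s t s' ∧ Q s'

variable {W S : ℕ}

theorem Tri.mono {p : Pr V} {s : St V} {T T' : ℕ} {Q Q' : St V → Prop} (h : Tri W S p s T Q)
    (hT : T ≤ T') (hQ : ∀ s', (∀ x, p.writes x = false → s'.reg x = s.reg x) → Q s' → Q' s') :
    Tri W S p s T' Q' := by
  obtain ⟨t, ht, s', hr, hq⟩ := h
  exact ⟨t, ht.trans hT, s', hr, hQ s' (fun _ hx => hr.frame hx) hq⟩

theorem Tri.seq {p q : Pr V} {s : St V} {T₁ T₂ T : ℕ} {Q₁ Q : St V → Prop}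
    (h₁ : Tri W S p s T₁ Q₁) (hT : T₁ + T₂ ≤ T)
    (h₂ : ∀ s', (∀ x, p.writes x = false → s'.reg x = s.reg x) → Q₁ s' → Tri W S q s' T₂ Q) :
    Tri W S (.seq p q) s T Q := by
  obtain ⟨t₁, ht₁, s₁, hr₁, hq₁⟩ := h₁
  obtain ⟨t₂, ht₂, s₂, hr₂, hq₂⟩ := h₂ s₁ (fun _ hx => hr₁.frame hx) hq₁
  exact ⟨t₁ + t₂, by omega, s₂, .seq hr₁ hr₂, hq₂⟩

/-- A bound on the running time of a loop-free program. -/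
def Pr.cost : Pr V → ℕ
  | .skip => 1
  | .set _ e => e.cost
  | .sto a e => a.cost + e.cost + 1
  | .seq p q => p.cost + q.cost
  | .ite e p q => e.cost + 1 + (p.cost + q.cost)
  | .whl _ _ => 0

/-- The weakest precondition of a loop-free program. -/
def Pr.wp (W S : ℕ) : Pr V → (St V → Prop) → St V → Prop
  | .skip, Q, s => Q s
  | .set x e, Q, s => e.ok W S s ∧ Q (s.set x (e.eval s))
  | .sto a e, Q, s => (a.ok W S s ∧ e.ok W S s ∧ a.eval s < S) ∧ Q (s.sto (a.eval s) (e.eval s))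
  | .seq p q, Q, s => p.wp W S (q.wp W S Q) s
  | .ite e p q, Q, s => e.ok W S s ∧ (e.eval s ≠ 0 → p.wp W S Q s) ∧ (e.eval s = 0 → q.wp W S Q s)
  | .whl _ _, _, _ => False

theorem Pr.wp_spec {p : Pr V} {s : St V} {Q : St V → Prop} (h : p.wp W S Q s) :
    Tri W S p s p.cost Q := by
  induction p generalizing s Q with
  | skip => exact ⟨_, le_rfl, _, .skip _, h⟩
  | set x e => exact ⟨_, le_rfl, _, .set _ _ _ h.1, h.2⟩
  | sto a e => exact ⟨_, le_rfl, _, .sto _ _ _ h.1.1 h.1.2.1 h.1.2.2, h.2⟩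
  | seq p q ihp ihq =>
    obtain ⟨t₁, ht₁, s₁, hr₁, hq₁⟩ := ihp h
    obtain ⟨t₂, ht₂, s₂, hr₂, hq₂⟩ := ihq hq₁
    exact ⟨_, Nat.add_le_add ht₁ ht₂, s₂, .seq hr₁ hr₂, hq₂⟩
  | ite e p q ihp ihq =>
    by_cases he : e.eval s = 0
    · obtain ⟨t₁, ht₁, s₁, hr₁, hq₁⟩ := ihq (h.2.2 he)
      exact ⟨_, by simp only [Pr.cost]; omega, s₁, .ite_false h.1 he hr₁, hq₁⟩
    · obtain ⟨t₁, ht₁, s₁, hr₁, hq₁⟩ := ihp (h.2.1 he)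
      exact ⟨_, by simp only [Pr.cost]; omega, s₁, .ite_true h.1 he hr₁, hq₁⟩
  | whl e p => exact h.elim

theorem Tri.of_wp {p : Pr V} {s : St V} {Q : St V → Prop} {T : ℕ} (hT : p.cost ≤ T)
    (h : p.wp W S Q s) : Tri W S p s T Q :=
  (Pr.wp_spec h).mono hT fun _ _ => id

theorem Tri.wp_seq {p q : Pr V} {s : St V} {Q : St V → Prop} {T₂ T : ℕ} (hT : p.cost + T₂ ≤ T)
    (h : p.wp W S (fun s' => Tri W S q s' T₂ Q) s) : Tri W S (.seq p q) s T Q :=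
  Tri.seq (Pr.wp_spec h) hT fun _ _ => id

/-- A loop that makes exactly `N` rounds, the `k`-th of which takes at most `Tb k` steps. -/
theorem Tri.whl_sum {e : Ex V} {p : Pr V} {s : St V} (N : ℕ) (Inv : ℕ → St V → Prop) (Tb : ℕ → ℕ)
    {T : ℕ} {Q : St V → Prop}
    (h0 : Inv 0 s)
    (hcond : ∀ k s', k ≤ N → (∀ x, p.writes x = false → s'.reg x = s.reg x) → Inv k s' →
      e.ok W S s' ∧ (e.eval s' ≠ 0 ↔ k < N))
    (hbody : ∀ k s', k < N → (∀ x, p.writes x = false → s'.reg x = s.reg x) → Inv k s' →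
      Tri W S p s' (Tb k) (Inv (k + 1)))
    (hT : ∑ k ∈ Finset.range N, (Tb k + e.cost + 1) + e.cost + 1 ≤ T)
    (hQ : ∀ s', (∀ x, p.writes x = false → s'.reg x = s.reg x) → Inv N s' → Q s') :
    Tri W S (.whl e p) s T Q := by
  -- Induction on the number `d` of rounds left, since `Run.whl_step` splits off the first round.
  have key : ∀ d k s', k + d = N → (∀ x, p.writes x = false → s'.reg x = s.reg x) → Inv k s' →
      Tri W S (.whl e p) s' (∑ i ∈ Finset.Ico k N, (Tb i + e.cost + 1) + e.cost + 1) Q := by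
    intro d
    induction d with
    | zero =>
      intro k s' hk hf hI
      obtain rfl : k = N := by omega
      obtain ⟨hok, hev⟩ := hcond k s' le_rfl hf hI
      refine ⟨_, by omega, s', .whl_done hok ?_, hQ s' hf hI⟩
      by_contra hne
      exact absurd (hev.1 hne) (lt_irrefl _)
    | succ d ih =>
      intro k s' hk hf hI
      have hkN : k < N := by omega
      obtain ⟨hok, hev⟩ := hcond k s' hkN.le hf hI
      obtain ⟨t₁, ht₁, s₁, hr₁, hI₁⟩ := hbody k s' hkN hf hI
      obtain ⟨t₂, ht₂, s₂, hr₂, hq₂⟩ := ih (k + 1) s₁ (by omega)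
        (fun x hx => (hr₁.frame hx).trans (hf x hx)) hI₁
      refine ⟨_, ?_, s₂, .whl_step hok (hev.2 hkN) hr₁ hr₂, hq₂⟩
      rw [Finset.sum_eq_sum_Ico_succ_bot hkN]
      omega
  obtain ⟨t, ht, h⟩ := key N 0 s (by omega) (fun _ _ => rfl) h0
  exact ⟨t, by rw [Finset.range_eq_Ico] at hT; omega, h⟩

/-- A loop that makes exactly `N` rounds of at most `Tb` steps each. -/
theorem Tri.whl_count {e : Ex V} {p : Pr V} {s : St V} (N : ℕ) (Inv : ℕ → St V → Prop) (Tb : ℕ)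
    {T : ℕ} {Q : St V → Prop}
    (h0 : Inv 0 s)
    (hcond : ∀ k s', k ≤ N → (∀ x, p.writes x = false → s'.reg x = s.reg x) → Inv k s' →
      e.ok W S s' ∧ (e.eval s' ≠ 0 ↔ k < N))
    (hbody : ∀ k s', k < N → (∀ x, p.writes x = false → s'.reg x = s.reg x) → Inv k s' →
      Tri W S p s' Tb (Inv (k + 1)))
    (hT : N * (Tb + e.cost + 1) + e.cost + 1 ≤ T)
    (hQ : ∀ s', (∀ x, p.writes x = false → s'.reg x = s.reg x) → Inv N s' → Q s') :
    Tri W S (.whl e p) s T Q :=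
  Tri.whl_sum N Inv (fun _ => Tb) h0 hcond hbody (by simpa using hT) hQ

/-- A loop with a strictly decreasing measure. -/
theorem Tri.whl_measure {e : Ex V} {p : Pr V} {s : St V} (μ : St V → ℕ) (Inv : St V → Prop)
    (Tb : ℕ) {N T : ℕ} {Q : St V → Prop}
    (h0 : Inv s) (hN : μ s ≤ N)
    (hok : ∀ s', (∀ x, p.writes x = false → s'.reg x = s.reg x) → Inv s' → e.ok W S s')
    (hbody : ∀ s', (∀ x, p.writes x = false → s'.reg x = s.reg x) → Inv s' → e.eval s' ≠ 0 →
      Tri W S p s' Tb (fun s'' => Inv s'' ∧ μ s'' < μ s'))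
    (hT : N * (Tb + e.cost + 1) + e.cost + 1 ≤ T)
    (hQ : ∀ s', (∀ x, p.writes x = false → s'.reg x = s.reg x) → Inv s' → e.eval s' = 0 → Q s') :
    Tri W S (.whl e p) s T Q := by
  have key : ∀ d s', μ s' ≤ d → (∀ x, p.writes x = false → s'.reg x = s.reg x) → Inv s' →
      Tri W S (.whl e p) s' (d * (Tb + e.cost + 1) + e.cost + 1) Q := by
    intro d
    induction d with
    | zero =>
      intro s' hd hf hI
      by_cases he : e.eval s' = 0
      · exact ⟨_, by omega, s', .whl_done (hok s' hf hI) he, hQ s' hf hI he⟩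
      · obtain ⟨t₁, ht₁, s₁, hr₁, hI₁, hμ⟩ := hbody s' hf hI he
        omega
    | succ d ih =>
      intro s' hd hf hI
      by_cases he : e.eval s' = 0
      · exact ⟨_, by omega, s', .whl_done (hok s' hf hI) he, hQ s' hf hI he⟩
      · obtain ⟨t₁, ht₁, s₁, hr₁, hI₁, hμ⟩ := hbody s' hf hI he
        obtain ⟨t₂, ht₂, s₂, hr₂, hq₂⟩ := ih s₁ (by omega)
          (fun x hx => (hr₁.frame hx).trans (hf x hx)) hI₁
        refine ⟨_, ?_, s₂, .whl_step (hok s' hf hI) he hr₁ hr₂, hq₂⟩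
        rw [Nat.succ_mul]; omega
  obtain ⟨t, ht, h⟩ := key N s hN (fun _ _ => rfl) h0
  exact ⟨t, by omega, h⟩

end Imp

/-! ## The recognition program -/

namespace CFRec

open Imp

/-- The variables of the program. -/
inductive Var
  | out | n | nt | ini | R | q | r | W0 | lg | s | s2 | M | P0 | B | F0 | T0 | I0 | D0 | idm
  | x | y | z | v | k | e | i | j | h | t | idx | I | J | K | ch | a | l | X | dst
  deriving DecidableEq

section program

open Var

local infixr:60 " ;; " => Pr.seq
local notation:max "ld(" a ")" => Ex.mem (V := Var) (a : Ex Var)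
local infix:70 " ≔ " => Pr.set

/-- The `e`-th binary digit of `x`. -/
def bitEx (x e : Ex Var) : Ex Var :=
  x / ld(P0 + e) - x / ld(P0 + e) / 2 * 2

def readHeader : Pr Var :=
  n ≔ ld(0) ;; nt ≔ ld(1) ;; ini ≔ ld(3) ;; R ≔ ld(4)

def skipRulesBody : Pr Var :=
  q ≔ (q + 2 + ld(q + 1) : Ex Var) ;; r ≔ (r + 1 : Ex Var)

/-- Rules have varying lengths, so the address of the string is found by walking over them; it is
the final value of `q`. As everywhere below, truncated subtraction serves as a comparison: `R - r`
is nonzero exactly when `r < R`. -/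
def skipRules : Pr Var :=
  (q ≔ 5 ;; r ≔ 0) ;; .whl (R - r : Ex Var) skipRulesBody

def logBody : Pr Var := x ≔ (x / 2 : Ex Var) ;; lg ≔ (lg + 1 : Ex Var)

def computeLog : Pr Var := (x ≔ n ;; lg ≔ 0) ;; .whl (x / 2 : Ex Var) logBody

/-- The test is nonzero exactly when `16 * (s + 1)² ≤ lg`, so the loop ends with the larger of 1 and
the integer square root of `lg / 16`. -/
def computeSide : Pr Var :=
  s ≔ 1 ;; .whl (lg + 1 - 16 * ((s + 1) * (s + 1)) : Ex Var) (s ≔ (s + 1 : Ex Var))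

def powBody : Pr Var :=
  .sto (P0 + k : Ex Var) v ;; v ≔ (v * 2 : Ex Var) ;; k ≔ (k + 1 : Ex Var)

/-- Powers of two replace shift instructions: bits are read by division and set by addition. The
last entry, with exponent `s2`, is the number of block values. -/
def buildPow : Pr Var :=
  (W0 ≔ q ;; s2 ≔ (s * s : Ex Var) ;; M ≔ (n / s + 1 : Ex Var) ;; P0 ≔ (W0 + n : Ex Var) ;;
    v ≔ 1 ;; k ≔ 0) ;; .whl (s2 + 1 - k : Ex Var) powBody

def setLayout : Pr Var :=
  B ≔ ld(P0 + s2) ;; F0 ≔ (P0 + s2 + 1 : Ex Var) ;; T0 ≔ (F0 + B * B * B : Ex Var) ;;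
  I0 ≔ (T0 + nt * (2 * M) : Ex Var) ;; D0 ≔ (I0 + W0 * M : Ex Var)

/-- The sum of the two truncated differences is nonzero exactly when `i ≠ j`. -/
def idBody : Pr Var :=
  i ≔ (e / s : Ex Var) ;; j ≔ (e - e / s * s : Ex Var) ;;
  .ite (i - j + (j - i) : Ex Var) .skip (idm ≔ (idm + ld(P0 + e) : Ex Var)) ;;
  e ≔ (e + 1 : Ex Var)

def buildId : Pr Var := (idm ≔ 0 ;; e ≔ 0) ;; .whl (s2 - e : Ex Var) idBody

def dotBody : Pr Var :=
  h ≔ (h + bitEx x (i * s + t : Ex Var) * bitEx y (t * s + j : Ex Var) : Ex Var) ;; t ≔ (t + 1 : Ex Var)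

def entryBody : Pr Var :=
  (i ≔ (e / s : Ex Var) ;; j ≔ (e - e / s * s : Ex Var) ;; h ≔ bitEx z e ;; t ≔ 0) ;;
  .whl (s - t : Ex Var) dotBody ;;
  .ite h (v ≔ (v + ld(P0 + e) : Ex Var)) .skip ;; e ≔ (e + 1 : Ex Var)

def tableBody : Pr Var :=
  (z ≔ (idx / B / B : Ex Var) ;; x ≔ (idx / B - idx / B / B * B : Ex Var) ;;
    y ≔ (idx - idx / B * B : Ex Var) ;; v ≔ 0 ;; e ≔ 0) ;;
  .whl (s2 - e : Ex Var) entryBody ;;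
  .sto (F0 + idx : Ex Var) v ;; idx ≔ (idx + 1 : Ex Var)

def buildTable : Pr Var := idx ≔ 0 ;; .whl (B * B * B - idx : Ex Var) tableBody

/-- A letter spans the positions `k` and `k + 1`, which lie in equal or adjacent blocks. The sum of
the two block indices then determines both, so `2 * M` words per terminal suffice. -/
def letterBody : Pr Var :=
  i ≔ (k / s : Ex Var) ;; j ≔ ((k + 1) / s : Ex Var) ;;
  dst ≔ (T0 + ld(W0 + k) * (2 * M) + (i + j) : Ex Var) ;;
  .sto dst (ld(dst) + ld(P0 + ((k - i * s) * s + (k + 1 - j * s))) : Ex Var) ;;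
  k ≔ (k + 1 : Ex Var)

def buildLetters : Pr Var := k ≔ 0 ;; .whl (n - k : Ex Var) letterBody

/-- Replace the matrix `Z` in the cell `dst` by `Z ∨ x · y`. -/
def update : Pr Var :=
  z ≔ ld(dst) ;; v ≔ ld(F0 + ((z * B + x) * B + y)) ;; .sto dst v ;;
  ch ≔ (ch + (v - z) : Ex Var)

/-- Load the matrix of the symbol `X` in the block `(K, J)`. -/
def loadSym : Pr Var :=
  .ite (X - X / 2 * 2 : Ex Var)
    (y ≔ ld(D0 + ((X / 2 * M + K) * M + J)))
    (.ite (J - K - 1 : Ex Var) (y ≔ 0) (y ≔ ld(T0 + X / 2 * (2 * M) + (K + J))))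

/-- The number `q` of a prefix is the input address of its last symbol, so the symbol to append is
at `q + 1` and the extended prefix has the number `q + 1`. -/
def symBody : Pr Var :=
  X ≔ ld(q + 1) ;; loadSym ;; x ≔ ld(I0 + (q * M + K)) ;;
  dst ≔ (I0 + ((q + 1) * M + J) : Ex Var) ;; update ;; q ≔ (q + 1 : Ex Var) ;; k ≔ (k + 1 : Ex Var)

/-- The product of two identity matrices puts the diagonal into the block of the empty prefix; only
diagonal blocks need it. -/
def ruleHead : Pr Var :=
  a ≔ ld(q) ;; l ≔ ld(q + 1) ;; q ≔ (q + 1 : Ex Var) ;; k ≔ 0 ;;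
  .ite (J - I : Ex Var) .skip
    (x ≔ idm ;; y ≔ idm ;; dst ≔ (I0 + (q * M + J) : Ex Var) ;; update)

/-- Multiplication by the identity makes the transfer from the full right-hand side to the left-hand
side one more `update`. -/
def ruleTail : Pr Var :=
  x ≔ ld(I0 + (q * M + J)) ;; y ≔ idm ;; dst ≔ (D0 + ((a * M + I) * M + J) : Ex Var) ;;
  update ;; q ≔ (q + 1 : Ex Var) ;; r ≔ (r + 1 : Ex Var)

def ruleBody : Pr Var := ruleHead ;; .whl (l - k : Ex Var) symBody ;; ruleTail

/-- Apply all rules once in the block `(I, J)`, with intermediate positions in the block `K`. -/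
def pass : Pr Var := (q ≔ 5 ;; r ≔ 0) ;; .whl (R - r : Ex Var) ruleBody

def clearBody : Pr Var := .sto (I0 + (q * M + J) : Ex Var) 0 ;; q ≔ (q + 1 : Ex Var)

def clear : Pr Var := (ch ≔ 0 ;; q ≔ 0) ;; .whl (W0 - q : Ex Var) clearBody

def accumulate : Pr Var := K ≔ I ;; .whl (J + 1 - K : Ex Var) (pass ;; K ≔ (K + 1 : Ex Var))

/-- Only `K = I` and `K = J` read blocks that are still changing. -/
def saturateBody : Pr Var := (ch ≔ 0 ;; K ≔ I) ;; pass ;; K ≔ J ;; pass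

def saturate : Pr Var := ch ≔ 1 ;; .whl ch saturateBody

def block : Pr Var := clear ;; accumulate ;; saturate

def row : Pr Var :=
  (I ≔ (I - 1 : Ex Var) ;; J ≔ I) ;; .whl (M - J : Ex Var) (block ;; J ≔ (J + 1 : Ex Var))

def fill : Pr Var := I ≔ M ;; .whl I row

def answer : Pr Var :=
  x ≔ ld(D0 + (ini * M * M + n / s)) ;; e ≔ (n - n / s * s : Ex Var) ;;
  out ≔ bitEx x e

def recognizer : Pr Var :=
  readHeader ;; skipRules ;; computeLog ;; computeSide ;; buildPow ;; setLayout ;; buildId ;;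
  buildTable ;; buildLetters ;; fill ;; answer

end program

end CFRec

namespace CFRec

open Imp

/-! ## Numerical instances and the memory layout -/

/-- An instance of the recognition problem, with terminals, nonterminals and rules replaced by
numbers. The symbol `2 * a` is the terminal `a`, and `2 * A + 1` is the nonterminal `A`. -/
structure Inst where
  n : ℕ
  nt : ℕ
  g : ℕ
  ini : ℕ
  R : ℕ
  lhs : ℕ → ℕ
  len : ℕ → ℕ
  sym : ℕ → ℕ → ℕ
  w : ℕ → ℕ

namespace Inst

variable (c : Inst)

/-- All numbers that occur in the instance are in range. -/
structure Valid : Prop where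
  ini_lt : c.ini < c.g
  lhs_lt : ∀ r < c.R, c.lhs r < c.g
  odd_lt : ∀ r < c.R, ∀ t < c.len r, c.sym r t % 2 = 1 → c.sym r t / 2 < c.g
  even_lt : ∀ r < c.R, ∀ t < c.len r, c.sym r t % 2 = 0 → c.sym r t / 2 < c.nt
  w_lt : ∀ k < c.n, c.w k < c.nt

/-- Offset of a rule in the list of rules. -/
def off (r : ℕ) : ℕ := ∑ r' ∈ Finset.range r, (2 + c.len r')

/-- Address of the string. -/
def W0 : ℕ := 5 + c.off c.R

/-- Side length of a block. -/
def s : ℕ := max 1 (Nat.sqrt (Nat.log 2 c.n / 16))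

/-- Number of bits of a block. -/
def s2 : ℕ := c.s * c.s

/-- Number of blocks in a row. -/
def M : ℕ := c.n / c.s + 1

/-- Address of the table of powers. -/
def P0 : ℕ := c.W0 + c.n

/-- Number of block values. -/
def B : ℕ := 2 ^ c.s2

/-- Address of the multiplication table. -/
def F0 : ℕ := c.P0 + c.s2 + 1

/-- Address of the blocks of the terminals. -/
def T0 : ℕ := c.F0 + c.B * c.B * c.B

/-- Address of the blocks of the rule prefixes. -/
def I0 : ℕ := c.T0 + c.nt * (2 * c.M)

/-- Address of the blocks of the nonterminals. -/
def D0 : ℕ := c.I0 + c.W0 * c.M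

/-- Memory size. -/
def S : ℕ := c.D0 + c.g * c.M * c.M

/-- The number of the prefix of length `t` of the right-hand side of rule `r`: the address of its
last symbol. -/
def pos (r t : ℕ) : ℕ := 5 + c.off r + 1 + t

theorem s_pos : 0 < c.s := by simp [s]

theorem M_pos : 0 < c.M := by simp [M]

theorem B_pos : 0 < c.B := by simp [B]

theorem off_succ (r : ℕ) : c.off (r + 1) = c.off r + (2 + c.len r) := by
  simp [off, Finset.sum_range_succ]

theorem off_mono {r r' : ℕ} (h : r ≤ r') : c.off r ≤ c.off r' :=
  Finset.sum_le_sum_of_subset (Finset.range_mono h)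

theorem off_lt {r r' : ℕ} (h : r < r') : c.off r + 2 + c.len r ≤ c.off r' := by
  have := c.off_mono (Nat.succ_le_of_lt h)
  rw [Nat.succ_eq_add_one, off_succ] at this
  omega

theorem pos_lt {r t : ℕ} (hr : r < c.R) (ht : t ≤ c.len r) : c.pos r t < c.W0 := by
  have := c.off_lt hr
  simp only [pos, W0]; omega

theorem pos_inj {r t r' t' : ℕ} (ht : t ≤ c.len r) (ht' : t' ≤ c.len r')
    (h : c.pos r t = c.pos r' t') : r = r' ∧ t = t' := by
  simp only [pos] at h
  rcases lt_trichotomy r r' with hr | rfl | hr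
  · have := c.off_lt hr; omega
  · exact ⟨rfl, by omega⟩
  · have := c.off_lt hr; omega

/-- `c.DerP r t i j`: the prefix of length `t` of the right-hand side of rule `r` derives the part
of the string between the positions `i` and `j`. -/
inductive DerP : ℕ → ℕ → ℕ → ℕ → Prop
  | nil (r i : ℕ) (hr : r < c.R) : DerP r 0 i i
  | term {r t i k : ℕ} (h : DerP r t i k) (ht : t < c.len r) (hk : k < c.n)
      (hs : c.sym r t = 2 * c.w k) : DerP r (t + 1) i (k + 1)
  | nont {r t i k r' j : ℕ} (h : DerP r t i k) (ht : t < c.len r)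
      (hs : c.sym r t = 2 * c.lhs r' + 1) (h' : DerP r' (c.len r') k j) : DerP r (t + 1) i j

/-- The nonterminal `A` derives the part of the string between the positions `i` and `j`. -/
def DerN (A i j : ℕ) : Prop := ∃ r, c.lhs r = A ∧ c.DerP r (c.len r) i j

/-- The symbol `X` derives the part of the string between the positions `i` and `j`. -/
def DerS (X i j : ℕ) : Prop :=
  (i < c.n ∧ X = 2 * c.w i ∧ j = i + 1) ∨ ∃ A, X = 2 * A + 1 ∧ c.DerN A i j

theorem DerP.rule_lt {c : Inst} {r t i j : ℕ} (h : c.DerP r t i j) : r < c.R := by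
  induction h <;> assumption

theorem DerP.le {c : Inst} {r t i j : ℕ} (h : c.DerP r t i j) : i ≤ j := by
  induction h <;> omega

theorem DerP.snoc {c : Inst} {r t i k j : ℕ} (h : c.DerP r t i k) (ht : t < c.len r)
    (hs : c.DerS (c.sym r t) k j) : c.DerP r (t + 1) i j := by
  rcases hs with ⟨hk, hX, rfl⟩ | ⟨A, hX, r', rfl, h'⟩
  · exact h.term ht hk hX
  · exact h.nont ht hX h'

/-! ## Blocks as bit matrices -/

/-- The entry for the positions `i` and `j` of a block. -/
def bit (v i j : ℕ) : Prop := v.testBit (i % c.s * c.s + j % c.s) = true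

/-- `v` is the block `z ∨ x · y`. -/
def IsMulAdd (z x y v : ℕ) : Prop :=
  v < c.B ∧ ∀ e < c.s2, v.testBit e = true ↔ z.testBit e = true ∨
    ∃ t < c.s, x.testBit (e / c.s * c.s + t) = true ∧ y.testBit (t * c.s + e % c.s) = true

/-- `v` is the identity matrix. -/
def IsId (v : ℕ) : Prop :=
  v < c.B ∧ ∀ e < c.s2, v.testBit e = true ↔ e / c.s = e % c.s

theorem index_lt {a b : ℕ} (ha : a < c.s) (hb : b < c.s) : a * c.s + b < c.s2 := by
  unfold s2; nlinarith

theorem bit_index_lt (i j : ℕ) : i % c.s * c.s + j % c.s < c.s2 :=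
  c.index_lt (Nat.mod_lt _ c.s_pos) (Nat.mod_lt _ c.s_pos)

theorem index_div (i j : ℕ) : (i % c.s * c.s + j % c.s) / c.s = i % c.s := by
  rw [mul_comm, Nat.mul_add_div c.s_pos, Nat.div_eq_of_lt (Nat.mod_lt _ c.s_pos), add_zero]

theorem index_mod (i j : ℕ) : (i % c.s * c.s + j % c.s) % c.s = j % c.s := by
  rw [mul_comm, Nat.mul_add_mod, Nat.mod_mod]

/-- A block value knows positions only modulo `s`, so the inner index of the product can be read as
a position in any block `K`: one table serves all intermediate blocks. -/
theorem IsMulAdd.bit {c : Inst} {z x y v : ℕ} (h : c.IsMulAdd z x y v) (K i j : ℕ) :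
    c.bit v i j ↔ c.bit z i j ∨ ∃ k, k / c.s = K ∧ c.bit x i k ∧ c.bit y k j := by
  unfold Inst.bit
  rw [h.2 _ (c.bit_index_lt i j), index_div, index_mod]
  refine or_congr_right ⟨?_, ?_⟩
  · rintro ⟨t, ht, h1, h2⟩
    have hm : (K * c.s + t) % c.s = t := by
      rw [mul_comm, Nat.mul_add_mod, Nat.mod_eq_of_lt ht]
    refine ⟨K * c.s + t, ?_, by rwa [hm], by rwa [hm]⟩
    rw [mul_comm, Nat.mul_add_div c.s_pos, Nat.div_eq_of_lt ht, add_zero]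
  · rintro ⟨k, -, h1, h2⟩
    exact ⟨k % c.s, Nat.mod_lt _ c.s_pos, h1, h2⟩

theorem IsMulAdd.mono {c : Inst} {z x y v : ℕ} (h : c.IsMulAdd z x y v) (hz : z < c.B) (e : ℕ)
    (he : z.testBit e = true) : v.testBit e = true := by
  by_cases hs : e < c.s2
  · exact (h.2 e hs).2 (Or.inl he)
  · have : z.testBit e = false :=
      Nat.testBit_lt_two_pow (lt_of_lt_of_le hz (Nat.pow_le_pow_right (by norm_num) (by omega)))
    simp [this] at he

theorem IsId.bit {c : Inst} {v : ℕ} (h : c.IsId v) (i j : ℕ) :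
    c.bit v i j ↔ i % c.s = j % c.s := by
  unfold Inst.bit
  rw [h.2 _ (c.bit_index_lt i j), index_div, index_mod]

theorem IsId.bit_iff {c : Inst} {v : ℕ} (h : c.IsId v) {i j : ℕ} (hij : i / c.s = j / c.s) :
    c.bit v i j ↔ i = j := by
  rw [h.bit]
  constructor
  · intro hm
    rw [← Nat.div_add_mod i c.s, ← Nat.div_add_mod j c.s, hij, hm]
  · rintro rfl; rfl

end Inst

/-- The first `e` binary digits of `v` are given by the predicate `P`, and there are no others. -/
def BitsUpTo (v e : ℕ) (P : ℕ → Prop) : Prop :=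
  v < 2 ^ e ∧ ∀ e' < e, v.testBit e' = true ↔ P e'

theorem BitsUpTo.succ_true {v e : ℕ} {P : ℕ → Prop} (h : BitsUpTo v e P) (hP : P e) :
    BitsUpTo (v + 2 ^ e) (e + 1) P := by
  refine ⟨by rw [pow_succ]; have := h.1; omega, fun e' he' => ?_⟩
  rw [add_comm v]
  rcases Nat.lt_succ_iff_lt_or_eq.1 he' with h' | rfl
  · rw [Nat.testBit_two_pow_add_gt h', h.2 _ h']
  · rw [Nat.testBit_two_pow_add_eq, Nat.testBit_lt_two_pow h.1]; simpa using hP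

theorem BitsUpTo.succ_false {v e : ℕ} {P : ℕ → Prop} (h : BitsUpTo v e P) (hP : ¬ P e) :
    BitsUpTo v (e + 1) P := by
  refine ⟨by rw [pow_succ]; have := h.1; omega, fun e' he' => ?_⟩
  rcases Nat.lt_succ_iff_lt_or_eq.1 he' with h' | rfl
  · exact h.2 _ h'
  · rw [Nat.testBit_lt_two_pow h.1]; simpa using hP

/-- Adding `2 ^ e` to a number whose bit `e` is clear causes no carry, so addition sets exactly that
bit. -/
theorem testBit_add_two_pow {v e : ℕ} (h : v.testBit e = false) (e' : ℕ) :
    (v + 2 ^ e).testBit e' = true ↔ v.testBit e' = true ∨ e' = e := by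
  have hb : v % 2 ^ e < 2 ^ e := Nat.mod_lt _ (by positivity)
  have hv : v = 2 ^ (e + 1) * (v / 2 ^ (e + 1)) + v % 2 ^ e := by
    have h1 : v / 2 ^ e % 2 = 0 := by
      rw [Nat.testBit_eq_decide_div_mod_eq] at h
      simp at h; omega
    have h2 : v / 2 ^ (e + 1) = v / 2 ^ e / 2 := by rw [pow_succ, Nat.div_div_eq_div_mul]
    have h3 : v / 2 ^ e = 2 * (v / 2 ^ e / 2) := by omega
    rw [h2, pow_succ, mul_assoc, ← h3, Nat.div_add_mod]
  generalize v / 2 ^ (e + 1) = a at hv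
  generalize v % 2 ^ e = b at hv hb
  subst hv
  rw [add_assoc, Nat.testBit_two_pow_mul_add _ (by rw [pow_succ]; omega),
    Nat.testBit_two_pow_mul_add _ (by rw [pow_succ]; omega), add_comm b]
  rcases lt_trichotomy e' e with h' | rfl | h'
  · simp [Nat.lt_succ_of_lt h', Nat.testBit_two_pow_add_gt h', h'.ne]
  · simp [Nat.testBit_two_pow_add_eq, Nat.testBit_lt_two_pow hb]
  · have : ¬ e' < e + 1 := by omega
    simp [this, h'.ne']

end CFRec

namespace CFRec

open Imp

theorem pair_lt {a b A m : ℕ} (ha : a < A) (hb : b < m) : a * m + b < A * m := by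
  calc a * m + b < a * m + m := by omega
    _ = (a + 1) * m := by ring
    _ ≤ A * m := Nat.mul_le_mul_right _ ha

theorem pair_inj {a b a' b' m : ℕ} (hb : b < m) (hb' : b' < m) (h : a * m + b = a' * m + b') :
    a = a' ∧ b = b' := by
  have hm : 0 < m := by omega
  have h1 : (a * m + b) / m = a := by
    rw [mul_comm, Nat.mul_add_div hm, Nat.div_eq_of_lt hb, add_zero]
  have h2 : (a' * m + b') / m = a' := by
    rw [mul_comm, Nat.mul_add_div hm, Nat.div_eq_of_lt hb', add_zero]
  have h3 : a = a' := by rw [← h1, ← h2, h]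
  subst h3
  exact ⟨rfl, by omega⟩

namespace Inst

variable (c : Inst)

/-! ## Contents of the memory -/

/-- Address of a block of a rule prefix. -/
def aItm (q J : ℕ) : ℕ := c.I0 + (q * c.M + J)

/-- Address of a block of a nonterminal. -/
def aNt (A I J : ℕ) : ℕ := c.D0 + ((A * c.M + I) * c.M + J)

theorem le_aItm (q J : ℕ) : c.I0 ≤ c.aItm q J := Nat.le_add_right _ _

theorem aItm_lt {q J : ℕ} (hq : q < c.W0) (hJ : J < c.M) : c.aItm q J < c.D0 := by
  have := pair_lt hq hJ
  unfold aItm D0; omega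

theorem le_aNt (A I J : ℕ) : c.D0 ≤ c.aNt A I J := Nat.le_add_right _ _

theorem aNt_lt {A I J : ℕ} (hA : A < c.g) (hI : I < c.M) (hJ : J < c.M) : c.aNt A I J < c.S := by
  have := pair_lt (pair_lt hA hI) hJ
  unfold aNt S; omega

theorem aItm_inj {q J q' J' : ℕ} (hJ : J < c.M) (hJ' : J' < c.M)
    (h : c.aItm q J = c.aItm q' J') : q = q' ∧ J = J' :=
  pair_inj hJ hJ' (by unfold aItm at h; omega)

theorem aNt_inj {A I J A' I' J' : ℕ} (hI : I < c.M) (hI' : I' < c.M) (hJ : J < c.M)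
    (hJ' : J' < c.M) (h : c.aNt A I J = c.aNt A' I' J') : A = A' ∧ I = I' ∧ J = J' := by
  obtain ⟨h1, h2⟩ := pair_inj (a := A * c.M + I) (a' := A' * c.M + I') hJ hJ'
    (by unfold aNt at h; omega)
  obtain ⟨h3, h4⟩ := pair_inj hI hI' h1
  exact ⟨h3, h4, h2⟩

theorem I0_le_D0 : c.I0 ≤ c.D0 := Nat.le_add_right _ _
theorem D0_le_S : c.D0 ≤ c.S := Nat.le_add_right _ _
theorem T0_le_I0 : c.T0 ≤ c.I0 := Nat.le_add_right _ _
theorem F0_le_T0 : c.F0 ≤ c.T0 := Nat.le_add_right _ _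
theorem P0_lt_F0 : c.P0 + c.s2 < c.F0 := by unfold F0; omega

/-- The rules and the string are in their places. -/
structure Inp (m : ℕ → ℕ) : Prop where
  lhs : ∀ r < c.R, m (5 + c.off r) = c.lhs r
  len : ∀ r < c.R, m (5 + c.off r + 1) = c.len r
  sym : ∀ r < c.R, ∀ t < c.len r, m (c.pos r t + 1) = c.sym r t
  w : ∀ k < c.n, m (c.W0 + k) = c.w k

/-- The table of powers. -/
def Pow (m : ℕ → ℕ) : Prop := ∀ e ≤ c.s2, m (c.P0 + e) = 2 ^ e

/-- The multiplication table. -/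
def Table (m : ℕ → ℕ) : Prop :=
  ∀ z < c.B, ∀ x < c.B, ∀ y < c.B, c.IsMulAdd z x y (m (c.F0 + ((z * c.B + x) * c.B + y)))

/-- The blocks of the terminals. -/
def Letters (m : ℕ → ℕ) : Prop :=
  ∀ a < c.nt, ∀ k j, j / c.s < c.M → k / c.s ≤ j / c.s → j / c.s ≤ k / c.s + 1 →
    (c.bit (m (c.T0 + a * (2 * c.M) + (k / c.s + j / c.s))) k j ↔ k < c.n ∧ c.w k = a ∧ j = k + 1)

/-- The part of the memory that is not changed while the blocks are filled in. -/
structure Static (m : ℕ → ℕ) : Prop where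
  inp : c.Inp m
  pow : c.Pow m
  table : c.Table m
  letters : c.Letters m

variable {c}

theorem Inp.congr {m m' : ℕ → ℕ} (h : c.Inp m) (hm : ∀ a < c.P0, m' a = m a) : c.Inp m' := by
  have hP : c.P0 = c.W0 + c.n := rfl
  refine ⟨fun r hr => ?_, fun r hr => ?_, fun r hr t ht => ?_, fun k hk => ?_⟩
  · rw [hm _ ?_, h.lhs r hr]
    have := c.pos_lt hr (Nat.zero_le _); unfold pos at this; omega
  · rw [hm _ ?_, h.len r hr]
    have := c.pos_lt hr (Nat.zero_le _); unfold pos at this; omega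
  · rw [hm _ ?_, h.sym r hr t ht]
    have := c.pos_lt hr (Nat.succ_le_of_lt ht); unfold pos at *; omega
  · rw [hm _ (by omega), h.w k hk]

theorem Pow.congr {m m' : ℕ → ℕ} (h : c.Pow m) (hm : ∀ a < c.F0, m' a = m a) : c.Pow m' := by
  intro e he
  rw [hm _ (by have := c.P0_lt_F0; omega), h e he]

theorem table_index_lt {z x y : ℕ} (hz : z < c.B) (hx : x < c.B) (hy : y < c.B) :
    c.F0 + ((z * c.B + x) * c.B + y) < c.T0 := by
  have := pair_lt (pair_lt hz hx) hy
  unfold T0; omega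

theorem Table.congr {m m' : ℕ → ℕ} (h : c.Table m) (hm : ∀ a < c.T0, m' a = m a) :
    c.Table m' := by
  intro z hz x hx y hy
  rw [hm _ (table_index_lt hz hx hy)]
  exact h z hz x hx y hy

theorem letter_index_lt {a b : ℕ} (ha : a < c.nt) (hb : b < 2 * c.M) :
    c.T0 + a * (2 * c.M) + b < c.I0 := by
  have := pair_lt ha hb
  unfold I0; omega

theorem Letters.congr {m m' : ℕ → ℕ} (h : c.Letters m) (hm : ∀ a < c.I0, m' a = m a) :
    c.Letters m' := by
  intro a ha k j hj hk hkj
  rw [hm _ (letter_index_lt ha (by omega))]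
  exact h a ha k j hj hk hkj

theorem Static.congr {m m' : ℕ → ℕ} (h : c.Static m) (hm : ∀ a < c.I0, m' a = m a) :
    c.Static m' := by
  have h1 := c.P0_lt_F0
  have h2 := c.F0_le_T0
  have h3 := c.T0_le_I0
  exact ⟨h.inp.congr fun a ha => hm a (by omega), h.pow.congr fun a ha => hm a (by omega),
    h.table.congr fun a ha => hm a (by omega), h.letters.congr hm⟩

/-! ### Soundness and completeness of blocks. -/

variable (c)

/-- Soundness of the blocks of the rule prefixes in the row block `I` and the column block `J`. -/
def ISound (I J : ℕ) (m : ℕ → ℕ) : Prop :=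
  ∀ q < c.W0, ∀ i j, i / c.s = I → j / c.s = J → c.bit (m (c.aItm q J)) i j →
    ∃ r t, t ≤ c.len r ∧ q = c.pos r t ∧ c.DerP r t i j

/-- Completeness of the blocks of the rule prefixes in the row block `I` and the column block
`J`. -/
def IComp (I J : ℕ) (m : ℕ → ℕ) : Prop :=
  ∀ r t i j, i / c.s = I → j / c.s = J → c.DerP r t i j → c.bit (m (c.aItm (c.pos r t) J)) i j

/-- Soundness of the blocks of the nonterminals. -/
def NSound (m : ℕ → ℕ) : Prop :=
  ∀ A < c.g, ∀ i j, i / c.s < c.M → j / c.s < c.M → c.bit (m (c.aNt A (i / c.s) (j / c.s))) i j →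
    c.DerN A i j

/-- Completeness of the blocks of the nonterminals in the row block `I` and the column block
`J`. -/
def NComp (I J : ℕ) (m : ℕ → ℕ) : Prop :=
  ∀ A i j, i / c.s = I → j / c.s = J → c.DerN A i j → c.bit (m (c.aNt A I J)) i j

/-- The memory is as it should be while the block `(I, J)` is filled in, except for
completeness. -/
structure Good (I J : ℕ) (m : ℕ → ℕ) : Prop where
  static : c.Static m
  rng : ∀ a, c.T0 ≤ a → m a < c.B
  isound : ∀ J', I ≤ J' → J' ≤ J → c.ISound I J' m
  nsound : c.NSound m

variable {c}

theorem Good.update_item {I J q v : ℕ} {m : ℕ → ℕ} (h : c.Good I J m) (hJ : J < c.M)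
    (hq : q < c.W0) (hv : v < c.B)
    (hb : ∀ i j, i / c.s = I → j / c.s = J → c.bit v i j →
      ∃ r t, t ≤ c.len r ∧ q = c.pos r t ∧ c.DerP r t i j) :
    c.Good I J (Function.update m (c.aItm q J) v) := by
  refine ⟨h.static.congr fun a ha => ?_, fun a ha => ?_, ?_, ?_⟩
  · exact Function.update_of_ne (by have := c.le_aItm q J; omega) _ _
  · rw [Function.update_apply]; split_ifs
    · exact hv
    · exact h.rng a ha
  · intro J' hI hJ' q' hq' i j hi hj hbit
    by_cases he : c.aItm q' J' = c.aItm q J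
    · obtain ⟨rfl, rfl⟩ := c.aItm_inj (by omega) hJ he
      rw [Function.update_self] at hbit
      exact hb i j hi hj hbit
    · rw [Function.update_of_ne he] at hbit
      exact h.isound J' hI hJ' q' hq' i j hi hj hbit
  · intro A hA i j hi hj hbit
    rw [Function.update_of_ne ?_] at hbit
    · exact h.nsound A hA i j hi hj hbit
    · have := c.aItm_lt hq hJ
      have := c.le_aNt A (i / c.s) (j / c.s)
      omega

theorem Good.update_nt {I J A v : ℕ} {m : ℕ → ℕ} (h : c.Good I J m) (hI : I < c.M) (hJ : J < c.M)
    (hv : v < c.B)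
    (hb : ∀ i j, i / c.s = I → j / c.s = J → c.bit v i j → c.DerN A i j) :
    c.Good I J (Function.update m (c.aNt A I J) v) := by
  have h0 := c.le_aNt A I J
  refine ⟨h.static.congr fun a ha => ?_, fun a ha => ?_, ?_, ?_⟩
  · exact Function.update_of_ne (by have := c.I0_le_D0; omega) _ _
  · rw [Function.update_apply]; split_ifs
    · exact hv
    · exact h.rng a ha
  · intro J' hI hJ' q' hq' i j hi hj hbit
    rw [Function.update_of_ne ?_] at hbit
    · exact h.isound J' hI hJ' q' hq' i j hi hj hbit
    · have := c.aItm_lt hq' (J := J') (by omega)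
      omega
  · intro A' hA' i j hi hj hbit
    by_cases he : c.aNt A' (i / c.s) (j / c.s) = c.aNt A I J
    · obtain ⟨rfl, h1, h2⟩ := c.aNt_inj hi hI hj hJ he
      rw [he, Function.update_self] at hbit
      exact hb i j h1 h2 hbit
    · rw [Function.update_of_ne he] at hbit
      exact h.nsound A' hA' i j hi hj hbit

/-! ### Growth of a block and the change counter. -/

variable (c)

/-- The cells that are written while the block `(I, J)` is filled in. -/
def cells (I J : ℕ) : Finset ℕ :=
  (Finset.range c.W0).image (fun q => c.aItm q J) ∪ (Finset.range c.g).image (fun A => c.aNt A I J)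

theorem card_cells_le (I J : ℕ) : (c.cells I J).card ≤ c.W0 + c.g := by
  refine (Finset.card_union_le _ _).trans (Nat.add_le_add ?_ ?_)
  · exact Finset.card_image_le.trans (by simp)
  · exact Finset.card_image_le.trans (by simp)

theorem aItm_mem_cells {q : ℕ} (I J : ℕ) (hq : q < c.W0) : c.aItm q J ∈ c.cells I J :=
  Finset.mem_union_left _ (Finset.mem_image.2 ⟨q, Finset.mem_range.2 hq, rfl⟩)

theorem aNt_mem_cells {A : ℕ} (I J : ℕ) (hA : A < c.g) : c.aNt A I J ∈ c.cells I J :=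
  Finset.mem_union_right _ (Finset.mem_image.2 ⟨A, Finset.mem_range.2 hA, rfl⟩)

theorem aItm_not_mem_cells {q I J K : ℕ} (hq : q < c.W0) (hJ : J < c.M) (hK : K < c.M)
    (h : K ≠ J) : c.aItm q K ∉ c.cells I J := by
  intro hmem
  rcases Finset.mem_union.1 hmem with h' | h'
  · obtain ⟨q', -, he⟩ := Finset.mem_image.1 h'
    exact h (c.aItm_inj hJ hK he).2.symm
  · obtain ⟨A, -, he⟩ := Finset.mem_image.1 h'
    have := c.aItm_lt hq hK
    have := c.le_aNt A I J
    omega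

theorem aNt_not_mem_cells {A I J I' J' : ℕ} (hI : I < c.M) (hJ : J < c.M) (hI' : I' < c.M)
    (hJ' : J' < c.M) (h : ¬ (I' = I ∧ J' = J)) : c.aNt A I' J' ∉ c.cells I J := by
  intro hmem
  rcases Finset.mem_union.1 hmem with h' | h'
  · obtain ⟨q', hq', he⟩ := Finset.mem_image.1 h'
    have := c.aItm_lt (Finset.mem_range.1 hq') hJ
    have := c.le_aNt A I' J'
    omega
  · obtain ⟨A', -, he⟩ := Finset.mem_image.1 h'
    obtain ⟨-, h1, h2⟩ := c.aNt_inj hI hI' hJ hJ' he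
    exact h ⟨h1.symm, h2.symm⟩

theorem not_mem_cells_of_lt {a I J : ℕ} (ha : a < c.I0) : a ∉ c.cells I J := by
  intro hmem
  rcases Finset.mem_union.1 hmem with h' | h'
  · obtain ⟨q', -, he⟩ := Finset.mem_image.1 h'
    have := c.le_aItm q' J; omega
  · obtain ⟨A', -, he⟩ := Finset.mem_image.1 h'
    have := c.le_aNt A' I J
    have := c.I0_le_D0
    omega

theorem T0_le_of_mem_cells {a I J : ℕ} (h : a ∈ c.cells I J) : c.T0 ≤ a := by
  by_contra ha
  exact c.not_mem_cells_of_lt (by have := c.T0_le_I0; omega) h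

/-- The sum of the cells of the block `(I, J)`. -/
def total (I J : ℕ) (m : ℕ → ℕ) : ℕ := ∑ a ∈ c.cells I J, m a

theorem total_le {I J : ℕ} {m : ℕ → ℕ} (h : ∀ a, c.T0 ≤ a → m a < c.B) :
    c.total I J m ≤ (c.W0 + c.g) * c.B := by
  refine (Finset.sum_le_card_nsmul _ _ c.B fun a ha => (h a (c.T0_le_of_mem_cells ha)).le).trans ?_
  rw [smul_eq_mul]
  exact Nat.mul_le_mul_right _ (c.card_cells_le I J)

/-- The memory has grown from `m` to `m'`, with changes in the block `(I, J)` only, and the change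
counter has gone from `ch` to `ch'`. -/
structure Grow (I J : ℕ) (m : ℕ → ℕ) (ch : ℕ) (m' : ℕ → ℕ) (ch' : ℕ) : Prop where
  frame : ∀ a, a ∉ c.cells I J → m' a = m a
  mono : ∀ a e, (m a).testBit e = true → (m' a).testBit e = true
  sum : c.total I J m + ch' = c.total I J m' + ch

variable {c}

theorem Grow.refl (I J : ℕ) (m : ℕ → ℕ) (ch : ℕ) : c.Grow I J m ch m ch :=
  ⟨fun _ _ => rfl, fun _ _ => id, rfl⟩

theorem Grow.trans {I J ch ch' ch'' : ℕ} {m m' m'' : ℕ → ℕ} (h : c.Grow I J m ch m' ch')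
    (h' : c.Grow I J m' ch' m'' ch'') : c.Grow I J m ch m'' ch'' :=
  ⟨fun a ha => (h'.frame a ha).trans (h.frame a ha), fun a e he => h'.mono a e (h.mono a e he),
    by have := h.sum; have := h'.sum; omega⟩

/-- A word that gains bits grows as a number, so the truncated difference `v - m a` is exact and the
counter records the growth of the total. -/
theorem Grow.update {I J : ℕ} {m : ℕ → ℕ} {ch a v : ℕ} (ha : a ∈ c.cells I J)
    (hv : ∀ e, (m a).testBit e = true → v.testBit e = true) :
    c.Grow I J m ch (Function.update m a v) (ch + (v - m a)) := by
  refine ⟨fun b hb => Function.update_of_ne (fun h => hb (by rwa [h])) _ _, fun b e he => ?_, ?_⟩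
  · by_cases h : b = a
    · subst h; rw [Function.update_self]; exact hv e he
    · rwa [Function.update_of_ne h]
  · have h1 : m a ≤ v := Nat.le_of_testBit hv
    unfold total
    rw [Finset.sum_update_of_mem ha, ← Finset.add_sum_erase _ _ ha, Finset.sdiff_singleton_eq_erase]
    omega

/-- If the change counter has not changed, neither has the memory. -/
theorem Grow.eq {I J ch : ℕ} {m m' : ℕ → ℕ} (h : c.Grow I J m ch m' ch) : m' = m := by
  -- Bitwise growth implies numerical growth, so equality of the sums forces equality in each cell.
  have h1 : ∀ a ∈ c.cells I J, m a ≤ m' a := fun a _ => Nat.le_of_testBit (h.mono a)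
  have h2 : c.total I J m = c.total I J m' := by have := h.sum; omega
  funext a
  by_cases ha : a ∈ c.cells I J
  · exact ((Finset.sum_eq_sum_iff_of_le h1).1 h2 a ha).symm
  · exact h.frame a ha

theorem Grow.le {I J ch ch' : ℕ} {m m' : ℕ → ℕ} (h : c.Grow I J m ch m' ch') : ch ≤ ch' := by
  have h1 : c.total I J m ≤ c.total I J m' :=
    Finset.sum_le_sum fun a _ => Nat.le_of_testBit (h.mono a)
  have := h.sum
  omega

/-! ### Closure of a block under the rules. -/

variable (c)

/-- The block `(K, J)` of the symbol `X`. -/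
def symBlock (m : ℕ → ℕ) (X K J : ℕ) : ℕ :=
  if X % 2 = 1 then m (c.aNt (X / 2) K J)
  else if J - K - 1 ≠ 0 then 0 else m (c.T0 + X / 2 * (2 * c.M) + (K + J))

/-- All extensions of prefixes of rule `r` that are possible in the block `(I, J)` of `m₀`, with
intermediate positions in the block `K`, have been made in `m`. -/
def StepClosed (I J K : ℕ) (m₀ m : ℕ → ℕ) (r : ℕ) : Prop :=
  ∀ t < c.len r, ∀ i k j, i / c.s = I → k / c.s = K → j / c.s = J →
    c.bit (m₀ (c.aItm (c.pos r t) K)) i k → c.bit (c.symBlock m₀ (c.sym r t) K J) k j →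
    c.bit (m (c.aItm (c.pos r (t + 1)) J)) i j

/-- All applications of rule `r` that are possible in the block `(I, J)` of `m₀`, with intermediate
positions in the block `K`, have been made in `m`. -/
structure Closed (I J K : ℕ) (m₀ m : ℕ → ℕ) (r : ℕ) : Prop where
  init : I = J → ∀ i, i / c.s = I → c.bit (m (c.aItm (c.pos r 0) J)) i i
  step : c.StepClosed I J K m₀ m r
  fin : ∀ i j, i / c.s = I → j / c.s = J → c.bit (m₀ (c.aItm (c.pos r (c.len r)) J)) i j →
    c.bit (m (c.aNt (c.lhs r) I J)) i j

variable {c}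

theorem Closed.mono {I J K : ℕ} {m₀ m m' : ℕ → ℕ} {r : ℕ} (h : c.Closed I J K m₀ m r)
    (hm : ∀ a e, (m a).testBit e = true → (m' a).testBit e = true) :
    c.Closed I J K m₀ m' r :=
  ⟨fun h0 i hi => hm _ _ (h.init h0 i hi),
    fun t ht i k j hi hk hj h1 h2 => hm _ _ (h.step t ht i k j hi hk hj h1 h2),
    fun i j hi hj h1 => hm _ _ (h.fin i j hi hj h1)⟩

theorem symBlock_mono {m m' : ℕ → ℕ}
    (hm : ∀ a e, (m a).testBit e = true → (m' a).testBit e = true) {X K J k j : ℕ}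
    (h : c.bit (c.symBlock m X K J) k j) : c.bit (c.symBlock m' X K J) k j := by
  unfold symBlock at *
  split_ifs at * with h1 h2
  · exact hm _ _ h
  · exact h
  · exact hm _ _ h

theorem symBlock_lt {m : ℕ → ℕ} (hm : ∀ a, c.T0 ≤ a → m a < c.B) (X K J : ℕ) :
    c.symBlock m X K J < c.B := by
  unfold symBlock
  split_ifs
  · exact hm _ (by have := c.le_aNt (X / 2) K J; have := c.I0_le_D0; have := c.T0_le_I0; omega)
  · exact c.B_pos
  · exact hm _ (by omega)

/-- Soundness of the blocks of the symbols. -/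
theorem symBlock_sound (hc : c.Valid) {m : ℕ → ℕ} (hs : c.Letters m) (hN : c.NSound m) {r t k j : ℕ}
    (hr : r < c.R) (ht : t < c.len r) (hj : j / c.s < c.M) (hkj : k / c.s ≤ j / c.s)
    (h : c.bit (c.symBlock m (c.sym r t) (k / c.s) (j / c.s)) k j) : c.DerS (c.sym r t) k j := by
  unfold symBlock at h
  split_ifs at h with h1 h2
  · exact Or.inr ⟨c.sym r t / 2, by omega, hN _ (hc.odd_lt r hr t ht h1) k j (by omega) hj h⟩
  · simp [bit] at h
  · have hev : c.sym r t % 2 = 0 := by omega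
    obtain ⟨h3, h4, h5⟩ := (hs _ (hc.even_lt r hr t ht hev) k j hj hkj (by omega)).1 h
    exact Or.inl ⟨h3, by omega, h5⟩

/-- Completeness of the blocks of the letters. -/
theorem symBlock_letter (hc : c.Valid) {m : ℕ → ℕ} (hs : c.Letters m) {k : ℕ} (hk : k < c.n)
    (hM : (k + 1) / c.s < c.M) :
    c.bit (c.symBlock m (2 * c.w k) (k / c.s) ((k + 1) / c.s)) k (k + 1) := by
  have h1 : (k + 1) / c.s ≤ k / c.s + 1 := by
    calc (k + 1) / c.s ≤ (k + c.s) / c.s := Nat.div_le_div_right (by have := c.s_pos; omega)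
      _ = k / c.s + 1 := Nat.add_div_right _ c.s_pos
  have h2 : ¬ (2 * c.w k) % 2 = 1 := by omega
  have h3 : ¬ ((k + 1) / c.s - k / c.s - 1 ≠ 0) := by omega
  have h4 : 2 * c.w k / 2 = c.w k := by omega
  unfold symBlock
  rw [if_neg h2, if_neg h3, h4]
  exact (hs _ (hc.w_lt k hk) k (k + 1) hM (Nat.div_le_div_right (by omega)) h1).2 ⟨hk, rfl, rfl⟩

/-- For `I < K < J` the two factors, a prefix block in column `K` and a symbol block in `(K, J)`,
lie outside the cells written for `(I, J)`. Closure through such a `K` therefore survives all later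
work on the block, and one pass is enough. -/
theorem StepClosed.grow (hc : c.Valid) {I J K ch ch' r : ℕ} {m₀ m m' : ℕ → ℕ}
    (h : c.StepClosed I J K m₀ m r) (hr : r < c.R) (hIK : I < K) (hKJ : K < J) (hJ : J < c.M)
    (hg : c.Grow I J m₀ ch m' ch')
    (hm : ∀ a e, (m a).testBit e = true → (m' a).testBit e = true) :
    c.StepClosed I J K m' m' r := by
  intro t ht i k j hi hk hj hb1 hb2
  refine hm _ _ (h t ht i k j hi hk hj ?_ ?_)
  · rwa [hg.frame _ (c.aItm_not_mem_cells (c.pos_lt hr ht.le) hJ (by omega) (by omega))] at hb1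
  · unfold symBlock at hb2 ⊢
    split_ifs at hb2 ⊢ with h1 h2
    · rwa [hg.frame _ (c.aNt_not_mem_cells (by omega) hJ (by omega) hJ (by omega))] at hb2
    · exact hb2
    · rwa [hg.frame _ (c.not_mem_cells_of_lt
        (letter_index_lt (hc.even_lt r hr t ht (by omega)) (by omega)))] at hb2

/-- Once no rule can be applied any more, the block `(I, J)` is complete. -/
theorem complete_of_closed (hc : c.Valid) {I J : ℕ} {m : ℕ → ℕ} (hs : c.Letters m)
    (hJ : J < c.M) (hI : ∀ J', I ≤ J' → J' < J → c.IComp I J' m)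
    (hN : ∀ I', I < I' → I' < c.M → c.NComp I' J m)
    (hst : ∀ K, I ≤ K → K ≤ J → ∀ r < c.R, c.StepClosed I J K m m r)
    (hcl : ∀ r < c.R, c.Closed I J I m m r) :
    c.IComp I J m ∧ c.NComp I J m := by
  -- The end `j` may lie in any block up to `J`: the prefixes met in the induction can end further
  -- to the left, where `hI` already gives completeness.
  have key : ∀ r t i j, c.DerP r t i j → i / c.s = I → j / c.s ≤ J →
      c.bit (m (c.aItm (c.pos r t) (j / c.s))) i j := by
    intro r t i j h
    have hlt : ∀ {r t i j}, c.DerP r t i j → i / c.s = I → j / c.s < J →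
        c.bit (m (c.aItm (c.pos r t) (j / c.s))) i j := fun h hi hj =>
      hI _ (hi ▸ Nat.div_le_div_right h.le) hj _ _ _ _ hi rfl h
    induction h with
    | nil r i hr =>
      intro hi hj
      rcases hj.lt_or_eq with hj' | hj'
      · exact hlt (.nil r i hr) hi hj'
      · rw [hj']
        exact (hcl r hr).init (by omega) i hi
    | @term r t i k h ht hk hsym ih =>
      intro hi hj
      rcases hj.lt_or_eq with hj' | hj'
      · exact hlt (h.term ht hk hsym) hi hj'
      · have h1 : k / c.s ≤ (k + 1) / c.s := Nat.div_le_div_right (by omega)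
        have h2 : I ≤ k / c.s := hi ▸ Nat.div_le_div_right h.le
        have h3 := symBlock_letter hc hs hk (by omega)
        rw [hj'] at h3 ⊢
        refine hst (k / c.s) h2 (by omega) r h.rule_lt t ht i k _ hi rfl hj'
          (ih hi (by omega)) ?_
        rwa [hsym]
    | @nont r t i k r' j h ht hsym h' ih ih' =>
      intro hi hj
      rcases hj.lt_or_eq with hj' | hj'
      · exact hlt (h.nont ht hsym h') hi hj'
      · have h1 : k / c.s ≤ j / c.s := Nat.div_le_div_right h'.le
        have h2 : I ≤ k / c.s := hi ▸ Nat.div_le_div_right h.le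
        rw [hj'] at ih' ⊢
        refine hst (k / c.s) h2 (by omega) r h.rule_lt t ht i k _ hi rfl hj'
          (ih hi (by omega)) ?_
        have h3 : (2 * c.lhs r' + 1) % 2 = 1 := by omega
        have h4 : (2 * c.lhs r' + 1) / 2 = c.lhs r' := by omega
        unfold symBlock
        rw [hsym, if_pos h3, h4]
        -- The inner nonterminal belongs to the block `(k / s, J)`. In a later row this block is
        -- complete by `hN`. In row `I` it is the block in question, and the induction hypothesis
        -- for the inner rule is followed by its closing step `fin`.
        rcases h2.lt_or_eq with h5 | h5
        · exact hN _ h5 (by omega) _ k j rfl hj' ⟨r', rfl, h'⟩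
        · rw [← h5]
          exact (hcl r' h'.rule_lt).fin k j h5.symm hj' (ih' h5.symm le_rfl)
  constructor
  · intro r t i j hi hj h
    have := key r t i j h hi hj.le
    rwa [hj] at this
  · rintro A i j hi hj ⟨r, rfl, h⟩
    have := key r _ i j h hi hj.le
    rw [hj] at this
    exact (hcl r h.rule_lt).fin i j hi hj this

end Inst

end CFRec

/-! ### One pass over the rules in a block. -/

namespace CFRec

open Imp

set_option linter.unusedSimpArgs false

variable {c : Inst} {W : ℕ}

/-- Words are long enough. -/
def Inst.Fits (c : Inst) (W : ℕ) : Prop := 64 * (c.S + 1) ^ 2 ≤ 2 ^ W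

/-- Addresses and indices are at most linear in `S`, so this slack reduces nearly every overflow
condition to linear arithmetic. -/
theorem Inst.Fits.lt (h : c.Fits W) {a : ℕ} (ha : a ≤ 60 * c.S + 60) : a < 2 ^ W := by
  unfold Inst.Fits at h
  nlinarith

/-- The variables that hold the parameters of the instance have their final values. -/
structure Env₀ (c : Inst) (σ : St Var) : Prop where
  n : σ.reg .n = c.n
  ini : σ.reg .ini = c.ini
  R : σ.reg .R = c.R
  W0 : σ.reg .W0 = c.W0
  s : σ.reg .s = c.s
  s2 : σ.reg .s2 = c.s2
  M : σ.reg .M = c.M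
  P0 : σ.reg .P0 = c.P0
  B : σ.reg .B = c.B
  F0 : σ.reg .F0 = c.F0
  T0 : σ.reg .T0 = c.T0
  I0 : σ.reg .I0 = c.I0
  D0 : σ.reg .D0 = c.D0

/-- In addition, the variable for the identity matrix has its value. -/
structure Env (c : Inst) (σ : St Var) : Prop extends Env₀ c σ where
  idm : c.IsId (σ.reg .idm)

def envVars : List Var := [.n, .ini, .R, .W0, .s, .s2, .M, .P0, .B, .F0, .T0, .I0, .D0]

theorem Env₀.frame {s s' : St Var} (h : Env₀ c s) {p : Pr Var}
    (hf : ∀ u, p.writes u = false → s'.reg u = s.reg u)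
    (hp : envVars.all (fun u => !p.writes u) = true) : Env₀ c s' := by
  simp only [envVars, List.all_cons, List.all_nil, Bool.and_true, Bool.and_eq_true,
    Bool.not_eq_true'] at hp
  obtain ⟨h1, h2, h3, h4, h5, h6, h7, h8, h9, h10, h11, h12, h13⟩ := hp
  exact ⟨(hf _ h1).trans h.n, (hf _ h2).trans h.ini, (hf _ h3).trans h.R, (hf _ h4).trans h.W0,
    (hf _ h5).trans h.s, (hf _ h6).trans h.s2, (hf _ h7).trans h.M, (hf _ h8).trans h.P0,
    (hf _ h9).trans h.B, (hf _ h10).trans h.F0, (hf _ h11).trans h.T0, (hf _ h12).trans h.I0,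
    (hf _ h13).trans h.D0⟩

theorem Env.frame {s s' : St Var} (h : Env c s) {p : Pr Var}
    (hf : ∀ u, p.writes u = false → s'.reg u = s.reg u)
    (hp : (Var.idm :: envVars).all (fun u => !p.writes u) = true) : Env c s' := by
  simp only [List.all_cons, Bool.and_eq_true, Bool.not_eq_true'] at hp
  exact ⟨h.toEnv₀.frame hf hp.2, (hf _ hp.1).symm ▸ h.idm⟩

theorem Env.set {s : St Var} (h : Env c s) {u : Var}
    (hu : (Var.idm :: envVars).contains u = false) (v : ℕ) : Env c (s.set u v) := by
  refine h.frame (p := .set u (0 : Ex Var)) (fun u' hu' => ?_) ?_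
  · simp only [Pr.writes, decide_eq_false_iff_not] at hu'
    simp [hu']
  · rw [List.all_eq_true]
    intro u' hu'
    have : u' ≠ u := by rintro rfl; simp_all
    simp [Pr.writes, this]

namespace Inst

theorem B_le_S : c.B ≤ c.S := by
  have h1 := c.F0_le_T0
  have h2 := c.T0_le_I0
  have h3 := c.I0_le_D0
  have h4 := c.D0_le_S
  have h5 := c.B_pos
  have : c.B ≤ c.B * c.B * c.B := by
    rw [mul_assoc]; exact Nat.le_mul_of_pos_right _ (Nat.mul_pos h5 h5)
  unfold T0 at *
  omega

theorem W0_le_S : c.W0 ≤ c.S := by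
  have h2 := c.F0_le_T0
  have h3 := c.T0_le_I0
  have h4 := c.I0_le_D0
  have h5 := c.D0_le_S
  have h6 := c.P0_lt_F0
  unfold P0 at *
  omega

theorem g_le_S : c.g ≤ c.S := by
  have h5 := c.M_pos
  have : c.g ≤ c.g * c.M * c.M := by
    rw [mul_assoc]; exact Nat.le_mul_of_pos_right _ (Nat.mul_pos h5 h5)
  unfold S
  omega

theorem nt_le_S : c.nt ≤ c.S := by
  have h5 := c.M_pos
  have : c.nt ≤ c.nt * (2 * c.M) := Nat.le_mul_of_pos_right _ (by omega)
  have := c.I0_le_D0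
  have := c.D0_le_S
  unfold I0 at *
  omega

theorem M_le_S : c.M ≤ c.S := by
  have h5 : 0 < c.W0 := by unfold W0; omega
  have : c.M ≤ c.W0 * c.M := Nat.le_mul_of_pos_left _ h5
  have := c.D0_le_S
  unfold D0 at *
  omega

end Inst

/-- The running time of one update of a block. -/
theorem update_wp (hW : c.Fits W) {s : St Var} {Q : St Var → Prop} {d : ℕ} (henv : Env c s)
    (ht : c.Table s.mem) (hx : s.reg .x < c.B) (hy : s.reg .y < c.B) (hd : s.reg .dst = d)
    (hdS : d < c.S) (hz : s.mem d < c.B) (hch : s.reg .ch ≤ (c.W0 + c.g) * c.B)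
    (hQ : ∀ v, c.IsMulAdd (s.mem d) (s.reg .x) (s.reg .y) v →
      Q ((((s.set .z (s.mem d)).set .v v).sto d v).set .ch (s.reg .ch + (v - s.mem d)))) :
    update.wp W c.S Q s := by
  have hlt := Inst.table_index_lt (c := c) hz hx hy
  have h1 := c.T0_le_I0
  have h2 := c.I0_le_D0
  have h3 := c.D0_le_S
  have hv := ht _ hz _ hx _ hy
  -- The change counter is bounded by a sum of `W0 + g` words below `B`, which can be quadratic in
  -- `S`; the square in `Fits` is there for it.
  have hbd : (c.W0 + c.g) * c.B + c.B < 2 ^ W := by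
    unfold Inst.Fits at hW
    have := c.B_le_S
    have := c.W0_le_S
    have := c.g_le_S
    have : (c.W0 + c.g) * c.B ≤ (2 * c.S) * c.S := Nat.mul_le_mul (by omega) (by omega)
    nlinarith
  have hQ' := hQ _ hv
  have hvB := hv.1
  simp only [update, Pr.wp, Ex.ok_mem, Ex.ok_var, Ex.eval_var, Ex.eval_mem, Ex.eval_add,
    Ex.eval_mul, Ex.eval_sub, Ex.ok_add, Ex.ok_mul, Ex.ok_sub, St.set_reg, St.set_mem, St.sto_reg,
    reduceCtorEq, if_false, if_true, true_and, and_true, St.sto_mem, henv.B, henv.F0, hd]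
  have e1 : s.mem d * c.B ≤ (s.mem d * c.B + s.reg .x) * c.B :=
    (Nat.le_add_right _ _).trans (Nat.le_mul_of_pos_right _ c.B_pos)
  have e2 : s.reg .x ≤ (s.mem d * c.B + s.reg .x) * c.B :=
    (Nat.le_add_left _ _).trans (Nat.le_mul_of_pos_right _ c.B_pos)
  and_intros <;> first | exact hQ' | omega | exact hW.lt (by omega)

theorem loadSym_wp (hW : c.Fits W) {s : St Var} {Q : St Var → Prop} (henv : Env c s) {K J : ℕ}
    (hKJ : K ≤ J) (hJ : J < c.M) 
    (hodd : s.reg .X % 2 = 1 → s.reg .X / 2 < c.g) (heven : s.reg .X % 2 = 0 → s.reg .X / 2 < c.nt)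
    (hK' : s.reg .K = K) (hJ' : s.reg .J = J)
    (hQ : Q (s.set .y (c.symBlock s.mem (s.reg .X) K J))) :
    loadSym.wp W c.S Q s := by
  have h1 := c.T0_le_I0
  have h2 := c.I0_le_D0
  have h3 := c.D0_le_S
  have h4 := c.M_le_S
  have h5 := c.M_pos
  have h6 : s.reg .X / 2 ≤ c.S := by
    have := c.g_le_S
    have := c.nt_le_S
    rcases Nat.mod_two_eq_zero_or_one (s.reg .X) with h | h
    · have := heven h; omega
    · have := hodd h; omega
  unfold Inst.symBlock at hQ
  simp only [loadSym, Pr.wp, Ex.ok_mem, Ex.ok_var, Ex.eval_var, Ex.eval_mem, Ex.eval_add,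
    Ex.eval_mul, Ex.eval_sub, Ex.eval_div, Ex.eval_num, Ex.ok_add, Ex.ok_mul, Ex.ok_sub, Ex.ok_div,
    Ex.ok_num, true_and, and_true, henv.D0, henv.M, henv.T0, hK', hJ']
  refine ⟨?_, fun hX => ?_, fun hX => ?_⟩
  · and_intros <;> exact hW.lt (by omega)
  · have hX' : s.reg .X % 2 = 1 := by omega
    rw [if_pos hX'] at hQ
    have hlt : c.D0 + ((s.reg .X / 2 * c.M + K) * c.M + J) < c.S :=
      c.aNt_lt (hodd hX') (by omega) hJ
    have e1 : s.reg .X / 2 * c.M ≤ (s.reg .X / 2 * c.M + K) * c.M :=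
      (Nat.le_add_right _ _).trans (Nat.le_mul_of_pos_right _ h5)
    and_intros <;> first | exact hQ | omega | exact hW.lt (by omega)
  · have hX' : ¬ s.reg .X % 2 = 1 := by omega
    rw [if_neg hX'] at hQ
    refine ⟨hW.lt (by omega), fun hX2 => ?_, fun hX2 => ?_⟩
    · rw [if_pos hX2] at hQ
      exact ⟨hW.lt (by omega), hQ⟩
    · rw [if_neg (by simpa using hX2)] at hQ
      have hlt := c.letter_index_lt (heven (by omega)) (show K + J < 2 * c.M by omega)
      and_intros <;> first | exact hQ | omega | exact hW.lt (by omega)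

/-- The cells of block `(I, J)` grow by one step, keeping the invariant. -/
structure PassInv (c : Inst) (I J : ℕ) (m₀ : ℕ → ℕ) (ch₀ : ℕ) (s : St Var) : Prop where
  good : c.Good I J s.mem
  grow : c.Grow I J m₀ ch₀ s.mem (s.reg .ch)

theorem PassInv.ch_le {I J ch₀ : ℕ} {m₀ : ℕ → ℕ} {s : St Var} (h : PassInv c I J m₀ ch₀ s)
    (h₀ : ch₀ ≤ c.total I J m₀) : s.reg .ch ≤ (c.W0 + c.g) * c.B := by
  have h1 := h.grow.sum
  have h2 := c.total_le (I := I) (J := J) h.good.rng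
  omega

/-- A new bit `(i, j)` has a witness `k` in block `K`: the prefix from `i` to `k` is sound by
`isound`, the symbol from `k` to `j` by `symBlock_sound`, and `DerP.snoc` joins them. The closure
claim refers to the memory before the step, since its sources may grow later. -/
theorem symBody_spec (hc : c.Valid) (hW : c.Fits W) {I J K ch₀ r t : ℕ} {m₀ : ℕ → ℕ} {s : St Var}
    (hIK : I ≤ K) (hKJ : K ≤ J) (hJ : J < c.M) (hch₀ : ch₀ ≤ c.total I J m₀) (hr : r < c.R)
    (ht : t < c.len r) (henv : Env c s) (hJ' : s.reg .J = J) (hK' : s.reg .K = K)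
    (hq : s.reg .q = c.pos r t)
    (hk : s.reg .k = t) (h : PassInv c I J m₀ ch₀ s) :
    Tri W c.S symBody s symBody.cost (fun s' => PassInv c I J m₀ ch₀ s' ∧
      s'.reg .q = c.pos r (t + 1) ∧ s'.reg .k = t + 1 ∧
      c.Grow I J s.mem (s.reg .ch) s'.mem (s'.reg .ch) ∧
      ∀ i k j, i / c.s = I → k / c.s = K → j / c.s = J →
        c.bit (s.mem (c.aItm (c.pos r t) K)) i k → c.bit (c.symBlock s.mem (c.sym r t) K J) k j →
        c.bit (s'.mem (c.aItm (c.pos r (t + 1)) J)) i j) := by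
  have h1 := c.T0_le_I0
  have h2 := c.I0_le_D0
  have h3 := c.D0_le_S
  have hpos : c.pos r t + 1 < c.W0 := c.pos_lt hr (Nat.succ_le_of_lt ht)
  have hW0 := c.W0_le_S
  have hsym := h.good.static.inp.sym r hr t ht
  have hx := c.aItm_lt (show c.pos r t < c.W0 by omega) (show K < c.M by omega)
  have hd := c.aItm_lt hpos hJ
  refine Tri.of_wp le_rfl ?_
  simp only [symBody, Pr.wp, Ex.ok_mem, Ex.ok_var, Ex.eval_var, Ex.eval_mem, Ex.eval_add,
    Ex.eval_num, Ex.ok_add, Ex.ok_num, true_and, and_true, hq, hsym]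
  refine ⟨?_, ?_⟩
  · and_intros <;> first | omega | exact hW.lt (by omega)
  refine loadSym_wp hW (c := c) (K := K) (J := J) ?_ hKJ hJ ?_ ?_ ?_ ?_ ?_
  · exact henv.set rfl _
  · simpa using hc.odd_lt r hr t ht
  · simpa using hc.even_lt r hr t ht
  · simpa using hK'
  · simpa using hJ'
  simp only [Ex.ok_mem, Ex.ok_var, Ex.eval_var, Ex.eval_mem, Ex.eval_add, Ex.eval_mul, Ex.ok_mul,
    Ex.eval_num, Ex.ok_add, Ex.ok_num, true_and, and_true, St.set_reg, St.set_mem, reduceCtorEq,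
    if_false, if_true, hq, henv.M, henv.I0, hJ', hK']
  change _ ∧ _ ∧ update.wp _ _ _ (St.set (St.set _ _ (s.mem (c.aItm (c.pos r t) K))) _
    (c.aItm (c.pos r t + 1) J))
  have hlen : t < c.W0 := by unfold Inst.pos at hpos; omega
  have hxB : s.mem (c.aItm (c.pos r t) K) < c.B := h.good.rng _ (by unfold Inst.aItm; omega)
  have hzB : s.mem (c.aItm (c.pos r t + 1) J) < c.B := h.good.rng _ (by unfold Inst.aItm; omega)
  refine ⟨?_, ?_, ?_⟩
  · unfold Inst.aItm at hx
    and_intros <;> first | omega | exact hW.lt (by omega)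
  · unfold Inst.aItm at hd
    and_intros <;> exact hW.lt (by omega)
  refine update_wp hW (d := c.aItm (c.pos r t + 1) J) ?_ ?_ ?_ ?_ ?_ (by omega) ?_ ?_ ?_
  · exact (((henv.set rfl _).set rfl _).set rfl _).set rfl _
  · exact h.good.static.table
  · simpa using hxB
  · simpa using Inst.symBlock_lt h.good.rng _ _ _
  · simp
  · simpa using hzB
  · simpa using h.ch_le hch₀
  intro v hv
  simp only [St.set_reg, St.set_mem, reduceCtorEq, if_false, if_true] at hv
  simp only [St.set_reg, St.set_mem, St.sto_reg, St.sto_mem, reduceCtorEq, if_false, if_true, hq, hk]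
  have hgrow : c.Grow I J s.mem (s.reg .ch) (Function.update s.mem (c.aItm (c.pos r t + 1) J) v)
      (s.reg .ch + (v - s.mem (c.aItm (c.pos r t + 1) J))) :=
    Inst.Grow.update (c.aItm_mem_cells I J hpos) (hv.mono hzB)
  refine ⟨⟨hW.lt (by omega), hW.lt (by omega)⟩, ⟨hW.lt (by omega), hW.lt (by omega)⟩, ⟨?_, ?_⟩, rfl,
    trivial, hgrow, ?_⟩
  · refine h.good.update_item hJ hpos hv.1 fun i j hi hj hb => ?_
    rcases (hv.bit K i j).1 hb with hb | ⟨k, hk, hb1, hb2⟩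
    · exact h.good.isound J (by omega) le_rfl _ hpos i j hi hj hb
    · obtain ⟨r', t', ht', he, hder⟩ := h.good.isound K hIK hKJ _ (by omega) i k hi hk hb1
      obtain ⟨rfl, rfl⟩ := c.pos_inj ht.le ht' he
      subst hj hk
      exact ⟨r, t + 1, ht, rfl, hder.snoc ht
        (Inst.symBlock_sound hc h.good.static.letters h.good.nsound hr ht hJ hKJ hb2)⟩
  · simpa [hq, hk] using h.grow.trans hgrow
  · intro i k j hi hk hj hb1 hb2
    rw [show c.pos r (t + 1) = c.pos r t + 1 from rfl, Function.update_self, hv.bit K]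
    exact Or.inr ⟨k, hk, hb1, hb2⟩

theorem ruleHead_spec (hW : c.Fits W) {I J ch₀ r : ℕ} {m₀ : ℕ → ℕ} {s : St Var}
    (hIJ : I ≤ J) (hJ : J < c.M) (hch₀ : ch₀ ≤ c.total I J m₀) (hr : r < c.R)
    (henv : Env c s) (hI' : s.reg .I = I) (hJ' : s.reg .J = J)
    (hq : s.reg .q = 5 + c.off r) (h : PassInv c I J m₀ ch₀ s) :
    Tri W c.S ruleHead s ruleHead.cost (fun s' => PassInv c I J m₀ ch₀ s' ∧
      s'.reg .q = c.pos r 0 ∧ s'.reg .a = c.lhs r ∧ s'.reg .l = c.len r ∧ s'.reg .k = 0 ∧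
      c.Grow I J s.mem (s.reg .ch) s'.mem (s'.reg .ch) ∧
      (I = J → ∀ i, i / c.s = I → c.bit (s'.mem (c.aItm (c.pos r 0) J)) i i)) := by
  have h1 := c.T0_le_I0
  have h2 := c.I0_le_D0
  have h3 := c.D0_le_S
  have hW0 := c.W0_le_S
  have hpos : c.pos r 0 < c.W0 := c.pos_lt hr (Nat.zero_le _)
  have hp0 : 5 + c.off r + 1 = c.pos r 0 := rfl
  have hlhs := h.good.static.inp.lhs r hr
  have hlen := h.good.static.inp.len r hr
  refine Tri.of_wp le_rfl ?_
  simp only [ruleHead, Pr.wp, Ex.ok_mem, Ex.ok_var, Ex.eval_var, Ex.eval_mem, Ex.eval_add,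
    Ex.eval_mul, Ex.ok_mul, Ex.eval_sub, Ex.ok_sub, Ex.eval_num, Ex.ok_add, Ex.ok_num, true_and,
    and_true, St.set_reg, St.set_mem, reduceCtorEq, if_false, if_true, hq, henv.M, henv.I0, hI',
    hJ', hlhs, hlen]
  simp only [hp0]
  refine ⟨by omega, ⟨⟨hW.lt (by omega), hW.lt (by omega)⟩, by omega⟩,
    ⟨hW.lt (by omega), hW.lt (by omega)⟩, hW.lt (by omega), fun hne => ?_, fun heq => ?_⟩
  · refine ⟨⟨h.good, by simpa using h.grow⟩, ?_⟩
    and_intros <;> first | trivial | exact Inst.Grow.refl _ _ _ _ | exact fun h => by omega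
  obtain rfl : I = J := by omega
  have hd := c.aItm_lt hpos hJ
  have hzB : s.mem (c.aItm (c.pos r 0) I) < c.B := h.good.rng _ (by unfold Inst.aItm; omega)
  refine ⟨?_, ?_⟩
  · unfold Inst.aItm at hd
    and_intros <;> exact hW.lt (by omega)
  refine update_wp hW (d := c.aItm (c.pos r 0) I) ?_ ?_ ?_ ?_ ?_ (by omega) ?_ ?_ ?_
  · exact ((((((henv.set rfl _).set rfl _).set rfl _).set rfl _).set rfl _).set rfl _).set rfl _
  · exact h.good.static.table
  · simpa using henv.idm.1
  · simpa using henv.idm.1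
  · simp [Inst.aItm]
  · simpa using hzB
  · simpa using h.ch_le hch₀
  intro v hv
  simp only [St.set_reg, St.set_mem, reduceCtorEq, if_false, if_true] at hv
  simp only [St.set_reg, St.set_mem, St.sto_reg, St.sto_mem, reduceCtorEq, if_false, if_true,
    true_and]
  have hgrow : c.Grow I I s.mem (s.reg .ch) (Function.update s.mem (c.aItm (c.pos r 0) I) v)
      (s.reg .ch + (v - s.mem (c.aItm (c.pos r 0) I))) :=
    Inst.Grow.update (c.aItm_mem_cells I I hpos) (hv.mono hzB)
  refine ⟨⟨?_, ?_⟩, hgrow, fun _ i hi => ?_⟩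
  · refine h.good.update_item hJ hpos hv.1 fun i j hi hj hb => ?_
    rcases (hv.bit I i j).1 hb with hb | ⟨k, hk, hb1, hb2⟩
    · exact h.good.isound I le_rfl le_rfl _ hpos i j hi hj hb
    -- Both factors are the identity, so `i = k = j` and the bit stands for the empty prefix.
    · rw [henv.idm.bit_iff (by omega)] at hb1 hb2
      subst hb1 hb2
      exact ⟨r, 0, Nat.zero_le _, rfl, .nil r _ hr⟩
  · simpa using h.grow.trans hgrow
  · rw [Function.update_self, hv.bit I]
    exact Or.inr ⟨i, hi, (henv.idm.bit_iff rfl).2 rfl, (henv.idm.bit_iff rfl).2 rfl⟩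

/-- The right factor is the identity, so the intermediate position lies in block `J` and equals `j`;
a new bit of the left-hand side is then a bit of the full right-hand side. -/
theorem ruleTail_spec (hc : c.Valid) (hW : c.Fits W) {I J ch₀ r : ℕ} {m₀ : ℕ → ℕ} {s : St Var}
    (hIJ : I ≤ J) (hJ : J < c.M) (hch₀ : ch₀ ≤ c.total I J m₀) (hr : r < c.R)
    (henv : Env c s) (hI' : s.reg .I = I) (hJ' : s.reg .J = J) (ha : s.reg .a = c.lhs r)
    (hq : s.reg .q = c.pos r (c.len r)) (hr' : s.reg .r = r) (h : PassInv c I J m₀ ch₀ s) :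
    Tri W c.S ruleTail s ruleTail.cost (fun s' => PassInv c I J m₀ ch₀ s' ∧
      s'.reg .q = 5 + c.off (r + 1) ∧ s'.reg .r = r + 1 ∧
      c.Grow I J s.mem (s.reg .ch) s'.mem (s'.reg .ch) ∧
      ∀ i j, i / c.s = I → j / c.s = J → c.bit (s.mem (c.aItm (c.pos r (c.len r)) J)) i j →
        c.bit (s'.mem (c.aNt (c.lhs r) I J)) i j) := by
  have h1 := c.T0_le_I0
  have h2 := c.I0_le_D0
  have h3 := c.D0_le_S
  have h5 := c.M_pos
  have hW0 := c.W0_le_S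
  have hpos : c.pos r (c.len r) < c.W0 := c.pos_lt hr le_rfl
  have hlhs := hc.lhs_lt r hr
  have hx := c.aItm_lt hpos hJ
  have hd := c.aNt_lt hlhs (show I < c.M by omega) hJ
  have hd' := c.le_aNt (c.lhs r) I J
  have hrW : r < c.W0 := by
    have : ∀ r, r ≤ c.off r := by
      intro r
      induction r with
      | zero => exact Nat.zero_le _
      | succ r ih => rw [c.off_succ]; omega
    have := this r
    unfold Inst.pos at hpos
    omega
  refine Tri.of_wp le_rfl ?_
  simp only [ruleTail, Pr.wp, Ex.ok_mem, Ex.ok_var, Ex.eval_var, Ex.eval_mem, Ex.eval_add,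
    Ex.eval_mul, Ex.ok_mul, Ex.eval_sub, Ex.ok_sub, Ex.eval_num, Ex.ok_add, Ex.ok_num, true_and,
    and_true, St.set_reg, St.set_mem, reduceCtorEq, if_false, if_true, hq, henv.M, henv.I0, henv.D0,
    hI', hJ', ha]
  change _ ∧ _ ∧ update.wp _ _ _
    (St.set (St.set (s.set _ (s.mem (c.aItm (c.pos r (c.len r)) J))) _ _) _ (c.aNt (c.lhs r) I J))
  have hxB : s.mem (c.aItm (c.pos r (c.len r)) J) < c.B :=
    h.good.rng _ (by unfold Inst.aItm; omega)
  have hzB : s.mem (c.aNt (c.lhs r) I J) < c.B := h.good.rng _ (by omega)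
  refine ⟨?_, ?_, ?_⟩
  · unfold Inst.aItm at hx
    and_intros <;> first | omega | exact hW.lt (by omega)
  · unfold Inst.aNt at hd
    have e1 : c.lhs r * c.M ≤ (c.lhs r * c.M + I) * c.M :=
      (Nat.le_add_right _ _).trans (Nat.le_mul_of_pos_right _ h5)
    have e2 : c.lhs r * c.M + I ≤ (c.lhs r * c.M + I) * c.M := Nat.le_mul_of_pos_right _ h5
    and_intros <;> exact hW.lt (by omega)
  refine update_wp hW (d := c.aNt (c.lhs r) I J) ?_ ?_ ?_ ?_ ?_ (by omega) ?_ ?_ ?_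
  · exact ((henv.set rfl _).set rfl _).set rfl _
  · exact h.good.static.table
  · simpa using hxB
  · simpa using henv.idm.1
  · simp
  · simpa using hzB
  · simpa using h.ch_le hch₀
  intro v hv
  simp only [St.set_reg, St.set_mem, reduceCtorEq, if_false, if_true] at hv
  simp only [St.set_reg, St.set_mem, St.sto_reg, St.sto_mem, reduceCtorEq, if_false, if_true, hq,
    hr']
  have hgrow : c.Grow I J s.mem (s.reg .ch) (Function.update s.mem (c.aNt (c.lhs r) I J) v)
      (s.reg .ch + (v - s.mem (c.aNt (c.lhs r) I J))) :=
    Inst.Grow.update (c.aNt_mem_cells I J hlhs) (hv.mono hzB)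
  refine ⟨⟨hW.lt (by omega), hW.lt (by omega)⟩, ⟨hW.lt (by omega), hW.lt (by omega)⟩, ⟨?_, ?_⟩, ?_,
    trivial, hgrow, ?_⟩
  · refine h.good.update_nt (by omega) hJ hv.1 fun i j hi hj hb => ?_
    rcases (hv.bit J i j).1 hb with hb | ⟨k, hk, hb1, hb2⟩
    · subst hi hj
      exact h.good.nsound _ hlhs i j (by omega) hJ hb
    · rw [henv.idm.bit_iff (by omega)] at hb2
      subst hb2
      obtain ⟨r', t', ht', he, hder⟩ := h.good.isound J (by omega) le_rfl _ hpos i k hi hk hb1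
      obtain ⟨rfl, rfl⟩ := c.pos_inj le_rfl ht' he
      exact ⟨r, rfl, hder⟩
  · simpa using h.grow.trans hgrow
  · rw [c.off_succ]; unfold Inst.pos; omega
  · intro i j hi hj hb
    rw [Function.update_self, hv.bit J]
    exact Or.inr ⟨j, hj, hb, (henv.idm.bit_iff rfl).2 rfl⟩

theorem ruleBody_spec (hc : c.Valid) (hW : c.Fits W) {I J K ch₀ r : ℕ} {m₀ : ℕ → ℕ} {s : St Var}
    (hIK : I ≤ K) (hKJ : K ≤ J) (hJ : J < c.M) (hch₀ : ch₀ ≤ c.total I J m₀) (hr : r < c.R)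
    (henv : Env c s) (hI' : s.reg .I = I) (hJ' : s.reg .J = J) (hK' : s.reg .K = K)
    (hq : s.reg .q = 5 + c.off r) (hr' : s.reg .r = r) (h : PassInv c I J m₀ ch₀ s) :
    Tri W c.S ruleBody s (200 * (2 + c.len r)) (fun s' => PassInv c I J m₀ ch₀ s' ∧
      s'.reg .q = 5 + c.off (r + 1) ∧ s'.reg .r = r + 1 ∧
      c.Grow I J s.mem (s.reg .ch) s'.mem (s'.reg .ch) ∧
      c.Closed I J K s.mem s'.mem r) := by
  -- The budget is 200 steps per word of the rule: a symbol costs at most `190 + 6` with the loop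
  -- test, and head, tail and loop exit at most `150 + 6 + 150`, covered by the two leading words.
  have hc1 : ruleHead.cost ≤ 150 := by decide
  have hc2 : symBody.cost ≤ 190 := by decide
  have hc3 : ruleTail.cost ≤ 150 := by decide
  refine Tri.seq (ruleHead_spec hW (hIK.trans hKJ) hJ hch₀ hr henv hI' hJ' hq h)
    (T₂ := c.len r * (symBody.cost + 6) + 6 + ruleTail.cost) (by nlinarith) ?_
  rintro s₁ hf₁ ⟨hp₁, hq₁, ha₁, hl₁, hk₁, hg₁, hinit⟩
  have henv₁ := henv.frame hf₁ rfl
  have hI₁ : s₁.reg .I = I := (hf₁ _ rfl).trans hI'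
  have hJ₁ : s₁.reg .J = J := (hf₁ _ rfl).trans hJ'
  have hK₁ : s₁.reg .K = K := (hf₁ _ rfl).trans hK'
  have hr₁ : s₁.reg .r = r := (hf₁ _ rfl).trans hr'
  refine Tri.seq (T₁ := c.len r * (symBody.cost + 6) + 6) (T₂ := ruleTail.cost)
    (Q₁ := fun s' => PassInv c I J m₀ ch₀ s' ∧ s'.reg .q = c.pos r (c.len r) ∧
      c.Grow I J s₁.mem (s₁.reg .ch) s'.mem (s'.reg .ch) ∧
      ∀ t < c.len r, ∀ i k j, i / c.s = I → k / c.s = K → j / c.s = J →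
        c.bit (s₁.mem (c.aItm (c.pos r t) K)) i k → c.bit (c.symBlock s₁.mem (c.sym r t) K J) k j →
        c.bit (s'.mem (c.aItm (c.pos r (t + 1)) J)) i j) ?_ (by omega) ?_
  · refine Tri.whl_count (c.len r) (fun t s' => PassInv c I J m₀ ch₀ s' ∧ s'.reg .q = c.pos r t ∧
      s'.reg .k = t ∧ c.Grow I J s₁.mem (s₁.reg .ch) s'.mem (s'.reg .ch) ∧
      ∀ t' < t, ∀ i k j, i / c.s = I → k / c.s = K → j / c.s = J →
        c.bit (s₁.mem (c.aItm (c.pos r t') K)) i k →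
        c.bit (c.symBlock s₁.mem (c.sym r t') K J) k j →
        c.bit (s'.mem (c.aItm (c.pos r (t' + 1)) J)) i j) symBody.cost ?_ ?_ ?_ ?_ ?_
    · exact ⟨hp₁, hq₁, hk₁, Inst.Grow.refl _ _ _ _, fun t ht => absurd ht (Nat.not_lt_zero _)⟩
    · rintro t s' ht hf ⟨-, -, hk, -⟩
      have : s'.reg .l = c.len r := (hf _ rfl).trans hl₁
      simp only [Ex.ok_sub, Ex.ok_var, Ex.eval_sub, Ex.eval_var, hk, this, true_and]
      omega
    · rintro t s' ht hf ⟨hp, hq, hk, hg, hcl⟩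
      refine (symBody_spec hc hW hIK hKJ hJ hch₀ hr ht (henv₁.frame hf rfl) ((hf _ rfl).trans hJ₁)
        ((hf _ rfl).trans hK₁) hq hk hp).mono le_rfl ?_
      rintro s'' - ⟨hp', hq', hk', hg', hcl'⟩
      refine ⟨hp', hq', hk', hg.trans hg', fun t' ht' i k j hi hk hj hb1 hb2 => ?_⟩
      rcases Nat.lt_succ_iff_lt_or_eq.1 ht' with ht' | rfl
      · exact hg'.mono _ _ (hcl t' ht' i k j hi ‹_› hj hb1 hb2)
      · exact hcl' i k j hi ‹_› hj (hg.mono _ _ hb1) (Inst.symBlock_mono hg.mono hb2)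
    · exact le_rfl
    · rintro s' - ⟨hp, hq, -, hg, hcl⟩
      exact ⟨hp, hq, hg, hcl⟩
  · rintro s₂ hf₂ ⟨hp₂, hq₂, hg₂, hcl₂⟩
    have henv₂ := henv₁.frame hf₂ rfl
    refine (ruleTail_spec hc hW (hIK.trans hKJ) hJ hch₀ hr henv₂ ((hf₂ _ rfl).trans hI₁)
      ((hf₂ _ rfl).trans hJ₁) ((hf₂ _ rfl).trans ha₁) hq₂ ((hf₂ _ rfl).trans hr₁) hp₂).mono
      le_rfl ?_
    rintro s₃ - ⟨hp₃, hq₃, hr₃, hg₃, hfin⟩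
    refine ⟨hp₃, hq₃, hr₃, (hg₁.trans hg₂).trans hg₃, ?_, ?_, ?_⟩
    · exact fun h0 i hi => (hg₂.trans hg₃).mono _ _ (hinit h0 i hi)
    · exact fun t ht i k j hi hk hj hb1 hb2 => hg₃.mono _ _ (hcl₂ t ht i k j hi hk hj
        (hg₁.mono _ _ hb1) (Inst.symBlock_mono hg₁.mono hb2))
    · exact fun i j hi hj hb => hfin i j hi hj ((hg₁.trans hg₂).mono _ _ hb)

theorem pass_spec (hc : c.Valid) (hW : c.Fits W) {I J K : ℕ} {s : St Var}
    (hIK : I ≤ K) (hKJ : K ≤ J) (hJ : J < c.M) (hch : s.reg .ch ≤ c.total I J s.mem)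
    (henv : Env c s) (hI' : s.reg .I = I) (hJ' : s.reg .J = J) (hK' : s.reg .K = K)
    (hgood : c.Good I J s.mem) :
    Tri W c.S pass s (220 * c.W0) (fun s' => c.Good I J s'.mem ∧
      c.Grow I J s.mem (s.reg .ch) s'.mem (s'.reg .ch) ∧
      ∀ r < c.R, c.Closed I J K s.mem s'.mem r) := by
  have hS : 5 ≤ c.S := by have := c.W0_le_S; unfold Inst.W0 at this; omega
  refine Tri.wp_seq (T₂ := 210 * c.off c.R + 10) ?_ ?_
  · change 2 + _ ≤ _
    unfold Inst.W0; omega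
  simp only [Pr.wp, Ex.ok_num, Ex.eval_num]
  refine ⟨hW.lt (by omega), hW.lt (by omega), ?_⟩
  refine Tri.whl_sum c.R (fun r s' => PassInv c I J s.mem (s.reg .ch) s' ∧
    s'.reg .q = 5 + c.off r ∧ s'.reg .r = r ∧ ∀ r' < r, c.Closed I J K s.mem s'.mem r')
    (fun r => 200 * (2 + c.len r)) ?_ ?_ ?_ ?_ ?_
  · refine ⟨⟨hgood, ?_⟩, ?_, ?_, fun r hr => absurd hr (Nat.not_lt_zero _)⟩
    · simpa using Inst.Grow.refl I J s.mem (s.reg .ch)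
    · simp [Inst.off]
    · simp
  · rintro r s' hr hf ⟨-, -, hr', -⟩
    have : s'.reg .R = c.R := (hf _ rfl).trans (by simpa using henv.R)
    simp only [Ex.ok_sub, Ex.ok_var, Ex.eval_sub, Ex.eval_var, hr', this, true_and]
    omega
  · rintro r s' hr hf ⟨hp, hq, hr', hcl⟩
    have henv' : Env c s' := ((henv.set (u := .q) rfl 5).set (u := .r) rfl 0).frame hf rfl
    refine (ruleBody_spec hc hW hIK hKJ hJ hch hr henv' ?_ ?_ ?_ hq hr' hp).mono le_rfl ?_
    · exact (hf _ rfl).trans (by simpa using hI')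
    · exact (hf _ rfl).trans (by simpa using hJ')
    · exact (hf _ rfl).trans (by simpa using hK')
    rintro s'' - ⟨hp', hq', hr'', hg, hcl'⟩
    refine ⟨hp', hq', hr'', fun r' h' => ?_⟩
    rcases Nat.lt_succ_iff_lt_or_eq.1 h' with h' | rfl
    · exact (hcl r' h').mono hg.mono
    -- Bits present at the start of the pass are still present when this rule is reached, so closure
    -- relative to the later memory gives closure relative to the earlier one.
    · refine ⟨hcl'.init, fun t ht i k j hi hk hj hb1 hb2 => hcl'.step t ht i k j hi hk hj
        (hp.grow.mono _ _ hb1) (Inst.symBlock_mono hp.grow.mono hb2), fun i j hi hj hb =>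
        hcl'.fin i j hi hj (hp.grow.mono _ _ hb)⟩
  · change ∑ r ∈ Finset.range c.R, (200 * (2 + c.len r) + 5 + 1) + 5 + 1 ≤ _
    have : ∑ r ∈ Finset.range c.R, (200 * (2 + c.len r) + 5 + 1)
        ≤ ∑ r ∈ Finset.range c.R, 210 * (2 + c.len r) :=
      Finset.sum_le_sum fun r _ => by omega
    rw [← Finset.mul_sum] at this
    unfold Inst.off
    omega
  · rintro s' - ⟨hp, -, -, hcl⟩
    exact ⟨hp.good, hp.grow, hcl⟩

end CFRec

/-! ### Filling in a block, a row, and the whole table. -/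

namespace CFRec

open Imp

set_option linter.unusedSimpArgs false

variable {c : Inst} {W : ℕ}

/-- The memory before the block `(I, J)` is filled in. -/
structure Ready (c : Inst) (I J : ℕ) (m : ℕ → ℕ) : Prop where
  static : c.Static m
  rng : ∀ a, c.T0 ≤ a → m a < c.B
  nsound : c.NSound m
  isound : ∀ J', I ≤ J' → J' < J → c.ISound I J' m
  icomp : ∀ J', I ≤ J' → J' < J → c.IComp I J' m
  ncomp : ∀ I' J', J' < c.M → I < I' ∨ (I' = I ∧ J' < J) → I' < c.M → c.NComp I' J' m

/-- The memory while the block `(I, J)` is filled in. -/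
structure Prep (c : Inst) (I J : ℕ) (m : ℕ → ℕ) : Prop where
  good : c.Good I J m
  icomp : ∀ J', I ≤ J' → J' < J → c.IComp I J' m
  ncomp : ∀ I' J', J' < c.M → I < I' ∨ (I' = I ∧ J' < J) → I' < c.M → c.NComp I' J' m

theorem Prep.grow {I J ch ch' : ℕ} {m m' : ℕ → ℕ} (h : Prep c I J m) (hg : c.Good I J m')
    (hgr : c.Grow I J m ch m' ch') : Prep c I J m' :=
  ⟨hg, fun J' h1 h2 r t i j hi hj hd => hgr.mono _ _ (h.icomp J' h1 h2 r t i j hi hj hd),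
    fun I' J' h1 h2 h3 A i j hi hj hd => hgr.mono _ _ (h.ncomp I' J' h1 h2 h3 A i j hi hj hd)⟩

/-- The memory arises from `m₀` by clearing the blocks of the first `q` prefixes in the column
block `J`. -/
structure Cleared (c : Inst) (J : ℕ) (m₀ : ℕ → ℕ) (q : ℕ) (m : ℕ → ℕ) : Prop where
  zero : ∀ q' < q, m (c.aItm q' J) = 0
  eq : ∀ a, (∀ q' < q, a ≠ c.aItm q' J) → m a = m₀ a

/-- The prefix blocks are reused by every row, so column `J` may hold remains of another row.
Clearing it makes soundness there trivial and touches neither the earlier columns nor the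
nonterminals. -/
theorem Ready.prep {I J : ℕ} {m₀ m : ℕ → ℕ} (hJ : J < c.M) (h : Ready c I J m₀)
    (hcl : Cleared c J m₀ c.W0 m) : Prep c I J m := by
  have hn : ∀ A I' J', m (c.aNt A I' J') = m₀ (c.aNt A I' J') := fun A I' J' =>
    hcl.eq _ fun q' hq' he => by
      have := c.aItm_lt hq' hJ
      have := c.le_aNt A I' J'
      omega
  have hi : ∀ q J', J' < J → m (c.aItm q J') = m₀ (c.aItm q J') := fun q J' hJ' =>
    hcl.eq _ fun q' hq' he => by
      have := (c.aItm_inj (by omega) hJ he).2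
      omega
  refine ⟨⟨h.static.congr fun a ha => hcl.eq a fun q' hq' he => ?_, fun a ha => ?_, ?_, ?_⟩, ?_, ?_⟩
  · have := c.le_aItm q' J; omega
  · by_cases he : ∃ q' < c.W0, a = c.aItm q' J
    · obtain ⟨q', hq', rfl⟩ := he
      rw [hcl.zero q' hq']; exact c.B_pos
    · push Not at he
      rw [hcl.eq a he]; exact h.rng a ha
  · intro J' h1 h2 q hq i j hi' hj hb
    rcases h2.lt_or_eq with h2 | rfl
    · rw [hi _ _ h2] at hb
      exact h.isound J' h1 h2 q hq i j hi' hj hb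
    · rw [hcl.zero q hq] at hb
      simp [Inst.bit] at hb
  · intro A hA i j hi' hj hb
    rw [hn] at hb
    exact h.nsound A hA i j hi' hj hb
  · intro J' h1 h2 r t i j hi' hj hd
    rw [hi _ _ h2]
    exact h.icomp J' h1 h2 r t i j hi' hj hd
  · intro I' J' h1 h2 h3 A i j hi' hj hd
    rw [hn]
    exact h.ncomp I' J' h1 h2 h3 A i j hi' hj hd

theorem clear_spec (hW : c.Fits W) {I J : ℕ} {s : St Var} (hJ : J < c.M) (henv : Env c s)
    (hJ' : s.reg .J = J) (h : Ready c I J s.mem) :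
    Tri W c.S clear s (40 * c.W0) (fun s' => Prep c I J s'.mem ∧ s'.reg .ch = 0) := by
  have h2 := c.W0_le_S
  have h3 := c.D0_le_S
  have h5 : 5 ≤ c.W0 := by unfold Inst.W0; omega
  refine Tri.wp_seq (T₂ := 30 * c.W0 + 10) ?_ ?_
  · change 2 + _ ≤ _
    omega
  simp only [Pr.wp, Ex.ok_num, Ex.eval_num]
  refine ⟨hW.lt (by omega), hW.lt (by omega), ?_⟩
  refine Tri.whl_count c.W0 (fun q s' => Cleared c J s.mem q s'.mem ∧ s'.reg .q = q ∧
    s'.reg .ch = 0) 20 ?_ ?_ ?_ ?_ ?_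
  · exact ⟨⟨fun q hq => absurd hq (Nat.not_lt_zero _), fun a _ => rfl⟩, by simp, by simp⟩
  · rintro q s' hq hf ⟨-, hq', -⟩
    have : s'.reg .W0 = c.W0 := (hf _ rfl).trans (by simpa using henv.W0)
    simp only [Ex.ok_sub, Ex.ok_var, Ex.eval_sub, Ex.eval_var, hq', this, true_and]
    omega
  · rintro q s' hq hf ⟨hcl, hq', hch⟩
    have henv' : Env c s' := ((henv.set (u := .ch) rfl 0).set (u := .q) rfl 0).frame hf rfl
    have hJ'' : s'.reg .J = J := (hf _ rfl).trans (by simpa using hJ')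
    have hlt : c.I0 + (q * c.M + J) < c.D0 := c.aItm_lt hq hJ
    refine Tri.of_wp (by decide) ?_
    simp only [clearBody, Pr.wp, Ex.ok_mem, Ex.ok_var, Ex.eval_var, Ex.eval_mem, Ex.eval_add,
      Ex.eval_mul, Ex.ok_mul, Ex.eval_num, Ex.ok_add, Ex.ok_num, true_and, St.set_reg, St.set_mem,
      St.sto_reg, St.sto_mem, reduceCtorEq, if_false, if_true, hq', hJ'', henv'.M, henv'.I0, hch]
    change _ ∧ _ ∧ Cleared c J s.mem (q + 1) (Function.update s'.mem (c.aItm q J) 0) ∧ _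
    refine ⟨?_, ?_, ⟨?_, ?_⟩, trivial⟩
    · and_intros <;> first | omega | exact hW.lt (by omega)
    · and_intros <;> exact hW.lt (by omega)
    · intro q' hq'
      rw [Function.update_apply]
      split_ifs with he
      · rfl
      · rcases Nat.lt_succ_iff_lt_or_eq.1 hq' with hq' | rfl
        · exact hcl.zero q' hq'
        · exact absurd rfl he
    · intro a ha
      rw [Function.update_of_ne (ha q (by omega))]
      exact hcl.eq a fun q' hq' => ha q' (by omega)
  · change c.W0 * (20 + 5 + 1) + 5 + 1 ≤ _
    omega
  · rintro s' - ⟨hcl, -, hch⟩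
    exact ⟨h.prep hJ hcl, hch⟩

/-- The loop also visits `K = I` and `K = J`, but closure is claimed only strictly between, where
`StepClosed.grow` preserves it through the later passes. -/
theorem accumulate_spec (hc : c.Valid) (hW : c.Fits W) {I J : ℕ} {s : St Var} (hIJ : I ≤ J)
    (hJ : J < c.M) (henv : Env c s) (hI' : s.reg .I = I) (hJ' : s.reg .J = J)
    (hch : s.reg .ch = 0) (h : Prep c I J s.mem) :
    Tri W c.S accumulate s (c.M * (230 * c.W0) + 20) (fun s' => Prep c I J s'.mem ∧
      ∀ K, I < K → K < J → ∀ r < c.R, c.StepClosed I J K s'.mem s'.mem r) := by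
  have hM := c.M_le_S
  have h5 : 5 ≤ c.W0 := by unfold Inst.W0; omega
  refine Tri.wp_seq (T₂ := c.M * (230 * c.W0) + 15) ?_ ?_
  · change 2 + _ ≤ _
    omega
  simp only [Pr.wp, Ex.ok_var, Ex.eval_var, true_and, hI']
  refine Tri.whl_count (J + 1 - I) (fun d s' => Prep c I J s'.mem ∧ s'.reg .K = I + d ∧
    s'.reg .ch ≤ c.total I J s'.mem ∧
    ∀ K, I < K → K < J → K < I + d → ∀ r < c.R, c.StepClosed I J K s'.mem s'.mem r)
    (220 * c.W0 + 4) ?_ ?_ ?_ ?_ ?_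
  · exact ⟨h, by simp, by simp [hch], fun K h1 h2 h3 => by omega⟩
  · rintro d s' hd hf ⟨-, hK, -⟩
    have : s'.reg .J = J := (hf _ rfl).trans (by simpa using hJ')
    simp only [Ex.ok_sub, Ex.ok_var, Ex.eval_sub, Ex.eval_var, Ex.ok_add, Ex.eval_add, Ex.ok_num,
      Ex.eval_num, hK, this, true_and]
    exact ⟨⟨⟨hW.lt (by omega), hW.lt (by omega)⟩, trivial⟩, by omega⟩
  · rintro d s' hd hf ⟨hp, hK, hch', hcl⟩
    have henv' : Env c s' := (henv.set (u := .K) rfl I).frame hf rfl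
    have hI'' : s'.reg .I = I := (hf _ rfl).trans (by simpa using hI')
    have hJ'' : s'.reg .J = J := (hf _ rfl).trans (by simpa using hJ')
    refine Tri.seq (pass_spec hc hW (by omega) (by omega) hJ hch' henv' hI'' hJ'' hK hp.good)
      (T₂ := 4) le_rfl ?_
    rintro s₁ hf₁ ⟨hg, hgr, hcl₁⟩
    refine Tri.of_wp (by decide) ?_
    have hK₁ : s₁.reg .K = I + d := (hf₁ _ rfl).trans hK
    simp only [Pr.wp, Ex.ok_var, Ex.eval_var, Ex.eval_add, Ex.eval_num, Ex.ok_add, Ex.ok_num,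
      true_and, St.set_reg, St.set_mem, reduceCtorEq, if_false, if_true, hK₁]
    refine ⟨⟨hW.lt (by omega), hW.lt (by omega)⟩, hp.grow hg hgr, rfl, ?_, ?_⟩
    · have := hgr.sum; omega
    · intro K h1 h2 h3 r hr
      by_cases hKd : K = I + d
      · subst hKd
        exact (hcl₁ r hr).step.grow hc hr h1 h2 hJ hgr fun _ _ => _root_.id
      · exact (hcl K h1 h2 (by omega) r hr).grow hc hr h1 h2 hJ hgr hgr.mono
  · change (J + 1 - I) * (220 * c.W0 + 4 + 7 + 1) + 7 + 1 ≤ _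
    have : (J + 1 - I) * (220 * c.W0 + 4 + 7 + 1) ≤ c.M * (230 * c.W0) :=
      Nat.mul_le_mul (by omega) (by omega)
    omega
  · rintro s' - ⟨hp, -, -, hcl⟩
    exact ⟨hp, fun K h1 h2 => hcl K h1 h2 (by omega)⟩

/-- At the end, closure holds for all `K`: strictly between by hypothesis, at the two ends because
the last round changed nothing. `complete_of_closed` then applies. -/
theorem saturate_spec (hc : c.Valid) (hW : c.Fits W) {I J : ℕ} {s : St Var} (hIJ : I ≤ J)
    (hJ : J < c.M) (henv : Env c s) (hI' : s.reg .I = I) (hJ' : s.reg .J = J)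
    (h : Prep c I J s.mem)
    (hst : ∀ K, I < K → K < J → ∀ r < c.R, c.StepClosed I J K s.mem s.mem r) :
    Tri W c.S saturate s (((c.W0 + c.g) * c.B + 1) * (450 * c.W0) + 10)
      (fun s' => Ready c I (J + 1) s'.mem) := by
  have hM := c.M_le_S
  have h5 : 5 ≤ c.W0 := by unfold Inst.W0; omega
  refine Tri.wp_seq (T₂ := ((c.W0 + c.g) * c.B + 1) * (450 * c.W0) + 9) ?_ ?_
  · change 1 + _ ≤ _
    omega
  simp only [Pr.wp, Ex.ok_num, Ex.eval_num]
  refine ⟨hW.lt (by omega), ?_⟩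
  -- In each round either the total of the cells increases, or it stays and the flag `ch` drops to
  -- zero. The total never exceeds `(W0 + g) * B`, and the initial `ch = 1` accounts for the extra
  -- round.
  refine Tri.whl_measure
    (fun s' => (c.W0 + c.g) * c.B - c.total I J s'.mem + if s'.reg .ch = 0 then 0 else 1)
    (fun s' => Prep c I J s'.mem ∧
      (∀ K, I < K → K < J → ∀ r < c.R, c.StepClosed I J K s'.mem s'.mem r) ∧
      (s'.reg .ch = 0 → ∀ r < c.R, c.Closed I J I s'.mem s'.mem r ∧
        c.StepClosed I J J s'.mem s'.mem r)) (440 * c.W0 + 10)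
    (N := (c.W0 + c.g) * c.B + 1) ?_ ?_ ?_ ?_ ?_ ?_
  · exact ⟨h, hst, by simp⟩
  · simp only [St.set_reg, St.set_mem, if_true]
    split_ifs <;> omega
  · intros; trivial
  · rintro s' hf ⟨hp, hst', -⟩ hne
    simp only [Ex.eval_var] at hne
    have henv' : Env c s' := (henv.set (u := .ch) rfl 1).frame hf rfl
    have hI'' : s'.reg .I = I := (hf _ rfl).trans (by simpa using hI')
    have hJ'' : s'.reg .J = J := (hf _ rfl).trans (by simpa using hJ')
    refine Tri.wp_seq (T₂ := 440 * c.W0 + 5) ?_ ?_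
    · change 3 + _ ≤ _
      omega
    simp only [Pr.wp, Ex.ok_num, Ex.eval_num, Ex.ok_var, Ex.eval_var, true_and, St.set_reg,
      reduceCtorEq, if_false, hI'']
    refine ⟨hW.lt (by omega), ?_⟩
    refine Tri.seq (pass_spec hc hW (K := I) le_rfl hIJ hJ (by simp)
      ((henv'.set rfl _).set rfl _) (by simpa using hI'') (by simpa using hJ'') (by simp)
      (by simpa using hp.good)) (T₂ := 220 * c.W0 + 5) (by omega) ?_
    rintro s₁ hf₁ ⟨hg₁, hgr₁, hcl₁⟩
    simp only [St.set_reg, St.set_mem, reduceCtorEq, if_false, if_true] at hgr₁ hcl₁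
    have hI₁ : s₁.reg .I = I := (hf₁ _ rfl).trans (by simpa using hI'')
    have hJ₁ : s₁.reg .J = J := (hf₁ _ rfl).trans (by simpa using hJ'')
    have henv₁ : Env c s₁ := ((henv'.set (u := .ch) rfl 0).set (u := .K) rfl I).frame hf₁ rfl
    refine Tri.wp_seq (T₂ := 220 * c.W0) ?_ ?_
    · change 2 + _ ≤ _
      omega
    simp only [Pr.wp, Ex.ok_var, Ex.eval_var, true_and, hJ₁]
    have hs₁ := hgr₁.sum
    refine (pass_spec hc hW (K := J) hIJ le_rfl hJ (by simpa using by omega)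
      (henv₁.set rfl _) (by simpa using hI₁) (by simpa using hJ₁) (by simp)
      (by simpa using hg₁)).mono le_rfl ?_
    rintro s₂ - ⟨hg₂, hgr₂, hcl₂⟩
    simp only [St.set_reg, St.set_mem, reduceCtorEq, if_false, if_true] at hgr₂ hcl₂
    have hgr := hgr₁.trans hgr₂
    refine ⟨⟨hp.grow hg₂ hgr, fun K h1 h2 r hr =>
      (hst' K h1 h2 r hr).grow hc hr h1 h2 hJ hgr hgr.mono, fun h0 r hr => ?_⟩, ?_⟩
    -- A final counter of zero was zero after the first pass too, so by `Grow.eq` neither pass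
    -- changed the memory, and closure of the new memory relative to the old is closure of one
    -- memory under itself.
    · have hle := hgr₂.le
      have h1 : s₁.reg .ch = 0 := by omega
      rw [h1] at hgr₁ hgr₂
      rw [h0] at hgr₂
      have e1 := hgr₁.eq
      have e2 := hgr₂.eq
      rw [e2, e1] at hcl₂ ⊢
      rw [e1] at hcl₁
      exact ⟨hcl₁ r hr, (hcl₂ r hr).step⟩
    · have hs := hgr.sum
      have ht₁ := c.total_le (I := I) (J := J) hp.good.rng
      have ht₂ := c.total_le (I := I) (J := J) hg₂.rng
      rw [if_neg hne]
      split_ifs <;> omega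
  · change _ * (440 * c.W0 + 10 + 2 + 1) + 2 + 1 ≤ _
    have : ((c.W0 + c.g) * c.B + 1) * (440 * c.W0 + 10 + 2 + 1) ≤
      ((c.W0 + c.g) * c.B + 1) * (450 * c.W0) := Nat.mul_le_mul_left _ (by omega)
    omega
  · rintro s' - ⟨hp, hst', hcl⟩ h0
    simp only [Ex.eval_var] at h0
    have hcl' := hcl h0
    obtain ⟨hI, hN⟩ := Inst.complete_of_closed hc hp.good.static.letters hJ hp.icomp
      (fun I' h1 h2 => hp.ncomp I' J hJ (Or.inl h1) h2)
      (fun K h1 h2 r hr => by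
        rcases h1.lt_or_eq with h1 | rfl
        · rcases h2.lt_or_eq with h2 | rfl
          · exact hst' K h1 h2 r hr
          · exact (hcl' r hr).2
        · exact (hcl' r hr).1.step) fun r hr => (hcl' r hr).1
    refine ⟨hp.good.static, hp.good.rng, hp.good.nsound, fun J' h1 h2 =>
      hp.good.isound J' h1 (by omega), fun J' h1 h2 => ?_, fun I' J' h1 h2 h3 => ?_⟩
    · rcases Nat.lt_succ_iff_lt_or_eq.1 h2 with h2 | rfl
      · exact hp.icomp J' h1 h2
      · exact hI
    · by_cases he : I' = I ∧ J' = J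
      · obtain ⟨rfl, rfl⟩ := he
        exact hN
      · exact hp.ncomp I' J' h1 (by omega) h3

/-- A bound on the time for one block. -/
def blockTime (c : Inst) : ℕ := 500 * c.W0 * (c.M + ((c.W0 + c.g) * c.B + 2))

theorem block_spec (hc : c.Valid) (hW : c.Fits W) {I J : ℕ} {s : St Var} (hIJ : I ≤ J)
    (hJ : J < c.M) (henv : Env c s) (hI' : s.reg .I = I) (hJ' : s.reg .J = J)
    (h : Ready c I J s.mem) :
    Tri W c.S block s (blockTime c) (fun s' => Ready c I (J + 1) s'.mem) := by
  have h5 : 5 ≤ c.W0 := by unfold Inst.W0; omega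
  refine Tri.seq (clear_spec hW hJ henv hJ' h) (T₂ := c.M * (230 * c.W0) + 20 +
    (((c.W0 + c.g) * c.B + 1) * (450 * c.W0) + 10)) ?_ ?_
  · unfold blockTime
    generalize (c.W0 + c.g) * c.B = X
    nlinarith
  rintro s₁ hf₁ ⟨hp₁, hch₁⟩
  have hI₁ : s₁.reg .I = I := (hf₁ _ rfl).trans hI'
  have hJ₁ : s₁.reg .J = J := (hf₁ _ rfl).trans hJ'
  have henv₁ : Env c s₁ := henv.frame hf₁ rfl
  refine Tri.seq (accumulate_spec hc hW hIJ hJ henv₁ hI₁ hJ₁ hch₁ hp₁) le_rfl ?_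
  rintro s₂ hf₂ ⟨hp₂, hst⟩
  exact saturate_spec hc hW hIJ hJ (henv₁.frame hf₂ rfl) ((hf₂ _ rfl).trans hI₁)
    ((hf₂ _ rfl).trans hJ₁) hp₂ hst

/-- The row blocks from `I` on are filled in. -/
structure Filled (c : Inst) (I : ℕ) (m : ℕ → ℕ) : Prop where
  static : c.Static m
  rng : ∀ a, c.T0 ≤ a → m a < c.B
  nsound : c.NSound m
  ncomp : ∀ I' J', I ≤ I' → I' < c.M → J' < c.M → c.NComp I' J' m

theorem row_spec (hc : c.Valid) (hW : c.Fits W) {I : ℕ} {s : St Var} (hI : I < c.M)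
    (henv : Env c s) (hI' : s.reg .I = I + 1) (h : Filled c (I + 1) s.mem) :
    Tri W c.S row s (c.M * (blockTime c + 20) + 20)
      (fun s' => Filled c I s'.mem ∧ s'.reg .I = I) := by
  have hM := c.M_le_S
  -- In row `I` no column precedes the diagonal block, and blocks left of it contain no derivations
  -- because positions never decrease.
  have hready : Ready c I I s.mem := by
    refine ⟨h.static, h.rng, h.nsound, fun J' h1 h2 => by omega, fun J' h1 h2 => by omega, ?_⟩
    intro I' J' h1 h2 h3
    rcases h2 with h2 | ⟨rfl, h2⟩
    · exact h.ncomp I' J' h2 h3 h1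
    · rintro A i j hi hj ⟨r, -, hd⟩
      have := Nat.div_le_div_right (c := c.s) hd.le
      omega
  refine Tri.wp_seq (T₂ := c.M * (blockTime c + 20) + 10) ?_ ?_
  · change 6 + _ ≤ _
    omega
  simp only [Pr.wp, Ex.ok_var, Ex.eval_var, Ex.ok_sub, Ex.eval_sub, Ex.ok_num, Ex.eval_num,
    true_and, St.set_reg, if_true, hI', Nat.add_sub_cancel]
  refine ⟨hW.lt (by omega), ?_⟩
  refine Tri.whl_count (c.M - I) (fun d s' => Ready c I (I + d) s'.mem ∧ s'.reg .J = I + d)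
    (blockTime c + 4) ?_ ?_ ?_ ?_ ?_
  · exact ⟨hready, by simp⟩
  · rintro d s' hd hf ⟨-, hJ⟩
    have : s'.reg .M = c.M := (hf _ rfl).trans (by simpa using henv.M)
    simp only [Ex.ok_sub, Ex.ok_var, Ex.eval_sub, Ex.eval_var, hJ, this, true_and]
    omega
  · rintro d s' hd hf ⟨hr, hJ⟩
    have henv' : Env c s' := ((henv.set (u := .I) rfl I).set (u := .J) rfl I).frame hf rfl
    have hI'' : s'.reg .I = I := (hf _ rfl).trans (by simp)
    refine Tri.seq (block_spec hc hW (by omega) (by omega) henv' hI'' hJ hr) (T₂ := 4) le_rfl ?_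
    rintro s₁ hf₁ hr₁
    have hJ₁ : s₁.reg .J = I + d := (hf₁ _ rfl).trans hJ
    refine Tri.of_wp (by decide) ?_
    simp only [Pr.wp, Ex.ok_var, Ex.eval_var, Ex.eval_add, Ex.eval_num, Ex.ok_add, Ex.ok_num,
      true_and, St.set_reg, St.set_mem, reduceCtorEq, if_false, if_true, hJ₁]
    exact ⟨⟨hW.lt (by omega), hW.lt (by omega)⟩, hr₁, rfl⟩
  · change (c.M - I) * (blockTime c + 4 + 5 + 1) + 5 + 1 ≤ _
    have : (c.M - I) * (blockTime c + 4 + 5 + 1) ≤ c.M * (blockTime c + 20) :=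
      Nat.mul_le_mul (by omega) (by omega)
    omega
  · rintro s' hf ⟨hr, -⟩
    refine ⟨⟨hr.static, hr.rng, hr.nsound, fun I' J' h1 h2 h3 => ?_⟩, (hf _ rfl).trans (by simp)⟩
    exact hr.ncomp I' J' h3 (by omega) h2

theorem fill_spec (hc : c.Valid) (hW : c.Fits W) {s : St Var} (henv : Env c s)
    (h : Filled c c.M s.mem) :
    Tri W c.S fill s (c.M * (c.M * (blockTime c + 20) + 30) + 10) (fun s' => Filled c 0 s'.mem) := by
  refine Tri.wp_seq (T₂ := c.M * (c.M * (blockTime c + 20) + 30) + 5) ?_ ?_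
  · change 2 + _ ≤ _
    omega
  simp only [Pr.wp, Ex.ok_var, Ex.eval_var, true_and, henv.M]
  refine Tri.whl_count c.M (fun d s' => Filled c (c.M - d) s'.mem ∧ s'.reg .I = c.M - d)
    (c.M * (blockTime c + 20) + 20) ?_ ?_ ?_ ?_ ?_
  · exact ⟨h, by simp⟩
  · rintro d s' hd hf ⟨-, hI⟩
    simp only [Ex.ok_var, Ex.eval_var, hI, true_and]
    omega
  · rintro d s' hd hf ⟨hr, hI⟩
    have henv' : Env c s' := (henv.set (u := .I) rfl c.M).frame hf rfl
    have e : c.M - d = c.M - (d + 1) + 1 := by omega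
    rw [e] at hr hI
    exact row_spec hc hW (by omega) henv' hI hr
  · change c.M * (c.M * (blockTime c + 20) + 20 + 2 + 1) + 2 + 1 ≤ _
    have : c.M * (c.M * (blockTime c + 20) + 20 + 2 + 1) ≤ c.M * (c.M * (blockTime c + 20) + 30) :=
      Nat.mul_le_mul_left _ (by omega)
    omega
  · rintro s' - ⟨hr, -⟩
    rwa [Nat.sub_self] at hr

end CFRec

/-! ### Reading the input, choice of parameters, powers of two, identity matrix. -/

namespace CFRec

open Imp

set_option linter.unusedSimpArgs false

variable {c : Inst} {W : ℕ}

/-- The memory holds the instance and nothing else. -/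
structure Input (c : Inst) (m : ℕ → ℕ) : Prop where
  n : m 0 = c.n
  nt : m 1 = c.nt
  ini : m 3 = c.ini
  R : m 4 = c.R
  inp : c.Inp m
  zero : ∀ a, c.P0 ≤ a → m a = 0

namespace Inst

theorem five_le_W0 : 5 ≤ c.W0 := by unfold W0; omega

theorem P0_le_S : c.P0 + c.s2 < c.S := by
  have h2 := c.F0_le_T0
  have h3 := c.T0_le_I0
  have h4 := c.I0_le_D0
  have h5 := c.D0_le_S
  have h6 := c.P0_lt_F0
  omega

theorem s_le_s2 : c.s ≤ c.s2 := Nat.le_mul_of_pos_left _ c.s_pos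

theorem le_off (r : ℕ) : 2 * r ≤ c.off r := by
  induction r with
  | zero => exact Nat.zero_le _
  | succ r ih => rw [c.off_succ]; omega

end Inst

theorem readHeader_spec (hW : c.Fits W) {s : St Var} (h : Input c s.mem) :
    Tri W c.S readHeader s 20 (fun s' => s'.mem = s.mem ∧ s'.reg .n = c.n ∧ s'.reg .nt = c.nt ∧
      s'.reg .ini = c.ini ∧ s'.reg .R = c.R) := by
  have h2 := c.W0_le_S
  have h3 := c.five_le_W0
  refine Tri.of_wp (by decide) ?_
  simp only [readHeader, Pr.wp, Ex.ok_mem, Ex.eval_mem, Ex.eval_num, Ex.ok_num, true_and,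
    St.set_reg, St.set_mem, reduceCtorEq, if_false, if_true, h.n, h.nt, h.ini, h.R]
  and_intros <;> first | trivial | omega | exact hW.lt (by omega)

theorem skipRules_spec (hW : c.Fits W) {s : St Var} (h : Input c s.mem) (hR : s.reg .R = c.R) :
    Tri W c.S skipRules s (40 * c.W0) (fun s' => s'.mem = s.mem ∧ s'.reg .q = c.W0) := by
  have h2 := c.W0_le_S
  have h3 := c.five_le_W0
  have hRle := c.le_off c.R
  have hW0 : c.W0 = 5 + c.off c.R := rfl
  refine Tri.wp_seq (T₂ := 30 * c.W0) ?_ ?_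
  · change 2 + _ ≤ _
    omega
  simp only [Pr.wp, Ex.ok_num, Ex.eval_num]
  refine ⟨hW.lt (by omega), hW.lt (by omega), ?_⟩
  refine Tri.whl_count c.R (fun r s' => s'.mem = s.mem ∧ s'.reg .q = 5 + c.off r ∧ s'.reg .r = r)
    20 ?_ ?_ ?_ ?_ ?_
  · exact ⟨rfl, by simp [Inst.off], by simp⟩
  · rintro r s' hr hf ⟨-, -, hr'⟩
    have : s'.reg .R = c.R := (hf _ rfl).trans (by simpa using hR)
    simp only [Ex.ok_sub, Ex.ok_var, Ex.eval_sub, Ex.eval_var, hr', this, true_and]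
    omega
  · rintro r s' hr hf ⟨hm, hq, hr'⟩
    have hlt := c.pos_lt hr le_rfl
    unfold Inst.pos at hlt
    have hlen := h.inp.len r hr
    refine Tri.of_wp (by decide) ?_
    simp only [skipRulesBody, Pr.wp, Ex.ok_mem, Ex.ok_var, Ex.eval_var, Ex.eval_mem, Ex.eval_add,
      Ex.eval_num, Ex.ok_add, Ex.ok_num, true_and, St.set_reg, St.set_mem, reduceCtorEq, if_false,
      if_true, hq, hr', hm, hlen, c.off_succ]
    and_intros <;> first | trivial | omega | exact hW.lt (by omega)
  · change c.R * (20 + 5 + 1) + 5 + 1 ≤ _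
    omega
  · rintro s' - ⟨hm, hq, -⟩
    exact ⟨hm, hq⟩

/-- Halving `x` lowers its logarithm by one, so the sum with `lg` is invariant. Taking `x` itself as
the measure gives only a linear bound, which is negligible in the total. -/
theorem computeLog_spec (hW : c.Fits W) {s : St Var} (hn : s.reg .n = c.n) :
    Tri W c.S computeLog s (20 * c.n + 20) (fun s' => s'.mem = s.mem ∧
      s'.reg .lg = Nat.log 2 c.n) := by
  have hS : c.n ≤ c.S := by have := c.P0_le_S; unfold Inst.P0 at this; omega
  refine Tri.wp_seq (T₂ := 20 * c.n + 10) ?_ ?_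
  · change 3 + _ ≤ _
    omega
  simp only [Pr.wp, Ex.ok_num, Ex.eval_num, Ex.ok_var, Ex.eval_var, true_and, hn]
  refine ⟨hW.lt (by omega), ?_⟩
  refine Tri.whl_measure (fun s' => s'.reg .x) (fun s' => s'.mem = s.mem ∧
    Nat.log 2 (s'.reg .x) + s'.reg .lg = Nat.log 2 c.n) 10 (N := c.n) ?_ ?_ ?_ ?_ ?_ ?_
  · exact ⟨rfl, by simp⟩
  · simp
  · intros
    simp only [Ex.ok_div, Ex.ok_var, Ex.ok_num, true_and]
    exact hW.lt (by omega)
  · rintro s' - ⟨hm, hlg⟩ hne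
    simp only [Ex.eval_div, Ex.eval_var, Ex.eval_num] at hne
    have hlog := Nat.log_div_base 2 (s'.reg .x)
    have hpos : 0 < Nat.log 2 (s'.reg .x) := Nat.log_pos (by norm_num) (by omega)
    have hle := Nat.log_le_self 2 c.n
    refine Tri.of_wp (by decide) ?_
    simp only [logBody, Pr.wp, Ex.ok_div, Ex.eval_div, Ex.ok_var, Ex.eval_var, Ex.eval_add,
      Ex.eval_num, Ex.ok_add, Ex.ok_num, true_and, St.set_reg, St.set_mem, reduceCtorEq, if_false,
      if_true, hm]
    and_intros <;> first | trivial | omega | exact hW.lt (by omega)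
  · change c.n * (10 + 4 + 1) + 4 + 1 ≤ _
    omega
  · rintro s' - ⟨hm, hlg⟩ h0
    simp only [Ex.eval_div, Ex.eval_var, Ex.eval_num] at h0
    have : Nat.log 2 (s'.reg .x) = 0 := Nat.log_of_lt (by omega)
    exact ⟨hm, by omega⟩

theorem computeSide_spec (hW : c.Fits W) {s : St Var} (hlg : s.reg .lg = Nat.log 2 c.n) :
    Tri W c.S computeSide s (30 * c.s + 20) (fun s' => s'.mem = s.mem ∧ s'.reg .s = c.s) := by
  have hS := c.P0_le_S
  have hs := c.s_le_s2
  have hpos := c.s_pos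
  have hn : c.n ≤ c.S := by unfold Inst.P0 at hS; omega
  have hle := Nat.log_le_self 2 c.n
  refine Tri.wp_seq (T₂ := 30 * c.s + 19) ?_ ?_
  · change 1 + _ ≤ _
    omega
  simp only [Pr.wp, Ex.ok_num, Ex.eval_num]
  refine ⟨hW.lt (by omega), ?_⟩
  refine Tri.whl_count (c.s - 1) (fun k s' => s'.mem = s.mem ∧ s'.reg .s = 1 + k) 4 ?_ ?_ ?_ ?_ ?_
  · exact ⟨rfl, by simp⟩
  · rintro k s' hk hf ⟨hm, hs'⟩
    have hlg' : s'.reg .lg = Nat.log 2 c.n := (hf _ rfl).trans (by simpa using hlg)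
    -- The test squares `s + 1`, up to one beyond the final side; this bound keeps the product
    -- within a word.
    have hsq : (1 + k + 1) * (1 + k + 1) ≤ 3 * c.s2 + 1 := by
      have h1 : (1 + k + 1) * (1 + k + 1) ≤ (c.s + 1) * (c.s + 1) :=
        Nat.mul_le_mul (by omega) (by omega)
      have h2 : (c.s + 1) * (c.s + 1) = c.s2 + 2 * c.s + 1 := by unfold Inst.s2; ring
      omega
    have key : k < c.s - 1 ↔ 16 * ((1 + k + 1) * (1 + k + 1)) ≤ Nat.log 2 c.n := by
      have h1 : k < c.s - 1 ↔ 1 + k + 1 ≤ Nat.sqrt (Nat.log 2 c.n / 16) := by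
        unfold Inst.s; omega
      rw [h1, Nat.le_sqrt, Nat.le_div_iff_mul_le (by norm_num), mul_comm]
    simp only [Ex.ok_sub, Ex.ok_var, Ex.eval_sub, Ex.eval_var, Ex.ok_add, Ex.eval_add, Ex.ok_num,
      Ex.eval_num, Ex.ok_mul, Ex.eval_mul, hs', hlg', true_and, key]
    refine ⟨?_, by omega⟩
    and_intros <;> exact hW.lt (by omega)
  · rintro k s' hk hf ⟨hm, hs'⟩
    refine Tri.of_wp (by decide) ?_
    simp only [Pr.wp, Ex.ok_var, Ex.eval_var, Ex.eval_add, Ex.eval_num, Ex.ok_add, Ex.ok_num,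
      true_and, St.set_reg, St.set_mem, if_true, hm, hs']
    exact ⟨⟨hW.lt (by omega), hW.lt (by omega)⟩, by omega⟩
  · have : (Ex.var Var.lg + 1 - 16 * ((Ex.var Var.s + 1) * (Ex.var Var.s + 1))).cost ≤ 20 := by
      decide
    generalize Ex.cost _ = y at *
    nlinarith [Nat.sub_le c.s 1]
  · rintro s' - ⟨hm, hs'⟩
    exact ⟨hm, by omega⟩

theorem buildPow_spec (hW : c.Fits W) {s : St Var} (h : Input c s.mem) (hn : s.reg .n = c.n)
    (hq : s.reg .q = c.W0) (hs : s.reg .s = c.s) :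
    Tri W c.S buildPow s (40 * c.s2 + 80) (fun s' => s'.reg .W0 = c.W0 ∧ s'.reg .s2 = c.s2 ∧
      s'.reg .M = c.M ∧ s'.reg .P0 = c.P0 ∧ c.Inp s'.mem ∧ c.Pow s'.mem ∧
      ∀ a, c.F0 ≤ a → s'.mem a = 0) := by
  have hS := c.P0_le_S
  have hss := c.s_le_s2
  have hM := c.M_le_S
  have hP : c.P0 = c.W0 + c.n := rfl
  have hs2 : c.s * c.s = c.s2 := rfl
  have hMd : c.n / c.s + 1 = c.M := rfl
  have hB := c.B_le_S
  refine Tri.wp_seq (T₂ := 40 * c.s2 + 50) ?_ ?_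
  · change 21 + _ ≤ _
    omega
  simp only [Pr.wp, Ex.ok_var, Ex.eval_var, Ex.eval_add, Ex.eval_num, Ex.ok_add, Ex.ok_num,
    Ex.ok_mul, Ex.eval_mul, Ex.ok_div, Ex.eval_div, true_and, St.set_reg, St.set_mem, reduceCtorEq,
    if_false, if_true, hn, hq, hs, hs2, hMd, ← hP]
  refine ⟨hW.lt (by omega), ⟨hW.lt (by omega), hW.lt (by omega)⟩, hW.lt (by omega),
    hW.lt (by omega), hW.lt (by omega), ?_⟩
  refine Tri.whl_count (c.s2 + 1) (fun k s' => s'.reg .k = k ∧ s'.reg .v = 2 ^ k ∧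
    (∀ a < c.P0, s'.mem a = s.mem a) ∧ (∀ e < k, s'.mem (c.P0 + e) = 2 ^ e) ∧
    ∀ a, c.P0 + k ≤ a → s'.mem a = 0) 25 ?_ ?_ ?_ ?_ ?_
  · exact ⟨by simp, by simp, fun _ _ => rfl, fun e he => absurd he (Nat.not_lt_zero _),
      fun a ha => h.zero a (by omega)⟩
  · rintro k s' hk hf ⟨hk', -⟩
    have : s'.reg .s2 = c.s2 := (hf _ rfl).trans (by simp)
    simp only [Ex.ok_sub, Ex.ok_var, Ex.eval_sub, Ex.eval_var, Ex.ok_add, Ex.eval_add, Ex.ok_num,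
      Ex.eval_num, hk', this, true_and]
    exact ⟨⟨⟨hW.lt (by omega), hW.lt (by omega)⟩, trivial⟩, by omega⟩
  · rintro k s' hk hf ⟨hk', hv, h1, h2, h3⟩
    have hP0 : s'.reg .P0 = c.P0 := (hf _ rfl).trans (by simp)
    have hpow : 2 ^ k ≤ c.B := Nat.pow_le_pow_right (by norm_num) (by omega)
    refine Tri.of_wp (by decide) ?_
    simp only [powBody, Pr.wp, Ex.ok_var, Ex.eval_var, Ex.eval_add, Ex.eval_num, Ex.ok_add,
      Ex.ok_num, Ex.ok_mul, Ex.eval_mul, true_and, St.set_reg, St.set_mem, St.sto_reg, St.sto_mem,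
      reduceCtorEq, if_false, if_true, hk', hv, hP0]
    refine ⟨⟨hW.lt (by omega), by omega⟩, ⟨hW.lt (by omega), hW.lt (by omega)⟩,
      ⟨hW.lt (by omega), hW.lt (by omega)⟩, (pow_succ _ _).symm, ?_, ?_, ?_⟩
    · intro a ha
      rw [Function.update_of_ne (by omega), h1 a ha]
    · intro e he
      rcases Nat.lt_succ_iff_lt_or_eq.1 he with he | rfl
      · rw [Function.update_of_ne (by omega), h2 e he]
      · rw [Function.update_self]
    · intro a ha
      rw [Function.update_of_ne (by omega), h3 a (by omega)]
  · change (c.s2 + 1) * (25 + 7 + 1) + 7 + 1 ≤ _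
    omega
  · rintro s' hf ⟨-, -, h1, h2, h3⟩
    refine ⟨(hf _ rfl).trans (by simp), (hf _ rfl).trans (by simp), (hf _ rfl).trans (by simp),
      (hf _ rfl).trans (by simp), h.inp.congr h1, fun e he => h2 e (by omega), fun a ha => ?_⟩
    exact h3 a (by unfold Inst.F0 at ha; omega)

theorem setLayout_spec (hW : c.Fits W) {s : St Var} (hnt : s.reg .nt = c.nt)
    (hW0 : s.reg .W0 = c.W0) (hs2 : s.reg .s2 = c.s2) (hM : s.reg .M = c.M)
    (hP0 : s.reg .P0 = c.P0) (hpow : c.Pow s.mem) :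
    Tri W c.S setLayout s 60 (fun s' => s'.mem = s.mem ∧ s'.reg .B = c.B ∧ s'.reg .F0 = c.F0 ∧
      s'.reg .T0 = c.T0 ∧ s'.reg .I0 = c.I0 ∧ s'.reg .D0 = c.D0) := by
  have h1 := c.F0_le_T0
  have h2 := c.T0_le_I0
  have h3 := c.I0_le_D0
  have h4 := c.D0_le_S
  have hS := c.P0_le_S
  have hMS := c.M_le_S
  have eB : s.mem (c.P0 + c.s2) = c.B := hpow _ le_rfl
  have eF : c.P0 + c.s2 + 1 = c.F0 := rfl
  have eT : c.F0 + c.B * c.B * c.B = c.T0 := rfl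
  have eI : c.T0 + c.nt * (2 * c.M) = c.I0 := rfl
  have eD : c.I0 + c.W0 * c.M = c.D0 := rfl
  have hBB : c.B * c.B ≤ c.B * c.B * c.B := Nat.le_mul_of_pos_right _ c.B_pos
  refine Tri.of_wp (by decide) ?_
  simp only [setLayout, Pr.wp, Ex.ok_var, Ex.eval_var, Ex.eval_add, Ex.eval_num, Ex.ok_add,
    Ex.ok_num, Ex.ok_mul, Ex.eval_mul, Ex.ok_mem, Ex.eval_mem, true_and, St.set_reg, St.set_mem,
    reduceCtorEq, if_false, if_true, hnt, hW0, hs2, hM, hP0, eB, eF, eT, eI, eD]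
  and_intros <;> first | trivial | omega | exact hW.lt (by omega)

theorem buildId_spec (hW : c.Fits W) {s : St Var} (henv : Env₀ c s) (hpow : c.Pow s.mem) :
    Tri W c.S buildId s (60 * c.s2 + 20) (fun s' => s'.mem = s.mem ∧ c.IsId (s'.reg .idm)) := by
  have hS := c.P0_le_S
  have hB := c.B_le_S
  refine Tri.wp_seq (T₂ := 60 * c.s2 + 10) ?_ ?_
  · change 2 + _ ≤ _
    omega
  simp only [Pr.wp, Ex.ok_num, Ex.eval_num]
  refine ⟨hW.lt (by omega), hW.lt (by omega), ?_⟩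
  refine Tri.whl_count c.s2 (fun e s' => s'.mem = s.mem ∧ s'.reg .e = e ∧
    BitsUpTo (s'.reg .idm) e (fun e => e / c.s = e % c.s)) 50 ?_ ?_ ?_ ?_ ?_
  · exact ⟨rfl, by simp, by simp [BitsUpTo]⟩
  · rintro e s' he hf ⟨-, he', -⟩
    have : s'.reg .s2 = c.s2 := (hf _ rfl).trans (by simpa using henv.s2)
    simp only [Ex.ok_sub, Ex.ok_var, Ex.eval_sub, Ex.eval_var, he', this, true_and]
    omega
  · rintro e s' he hf ⟨hm, he', hb⟩
    have hs : s'.reg .s = c.s := (hf _ rfl).trans (by simpa using henv.s)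
    have hP0 : s'.reg .P0 = c.P0 := (hf _ rfl).trans (by simpa using henv.P0)
    have hmod : e - e / c.s * c.s = e % c.s := by
      have := Nat.div_add_mod' e c.s; omega
    have hdiv : e / c.s ≤ e := Nat.div_le_self _ _
    have hmodle : e % c.s ≤ e := Nat.mod_le _ _
    have hmulle : e / c.s * c.s ≤ e := Nat.div_mul_le_self _ _
    have hpe : s.mem (c.P0 + e) = 2 ^ e := hpow e he.le
    have hlt : 2 ^ e ≤ c.B := Nat.pow_le_pow_right (by norm_num) he.le
    have hb1 := hb.1
    refine Tri.of_wp (by decide) ?_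
    simp only [idBody, Pr.wp, Ex.ok_var, Ex.eval_var, Ex.eval_add, Ex.eval_num, Ex.ok_add,
      Ex.ok_num, Ex.ok_mul, Ex.eval_mul, Ex.ok_sub, Ex.eval_sub, Ex.ok_div, Ex.eval_div, Ex.ok_mem,
      Ex.eval_mem, true_and, and_true, St.set_reg, St.set_mem, reduceCtorEq, if_false, if_true, he', hs,
      hP0, hm, hmod, hpe]
    have hsum : e / c.s - e % c.s + (e % c.s - e / c.s) ≤ e := by
      generalize e / c.s = x at *
      generalize e % c.s = y at *
      omega
    refine ⟨hW.lt (by omega), hW.lt (by omega), fun hne => ?_, fun heq => ?_⟩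
    · exact ⟨⟨hW.lt (by omega), hW.lt (by omega)⟩, hb.succ_false (by omega)⟩
    · refine ⟨⟨⟨hW.lt (by omega), by omega⟩, hW.lt (by omega)⟩,
        ⟨hW.lt (by omega), hW.lt (by omega)⟩, hb.succ_true (by omega)⟩
  · change c.s2 * (50 + 5 + 1) + 5 + 1 ≤ _
    omega
  · rintro s' - ⟨hm, -, hb⟩
    exact ⟨hm, hb⟩

end CFRec

/-! ### The multiplication table. -/

namespace CFRec

open Imp

set_option linter.unusedSimpArgs false

variable {c : Inst} {W : ℕ}

theorem bitEx_eval {s : St Var} (hP : s.reg .P0 = c.P0) (hpow : c.Pow s.mem) {a b : Ex Var}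
    (hb : b.eval s ≤ c.s2) :
    (bitEx a b).eval s = ((a.eval s).testBit (b.eval s)).toNat := by
  have h1 : s.mem (c.P0 + b.eval s) = 2 ^ b.eval s := hpow _ hb
  simp only [bitEx, Ex.eval_sub, Ex.eval_div, Ex.eval_mul, Ex.eval_mem, Ex.eval_add, Ex.eval_var,
    Ex.eval_num, hP, h1]
  rw [Nat.toNat_testBit]
  omega

theorem bitEx_ok (hW : c.Fits W) {s : St Var} (hP : s.reg .P0 = c.P0) {a b : Ex Var}
    (ha : a.ok W c.S s) (hb : b.ok W c.S s) (hb' : b.eval s ≤ c.s2) (ha' : a.eval s ≤ c.S) :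
    (bitEx a b).ok W c.S s := by
  have hS := c.P0_le_S
  have h2 : a.eval s / s.mem (c.P0 + b.eval s) ≤ a.eval s := Nat.div_le_self _ _
  simp only [bitEx, Ex.ok_sub, Ex.ok_div, Ex.ok_mul, Ex.ok_mem, Ex.ok_add, Ex.ok_var,
    Ex.ok_num, Ex.eval_sub, Ex.eval_div, Ex.eval_mul, Ex.eval_mem, Ex.eval_add, Ex.eval_var,
    Ex.eval_num, hP, true_and]
  generalize a.eval s / s.mem (c.P0 + b.eval s) = y at *
  and_intros <;> first | assumption | omega | exact hW.lt (by omega)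

/-- The entry `e` of the matrix `z ∨ x · y`. -/
def MulAddBit (c : Inst) (z x y e : ℕ) : Prop :=
  z.testBit e = true ∨
    ∃ t < c.s, x.testBit (e / c.s * c.s + t) = true ∧ y.testBit (t * c.s + e % c.s) = true

theorem entryBody_spec (hW : c.Fits W) {s : St Var} {z x y e : ℕ} (henv : Env₀ c s)
    (hpow : c.Pow s.mem) (he : e < c.s2) (hz : s.reg .z = z) (hx : s.reg .x = x)
    (hy : s.reg .y = y) (he' : s.reg .e = e) (hzB : z < c.B) (hxB : x < c.B) (hyB : y < c.B)
    (hv : BitsUpTo (s.reg .v) e (MulAddBit c z x y)) :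
    Tri W c.S entryBody s (100 * c.s + 100) (fun s' => s'.mem = s.mem ∧ s'.reg .e = e + 1 ∧
      BitsUpTo (s'.reg .v) (e + 1) (MulAddBit c z x y)) := by
  have hS := c.P0_le_S
  have hB := c.B_le_S
  have hss := c.s_le_s2
  have hi : e / c.s < c.s := Nat.div_lt_of_lt_mul he
  have hj : e % c.s < c.s := Nat.mod_lt _ c.s_pos
  have hmod : e - e / c.s * c.s = e % c.s := by
    have := Nat.div_add_mod' e c.s; omega
  have hmulle : e / c.s * c.s ≤ e := Nat.div_mul_le_self _ _
  refine Tri.wp_seq (T₂ := 100 * c.s + 50) ?_ ?_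
  · have : Pr.cost ((Pr.set Var.i (Ex.var Var.e / Ex.var Var.s)).seq
      ((Pr.set Var.j (Ex.var Var.e - Ex.var Var.e / Ex.var Var.s * Ex.var Var.s)).seq
        ((Pr.set Var.h (bitEx (Ex.var Var.z) (Ex.var Var.e))).seq (Pr.set Var.t 0)))) ≤ 50 := by
      decide
    omega
  simp only [Pr.wp]
  have hevb : (bitEx (Ex.var Var.z) (Ex.var Var.e)).eval
      ((s.set Var.i (e / c.s)).set Var.j (e % c.s)) = (z.testBit e).toNat := by
    rw [bitEx_eval (c := c)]
    · simp [hz, he']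
    · simpa using henv.P0
    · exact hpow
    · simpa [he'] using he.le
  simp only [Ex.ok_var, Ex.eval_var, Ex.eval_num, Ex.ok_num, Ex.ok_mul, Ex.eval_mul, Ex.ok_sub,
    Ex.eval_sub, Ex.ok_div, Ex.eval_div, true_and, and_true, St.set_reg, St.set_mem, reduceCtorEq,
    if_false, if_true, he', henv.s, hmod, hevb]
  refine ⟨hW.lt (by omega), ?_, hW.lt (by omega), ?_⟩
  · refine bitEx_ok hW ?_ ?_ ?_ ?_ ?_
    · simpa using henv.P0
    · trivial
    · trivial
    · simpa [he'] using he.le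
    · simpa [hz] using by omega
  refine Tri.seq (T₁ := 100 * c.s + 10) (T₂ := 20) (Q₁ := fun s' => s'.mem = s.mem ∧
    (s'.reg .h ≠ 0 ↔ MulAddBit c z x y e)) ?_ (by omega) ?_
  -- `h` counts the bit of `z` together with the witnesses `t'`; only its being nonzero matters, and
  -- `h ≤ 1 + t` excludes overflow.
  · refine Tri.whl_count c.s (fun t s' => s'.mem = s.mem ∧ s'.reg .t = t ∧ s'.reg .h ≤ 1 + t ∧
      (s'.reg .h ≠ 0 ↔ z.testBit e = true ∨ ∃ t' < t, x.testBit (e / c.s * c.s + t') = true ∧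
        y.testBit (t' * c.s + e % c.s) = true)) 90 ?_ ?_ ?_ ?_ ?_
    · refine ⟨rfl, by simp, ?_, ?_⟩
      · simpa using Bool.toNat_le _
      · simp
    · rintro t s' ht hf ⟨-, ht', -⟩
      have : s'.reg .s = c.s := (hf _ rfl).trans (by simpa using henv.s)
      simp only [Ex.ok_sub, Ex.ok_var, Ex.eval_sub, Ex.eval_var, ht', this, true_and]
      omega
    · rintro t s' ht hf ⟨hm, ht', hle, hiff⟩
      have hs : s'.reg .s = c.s := (hf _ rfl).trans (by simpa using henv.s)
      have hP : s'.reg .P0 = c.P0 := (hf _ rfl).trans (by simpa using henv.P0)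
      have hx' : s'.reg .x = x := (hf _ rfl).trans (by simpa using hx)
      have hy' : s'.reg .y = y := (hf _ rfl).trans (by simpa using hy)
      have hi' : s'.reg .i = e / c.s := (hf _ rfl).trans (by simp)
      have hj' : s'.reg .j = e % c.s := (hf _ rfl).trans (by simp)
      have hlt1 := c.index_lt hi ht
      have hlt2 := c.index_lt ht hj
      have hpow' : c.Pow s'.mem := hm ▸ hpow
      have hev1 : (Ex.var Var.i * Ex.var Var.s + Ex.var Var.t).eval s' = e / c.s * c.s + t := by
        simp [hi', hs, ht']
      have hev2 : (Ex.var Var.t * Ex.var Var.s + Ex.var Var.j).eval s' = t * c.s + e % c.s := by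
        simp [hj', hs, ht']
      have hb1 := bitEx_eval hP hpow' (a := .var .x)
        (b := Ex.var Var.i * Ex.var Var.s + Ex.var Var.t) (by rw [hev1]; omega)
      have hb2 := bitEx_eval hP hpow' (a := .var .y)
        (b := Ex.var Var.t * Ex.var Var.s + Ex.var Var.j) (by rw [hev2]; omega)
      rw [hev1, Ex.eval_var, hx'] at hb1
      rw [hev2, Ex.eval_var, hy'] at hb2
      have hok1 : (bitEx (.var .x) (Ex.var Var.i * Ex.var Var.s + Ex.var Var.t)).ok W c.S s' := by
        refine bitEx_ok hW hP trivial ?_ (by rw [hev1]; omega)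
          (by rw [Ex.eval_var, hx']; omega)
        simp only [Ex.ok_add, Ex.ok_mul, Ex.ok_var, Ex.eval_mul, Ex.eval_var, true_and, hi', hs, ht']
        exact ⟨hW.lt (by omega), hW.lt (by omega)⟩
      have hok2 : (bitEx (.var .y) (Ex.var Var.t * Ex.var Var.s + Ex.var Var.j)).ok W c.S s' := by
        refine bitEx_ok hW hP trivial ?_ (by rw [hev2]; omega)
          (by rw [Ex.eval_var, hy']; omega)
        simp only [Ex.ok_add, Ex.ok_mul, Ex.ok_var, Ex.eval_mul, Ex.eval_var, true_and, hj', hs, ht']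
        exact ⟨hW.lt (by omega), hW.lt (by omega)⟩
      refine Tri.of_wp (by decide) ?_
      simp only [dotBody, Pr.wp, Ex.ok_add, Ex.eval_add, Ex.ok_mul, Ex.eval_mul, hok1, hok2, hb1,
        hb2, Ex.ok_var, Ex.eval_var, Ex.ok_num, Ex.eval_num, true_and, St.set_reg, St.set_mem,
        reduceCtorEq, if_false, if_true, hm, ht']
      have hl1 := Bool.toNat_le (x.testBit (e / c.s * c.s + t))
      have hl2 := Bool.toNat_le (y.testBit (t * c.s + e % c.s))
      have hl3 := Nat.mul_le_mul hl1 hl2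
      have hsucc : (∃ t' < t + 1, x.testBit (e / c.s * c.s + t') = true ∧
            y.testBit (t' * c.s + e % c.s) = true) ↔
          (∃ t' < t, x.testBit (e / c.s * c.s + t') = true ∧
            y.testBit (t' * c.s + e % c.s) = true) ∨
          (x.testBit (e / c.s * c.s + t) = true ∧ y.testBit (t * c.s + e % c.s) = true) := by
        constructor
        · rintro ⟨t', h1, h2⟩
          rcases Nat.lt_succ_iff_lt_or_eq.1 h1 with h1 | rfl
          · exact Or.inl ⟨t', h1, h2⟩
          · exact Or.inr h2
        · rintro (⟨t', h1, h2⟩ | h2)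
          · exact ⟨t', by omega, h2⟩
          · exact ⟨t, by omega, h2⟩
      refine ⟨⟨hW.lt (by omega), hW.lt (by omega)⟩, ⟨hW.lt (by omega), hW.lt (by omega)⟩,
        by omega, ?_⟩
      rw [hsucc, ← or_assoc, ← hiff]
      cases x.testBit (e / c.s * c.s + t) <;> cases y.testBit (t * c.s + e % c.s) <;> simp
    · change c.s * (90 + 5 + 1) + 5 + 1 ≤ _
      omega
    · rintro s' - ⟨hm, -, -, hiff⟩
      exact ⟨hm, hiff⟩
  · rintro s₁ hf ⟨hm, hiff⟩
    have hP : s₁.reg .P0 = c.P0 := (hf _ rfl).trans (by simpa using henv.P0)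
    have he₁ : s₁.reg .e = e := (hf _ rfl).trans (by simpa using he')
    have hv₁ : s₁.reg .v = s.reg .v := (hf _ rfl).trans (by simp)
    have hpe : s.mem (c.P0 + e) = 2 ^ e := hpow e he.le
    have hlt : 2 ^ e ≤ c.B := Nat.pow_le_pow_right (by norm_num) he.le
    have hb1 := hv.1
    refine Tri.of_wp (by decide) ?_
    simp only [Pr.wp, Ex.ok_add, Ex.eval_add, Ex.ok_mem, Ex.eval_mem, Ex.ok_var, Ex.eval_var,
      Ex.ok_num, Ex.eval_num, true_and, St.set_reg, St.set_mem, reduceCtorEq, if_false, if_true, hm,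
      hP, he₁, hv₁, hpe]
    refine ⟨fun hne => ?_, fun heq => ?_⟩
    · refine ⟨⟨⟨hW.lt (by omega), by omega⟩, hW.lt (by omega)⟩,
        ⟨hW.lt (by omega), hW.lt (by omega)⟩, hv.succ_true (hiff.1 hne)⟩
    · refine ⟨⟨hW.lt (by omega), hW.lt (by omega)⟩, hv.succ_false fun h => ?_⟩
      exact hiff.2 h heq

theorem tableBody_spec (hW : c.Fits W) {s : St Var} {idx : ℕ} (henv : Env₀ c s)
    (hpow : c.Pow s.mem) (hidx : idx < c.B * c.B * c.B) (hidx' : s.reg .idx = idx) :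
    Tri W c.S tableBody s (c.s2 * (100 * c.s + 110) + 80) (fun s' => s'.reg .idx = idx + 1 ∧
      ∃ v, c.IsMulAdd (idx / c.B / c.B) (idx / c.B % c.B) (idx % c.B) v ∧
        s'.mem = Function.update s.mem (c.F0 + idx) v) := by
  have h1 := c.T0_le_I0
  have h2 := c.I0_le_D0
  have h3 := c.D0_le_S
  have hT : c.F0 + c.B * c.B * c.B = c.T0 := rfl
  have hz : idx / c.B / c.B < c.B := by
    rw [Nat.div_div_eq_div_mul]
    exact Nat.div_lt_of_lt_mul hidx
  have hx : idx / c.B % c.B < c.B := Nat.mod_lt _ c.B_pos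
  have hy : idx % c.B < c.B := Nat.mod_lt _ c.B_pos
  have hmod1 : idx / c.B - idx / c.B / c.B * c.B = idx / c.B % c.B := by
    have := Nat.div_add_mod' (idx / c.B) c.B; omega
  have hmod2 : idx - idx / c.B * c.B = idx % c.B := by
    have := Nat.div_add_mod' idx c.B; omega
  have hm1 : idx / c.B / c.B * c.B ≤ idx := (Nat.div_mul_le_self _ _).trans (Nat.div_le_self _ _)
  have hm2 : idx / c.B * c.B ≤ idx := Nat.div_mul_le_self _ _
  refine Tri.wp_seq (T₂ := c.s2 * (100 * c.s + 110) + 30) ?_ ?_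
  · change 38 + _ ≤ _
    omega
  simp only [Pr.wp, Ex.ok_var, Ex.eval_var, Ex.eval_num, Ex.ok_num, Ex.ok_mul, Ex.eval_mul,
    Ex.ok_sub, Ex.eval_sub, Ex.ok_div, Ex.eval_div, true_and, and_true, St.set_reg, St.set_mem,
    reduceCtorEq, if_false, if_true, hidx', henv.B, hmod1, hmod2]
  refine ⟨hW.lt (by omega), hW.lt (by omega), hW.lt (by omega), hW.lt (by omega), ?_⟩
  refine Tri.seq (T₁ := c.s2 * (100 * c.s + 110) + 10) (T₂ := 20) (Q₁ := fun s' =>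
    s'.mem = s.mem ∧ BitsUpTo (s'.reg .v) c.s2
      (MulAddBit c (idx / c.B / c.B) (idx / c.B % c.B) (idx % c.B))) ?_ (by omega) ?_
  · refine Tri.whl_count c.s2 (fun e s' => s'.mem = s.mem ∧ s'.reg .e = e ∧ BitsUpTo (s'.reg .v) e
      (MulAddBit c (idx / c.B / c.B) (idx / c.B % c.B) (idx % c.B))) (100 * c.s + 100) ?_ ?_ ?_ ?_ ?_
    · exact ⟨rfl, by simp, by simp [BitsUpTo]⟩
    · rintro e s' he hf ⟨-, he', -⟩
      have : s'.reg .s2 = c.s2 := (hf _ rfl).trans (by simpa using henv.s2)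
      simp only [Ex.ok_sub, Ex.ok_var, Ex.eval_sub, Ex.eval_var, he', this, true_and]
      omega
    · rintro e s' he hf ⟨hm, he', hb⟩
      have henv' : Env₀ c s' := by
        refine Env₀.frame ?_ hf rfl
        exact ⟨henv.n, henv.ini, henv.R, henv.W0, henv.s, henv.s2, henv.M, henv.P0, henv.B,
          henv.F0, henv.T0, henv.I0, henv.D0⟩
      refine (entryBody_spec hW henv' (hm ▸ hpow) he ((hf _ rfl).trans (by simp))
        ((hf _ rfl).trans (by simp)) ((hf _ rfl).trans (by simp)) he' hz hx hy hb).mono le_rfl ?_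
      rintro s'' - ⟨hm', he'', hb'⟩
      exact ⟨hm'.trans hm, he'', hb'⟩
    · change c.s2 * (100 * c.s + 100 + 5 + 1) + 5 + 1 ≤ _
      have : c.s2 * (100 * c.s + 100 + 5 + 1) ≤ c.s2 * (100 * c.s + 110) :=
        Nat.mul_le_mul_left _ (by omega)
      omega
    · rintro s' - ⟨hm, -, hb⟩
      exact ⟨hm, hb⟩
  · rintro s₁ hf ⟨hm, hb⟩
    have hF : s₁.reg .F0 = c.F0 := (hf _ rfl).trans (by simpa using henv.F0)
    have hi : s₁.reg .idx = idx := (hf _ rfl).trans (by simpa using hidx')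
    refine Tri.of_wp (by decide) ?_
    simp only [Pr.wp, Ex.ok_add, Ex.eval_add, Ex.ok_var, Ex.eval_var, Ex.ok_num, Ex.eval_num,
      true_and, St.set_reg, St.set_mem, St.sto_reg, St.sto_mem, reduceCtorEq, if_false, if_true, hm,
      hF, hi]
    exact ⟨⟨hW.lt (by omega), by omega⟩, ⟨hW.lt (by omega), hW.lt (by omega)⟩, _, hb, rfl⟩

/-- The arguments `z`, `x`, `y` are the base-`B` digits of the running index. Computing the entries
bit by bit is affordable because `B ^ 3` is a small power of `n`. -/
theorem buildTable_spec (hW : c.Fits W) {s : St Var} (henv : Env₀ c s) (hpow : c.Pow s.mem)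
    (h0 : ∀ a, c.F0 ≤ a → s.mem a = 0) :
    Tri W c.S buildTable s (c.B * c.B * c.B * (c.s2 * (100 * c.s + 110) + 100) + 30) (fun s' =>
      (∀ a < c.F0, s'.mem a = s.mem a) ∧ c.Table s'.mem ∧ ∀ a, c.T0 ≤ a → s'.mem a = 0) := by
  have h1 := c.T0_le_I0
  have h2 := c.I0_le_D0
  have h3 := c.D0_le_S
  have hT : c.F0 + c.B * c.B * c.B = c.T0 := rfl
  have hBB : c.B * c.B ≤ c.B * c.B * c.B := Nat.le_mul_of_pos_right _ c.B_pos
  refine Tri.wp_seq (T₂ := c.B * c.B * c.B * (c.s2 * (100 * c.s + 110) + 100) + 20) ?_ ?_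
  · change 1 + _ ≤ _
    omega
  simp only [Pr.wp, Ex.ok_num, Ex.eval_num]
  refine ⟨hW.lt (by omega), ?_⟩
  refine Tri.whl_count (c.B * c.B * c.B) (fun k s' => s'.reg .idx = k ∧
    (∀ a < c.F0, s'.mem a = s.mem a) ∧
    (∀ i < k, c.IsMulAdd (i / c.B / c.B) (i / c.B % c.B) (i % c.B) (s'.mem (c.F0 + i))) ∧
    ∀ a, c.F0 + k ≤ a → s'.mem a = 0) (c.s2 * (100 * c.s + 110) + 80) ?_ ?_ ?_ ?_ ?_
  · exact ⟨by simp, fun _ _ => rfl, fun i hi => absurd hi (Nat.not_lt_zero _),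
      fun a ha => h0 a (by omega)⟩
  · rintro k s' hk hf ⟨hk', -⟩
    have : s'.reg .B = c.B := (hf _ rfl).trans (by simpa using henv.B)
    simp only [Ex.ok_sub, Ex.ok_var, Ex.eval_sub, Ex.eval_var, Ex.ok_mul, Ex.eval_mul, hk', this,
      true_and, and_true]
    exact ⟨⟨hW.lt (by omega), hW.lt (by omega)⟩, by omega⟩
  · rintro k s' hk hf ⟨hk', e1, e2, e3⟩
    have henv' : Env₀ c s' := by
      refine Env₀.frame ?_ hf rfl
      exact ⟨henv.n, henv.ini, henv.R, henv.W0, henv.s, henv.s2, henv.M, henv.P0, henv.B,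
        henv.F0, henv.T0, henv.I0, henv.D0⟩
    refine (tableBody_spec hW henv' (hpow.congr e1) hk hk').mono le_rfl ?_
    rintro s'' - ⟨hk'', v, hv, hm⟩
    rw [hm]
    refine ⟨hk'', fun a ha => ?_, fun i hi => ?_, fun a ha => ?_⟩
    · rw [Function.update_of_ne (by omega), e1 a ha]
    · rcases Nat.lt_succ_iff_lt_or_eq.1 hi with hi | rfl
      · rw [Function.update_of_ne (by omega)]
        exact e2 i hi
      · rw [Function.update_self]
        exact hv
    · rw [Function.update_of_ne (by omega), e3 a (by omega)]
  · change c.B * c.B * c.B * (c.s2 * (100 * c.s + 110) + 80 + 11 + 1) + 11 + 1 ≤ _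
    have : c.B * c.B * c.B * (c.s2 * (100 * c.s + 110) + 80 + 11 + 1) ≤
      c.B * c.B * c.B * (c.s2 * (100 * c.s + 110) + 100) := Nat.mul_le_mul_left _ (by omega)
    omega
  · rintro s' - ⟨-, e1, e2, e3⟩
    refine ⟨e1, fun z hz x hx y hy => ?_, e3⟩
    have hlt := pair_lt (pair_lt hz hx) hy
    have d1 : ((z * c.B + x) * c.B + y) / c.B = z * c.B + x := by
      rw [mul_comm, Nat.mul_add_div c.B_pos, Nat.div_eq_of_lt hy, add_zero]
    have d2 : ((z * c.B + x) * c.B + y) % c.B = y := by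
      rw [mul_comm, Nat.mul_add_mod, Nat.mod_eq_of_lt hy]
    have d3 : (z * c.B + x) / c.B = z := by
      rw [mul_comm, Nat.mul_add_div c.B_pos, Nat.div_eq_of_lt hx, add_zero]
    have d4 : (z * c.B + x) % c.B = x := by
      rw [mul_comm, Nat.mul_add_mod, Nat.mod_eq_of_lt hx]
    have := e2 _ hlt
    rwa [d1, d2, d3, d4] at this

end CFRec

/-! ### Terminal blocks, the final answer, and the complete program. -/

namespace CFRec

open Imp

set_option linter.unusedSimpArgs false

variable {c : Inst} {W : ℕ}

/-- The blocks of the terminals, for the first `k` letters of the string. -/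
def LettersUpTo (c : Inst) (k : ℕ) (m : ℕ → ℕ) : Prop :=
  ∀ a < c.nt, ∀ i j, j / c.s < c.M → i / c.s ≤ j / c.s → j / c.s ≤ i / c.s + 1 →
    (c.bit (m (c.T0 + a * (2 * c.M) + (i / c.s + j / c.s))) i j ↔ i < k ∧ c.w i = a ∧ j = i + 1)

theorem Inst.div_succ_le (c : Inst) (k : ℕ) : (k + 1) / c.s ≤ k / c.s + 1 := by
  calc (k + 1) / c.s ≤ (k + c.s) / c.s := Nat.div_le_div_right (by have := c.s_pos; omega)
    _ = k / c.s + 1 := Nat.add_div_right _ c.s_pos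

/-- The bit for `(k, k + 1)` is still clear, since only earlier letters have been entered. Adding `2
^ e` therefore sets it and changes nothing else. -/
theorem LettersUpTo.succ (hc : c.Valid) {k d e : ℕ} {m : ℕ → ℕ} (h : LettersUpTo c k m)
    (hrng : ∀ a, c.T0 ≤ a → m a < c.B) (hk : k < c.n) (hM : (k + 1) / c.s < c.M)
    (hd : d = c.T0 + c.w k * (2 * c.M) + (k / c.s + (k + 1) / c.s))
    (he : e = k % c.s * c.s + (k + 1) % c.s) :
    m d + 2 ^ e < c.B ∧ LettersUpTo c (k + 1) (Function.update m d (m d + 2 ^ e)) := by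
  have hle : k / c.s ≤ (k + 1) / c.s := Nat.div_le_div_right (by omega)
  have hle' := c.div_succ_le k
  have hbit : (m d).testBit e = false := by
    have := h _ (hc.w_lt k hk) k (k + 1) hM hle hle'
    rw [← hd] at this
    unfold Inst.bit at this
    rw [← he] at this
    simpa using this
  have hadd := testBit_add_two_pow hbit
  have hes : e < c.s2 := he ▸ c.bit_index_lt k (k + 1)
  refine ⟨Nat.lt_pow_two_of_testBit _ fun e' he' => ?_, ?_⟩
  · rw [Bool.eq_false_iff, Ne, hadd, not_or]
    refine ⟨?_, by omega⟩
    have : m d < 2 ^ c.s2 :=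
      hrng d (hd ▸ (Nat.le_add_right _ _).trans (Nat.le_add_right _ _))
    rw [Nat.testBit_lt_two_pow (this.trans_le (Nat.pow_le_pow_right (by norm_num) he'))]
    simp
  · intro a ha i j hj hij hij'
    by_cases hda : c.T0 + a * (2 * c.M) + (i / c.s + j / c.s) = d
    · have hinj := pair_inj (a := a) (b := i / c.s + j / c.s) (a' := c.w k)
        (b' := k / c.s + (k + 1) / c.s) (m := 2 * c.M) (by omega) (by omega) (by omega)
      obtain ⟨rfl, hsum⟩ := hinj
      -- In both pairs the column block is the row block or the next one, so equal sums force equal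
      -- pairs.
      have hi : i / c.s = k / c.s := by omega
      have hj' : j / c.s = (k + 1) / c.s := by omega
      have hold := h _ ha i j hj hij hij'
      rw [hda] at hold ⊢
      rw [Function.update_self]
      unfold Inst.bit at hold ⊢
      rw [hadd, hold]
      have key : i % c.s * c.s + j % c.s = e ↔ i = k ∧ j = k + 1 := by
        rw [he]
        constructor
        · intro hh
          obtain ⟨e1, e2⟩ := pair_inj (Nat.mod_lt _ c.s_pos) (Nat.mod_lt _ c.s_pos) hh
          constructor
          · rw [← Nat.div_add_mod i c.s, ← Nat.div_add_mod k c.s, hi, e1]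
          · rw [← Nat.div_add_mod j c.s, ← Nat.div_add_mod (k + 1) c.s, hj', e2]
        · rintro ⟨rfl, rfl⟩; rfl
      rw [key]
      constructor
      · rintro (⟨h1, h2, h3⟩ | ⟨rfl, h2⟩)
        · exact ⟨by omega, h2, h3⟩
        · exact ⟨by omega, rfl, h2⟩
      · rintro ⟨h1, h2, h3⟩
        rcases Nat.lt_succ_iff_lt_or_eq.1 h1 with h1 | rfl
        · exact Or.inl ⟨h1, h2, h3⟩
        · exact Or.inr ⟨rfl, h3⟩
    · rw [Function.update_of_ne hda, h a ha i j hj hij hij']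
      constructor
      · rintro ⟨h1, h2, h3⟩
        exact ⟨by omega, h2, h3⟩
      · rintro ⟨h1, h2, h3⟩
        refine ⟨?_, h2, h3⟩
        rcases Nat.lt_succ_iff_lt_or_eq.1 h1 with h1 | rfl
        · exact h1
        · subst h2 h3
          exact absurd hd.symm hda

theorem buildLetters_spec (hc : c.Valid) (hW : c.Fits W) {s : St Var} (henv : Env₀ c s)
    (hinp : c.Inp s.mem) (hpow : c.Pow s.mem) (h0 : ∀ a, c.T0 ≤ a → s.mem a = 0) :
    Tri W c.S buildLetters s (120 * c.n + 20) (fun s' => (∀ a < c.T0, s'.mem a = s.mem a) ∧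
      c.Letters s'.mem ∧ (∀ a, c.T0 ≤ a → s'.mem a < c.B) ∧ ∀ a, c.I0 ≤ a → s'.mem a = 0) := by
  have h1 := c.F0_le_T0
  have h2 := c.T0_le_I0
  have h3 := c.I0_le_D0
  have h4 := c.D0_le_S
  have h5 := c.P0_lt_F0
  have hP : c.P0 = c.W0 + c.n := rfl
  have hMS := c.M_le_S
  have hBS := c.B_le_S
  refine Tri.wp_seq (T₂ := 120 * c.n + 15) ?_ ?_
  · change 1 + _ ≤ _
    omega
  simp only [Pr.wp, Ex.ok_num, Ex.eval_num]
  refine ⟨hW.lt (by omega), ?_⟩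
  refine Tri.whl_count c.n (fun k s' => s'.reg .k = k ∧ (∀ a < c.T0, s'.mem a = s.mem a) ∧
    LettersUpTo c k s'.mem ∧ (∀ a, c.T0 ≤ a → s'.mem a < c.B) ∧ ∀ a, c.I0 ≤ a → s'.mem a = 0)
    110 ?_ ?_ ?_ ?_ ?_
  · refine ⟨by simp, fun _ _ => rfl, fun a ha i j _ _ _ => ?_, fun a ha => ?_,
      fun a ha => h0 a (by omega)⟩
    · simp [Inst.bit, h0 (c.T0 + a * (2 * c.M) + (i / c.s + j / c.s))
        ((Nat.le_add_right _ _).trans (Nat.le_add_right _ _))]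
    · simpa [h0 a ha] using c.B_pos
  · rintro k s' hk hf ⟨hk', -⟩
    have : s'.reg .n = c.n := (hf _ rfl).trans (by simpa using henv.n)
    simp only [Ex.ok_sub, Ex.ok_var, Ex.eval_sub, Ex.eval_var, hk', this, true_and]
    omega
  · rintro k s' hk hf ⟨hk', e1, e2, e3, e4⟩
    have hs : s'.reg .s = c.s := (hf _ rfl).trans (by simpa using henv.s)
    have hM : s'.reg .M = c.M := (hf _ rfl).trans (by simpa using henv.M)
    have hT0 : s'.reg .T0 = c.T0 := (hf _ rfl).trans (by simpa using henv.T0)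
    have hW0 : s'.reg .W0 = c.W0 := (hf _ rfl).trans (by simpa using henv.W0)
    have hP0 : s'.reg .P0 = c.P0 := (hf _ rfl).trans (by simpa using henv.P0)
    have hJM : (k + 1) / c.s < c.M :=
      Nat.lt_succ_of_le (Nat.div_le_div_right (by omega))
    have hKJ : k / c.s ≤ (k + 1) / c.s := Nat.div_le_div_right (by omega)
    have hw : s'.mem (c.W0 + k) = c.w k := by rw [e1 _ (by omega), hinp.w k hk]
    have hlt := Inst.letter_index_lt (c := c) (hc.w_lt k hk)
      (show k / c.s + (k + 1) / c.s < 2 * c.M by omega)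
    have hmod1 : k - k / c.s * c.s = k % c.s := by
      have := Nat.div_add_mod' k c.s; omega
    have hmod2 : k + 1 - (k + 1) / c.s * c.s = (k + 1) % c.s := by
      have := Nat.div_add_mod' (k + 1) c.s; omega
    have hm1 : k / c.s * c.s ≤ k := Nat.div_mul_le_self _ _
    have hm2 : (k + 1) / c.s * c.s ≤ k + 1 := Nat.div_mul_le_self _ _
    have hes := c.bit_index_lt k (k + 1)
    have hpe : s'.mem (c.P0 + (k % c.s * c.s + (k + 1) % c.s)) =
        2 ^ (k % c.s * c.s + (k + 1) % c.s) := by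
      rw [e1 _ (by omega), hpow _ hes.le]
    obtain ⟨hlt', hup⟩ := e2.succ hc e3 hk hJM rfl rfl
    refine Tri.of_wp (by decide) ?_
    simp only [letterBody, Pr.wp, Ex.ok_var, Ex.eval_var, Ex.eval_add, Ex.eval_num, Ex.ok_add,
      Ex.ok_num, Ex.ok_mul, Ex.eval_mul, Ex.ok_sub, Ex.eval_sub, Ex.ok_div, Ex.eval_div, Ex.ok_mem,
      Ex.eval_mem, true_and, and_true, St.set_reg, St.set_mem, St.sto_reg, St.sto_mem, reduceCtorEq,
      if_false, if_true, hk', hs, hM, hT0, hW0, hP0, hw, hmod1, hmod2, hpe]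
    generalize hD : c.T0 + c.w k * (2 * c.M) + (k / c.s + (k + 1) / c.s) = D at *
    generalize hE : k % c.s * c.s + (k + 1) % c.s = E at *
    generalize k / c.s = K at *
    generalize (k + 1) / c.s = J at *
    refine ⟨?_, ?_, ?_, ?_, ?_, hup, ?_, ?_⟩
    · exact ⟨hW.lt (by omega), hW.lt (by omega)⟩
    · and_intros <;> first | omega | exact hW.lt (by omega)
    · and_intros <;> first | omega | exact hW.lt (by omega)
    · and_intros <;> exact hW.lt (by omega)
    · intro a ha
      rw [Function.update_of_ne (by omega), e1 a ha]
    · intro a ha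
      rw [Function.update_apply]
      split_ifs
      · exact hlt'
      · exact e3 a ha
    · intro a ha
      rw [Function.update_of_ne (by omega), e4 a ha]
  · change c.n * (110 + 5 + 1) + 5 + 1 ≤ _
    omega
  · rintro s' - ⟨-, e1, e2, e3, e4⟩
    exact ⟨e1, e2, e3, e4⟩

theorem answer_spec (hc : c.Valid) (hW : c.Fits W) {s : St Var} (henv : Env c s)
    (h : Filled c 0 s.mem) :
    Tri W c.S answer s 80 (fun s' => s'.reg .out ≠ 0 ↔ c.DerN c.ini 0 c.n) := by
  have h1 := c.T0_le_I0
  have h2 := c.I0_le_D0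
  have hM := c.M_pos
  have hJ : c.n / c.s < c.M := Nat.lt_succ_self _
  have hlt := c.aNt_lt hc.ini_lt hM hJ
  -- Row block 0 contributes nothing to the address, and row 0 nothing to the bit index, which is
  -- just `n % s`.
  have haddr : c.D0 + (c.ini * c.M * c.M + c.n / c.s) = c.aNt c.ini 0 (c.n / c.s) := rfl
  have hmul : c.ini * c.M ≤ c.ini * c.M * c.M := Nat.le_mul_of_pos_right _ hM
  have hmod : c.n - c.n / c.s * c.s = c.n % c.s := by
    have := Nat.div_add_mod' c.n c.s; omega
  have hm1 : c.n / c.s * c.s ≤ c.n := Nat.div_mul_le_self _ _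
  have hn : c.n ≤ c.S := by have := c.P0_le_S; unfold Inst.P0 at this; omega
  have hB := c.B_le_S
  have hnn := Nat.zero_le (c.n / c.s)
  have hxB : s.mem (c.aNt c.ini 0 (c.n / c.s)) < c.B :=
    h.rng _ (by have := c.le_aNt c.ini 0 (c.n / c.s); omega)
  have hms : c.n % c.s ≤ c.s2 := (Nat.mod_lt _ c.s_pos).le.trans c.s_le_s2
  have hP : ((s.set Var.x (s.mem (c.aNt c.ini 0 (c.n / c.s)))).set Var.e (c.n % c.s)).reg .P0 = c.P0 := by
    simpa using henv.P0
  refine Tri.of_wp (by decide) ?_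
  simp only [answer, Pr.wp, Ex.ok_var, Ex.eval_var, Ex.eval_add, Ex.ok_add, Ex.ok_mul, Ex.eval_mul,
    Ex.ok_sub, Ex.eval_sub, Ex.ok_div, Ex.eval_div, Ex.ok_mem, Ex.eval_mem, true_and, and_true,
    St.set_reg, reduceCtorEq, if_false, if_true, henv.D0, henv.M, henv.n, henv.s, henv.ini, haddr,
    hmod]
  rw [bitEx_eval hP h.static.pow (by simpa using hms)]
  unfold Inst.aNt at hlt
  refine ⟨?_, hW.lt (by omega), bitEx_ok hW hP trivial trivial (by simpa using hms)
    (by simpa using by omega), ?_⟩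
  · unfold Inst.aNt
    simp only [zero_add, add_zero] at hlt ⊢
    and_intros <;> first | omega | exact hW.lt (by omega)
  · have hz : 0 / c.s = 0 := Nat.zero_div _
    have hbit : c.bit (s.mem (c.aNt c.ini 0 (c.n / c.s))) 0 c.n ↔ c.DerN c.ini 0 c.n := by
      constructor
      · intro hb
        exact h.nsound _ hc.ini_lt 0 c.n (by rw [hz]; exact hM) hJ (by rwa [hz])
      · intro hd
        exact h.ncomp 0 (c.n / c.s) le_rfl hM hJ c.ini 0 c.n hz rfl hd
    rw [← hbit]
    unfold Inst.bit
    simp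

/-- A bound on the running time of the recognizer. -/
def totalTime (c : Inst) : ℕ :=
  1000 * (c.W0 + c.n + c.s2) + c.B * c.B * c.B * (c.s2 * (100 * c.s + 110) + 100) +
    c.M * (c.M * (blockTime c + 20) + 30)

theorem recognizer_spec (hc : c.Valid) (hW : c.Fits W) {s : St Var} (h : Input c s.mem) :
    Tri W c.S recognizer s (totalTime c) (fun s' => s'.reg .out ≠ 0 ↔ c.DerN c.ini 0 c.n) := by
  have hss := c.s_le_s2
  have hW5 := c.five_le_W0
  refine Tri.seq (readHeader_spec hW h) (T₂ := totalTime c - 20) (by unfold totalTime; omega) ?_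
  rintro s₁ hf₁ ⟨hm₁, hn₁, hnt₁, hini₁, hR₁⟩
  have h₁ : Input c s₁.mem := hm₁ ▸ h
  refine Tri.seq (skipRules_spec hW h₁ hR₁) (T₂ := totalTime c - 20 - 40 * c.W0)
    (by unfold totalTime; omega) ?_
  rintro s₂ hf₂ ⟨hm₂, hq₂⟩
  have h₂ : Input c s₂.mem := hm₂ ▸ h₁
  have hn₂ : s₂.reg .n = c.n := (hf₂ _ rfl).trans hn₁
  refine Tri.seq (computeLog_spec hW hn₂) (T₂ := totalTime c - 40 - 40 * c.W0 - 20 * c.n)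
    (by unfold totalTime; omega) ?_
  rintro s₃ hf₃ ⟨hm₃, hlg₃⟩
  refine Tri.seq (computeSide_spec hW hlg₃)
    (T₂ := totalTime c - 60 - 40 * c.W0 - 20 * c.n - 30 * c.s) (by unfold totalTime; omega) ?_
  rintro s₄ hf₄ ⟨hm₄, hs₄⟩
  have h₄ : Input c s₄.mem := by rw [hm₄, hm₃]; exact h₂
  have hn₄ : s₄.reg .n = c.n := (hf₄ _ rfl).trans ((hf₃ _ rfl).trans hn₂)
  have hq₄ : s₄.reg .q = c.W0 := (hf₄ _ rfl).trans ((hf₃ _ rfl).trans hq₂)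
  refine Tri.seq (buildPow_spec hW h₄ hn₄ hq₄ hs₄)
    (T₂ := totalTime c - 140 - 40 * c.W0 - 20 * c.n - 30 * c.s - 40 * c.s2)
    (by unfold totalTime; omega) ?_
  rintro s₅ hf₅ ⟨hW₅, hs2₅, hM₅, hP₅, hinp₅, hpow₅, hz₅⟩
  have hnt₅ : s₅.reg .nt = c.nt := (hf₅ _ rfl).trans ((hf₄ _ rfl).trans ((hf₃ _ rfl).trans
    ((hf₂ _ rfl).trans hnt₁)))
  refine Tri.seq (setLayout_spec hW hnt₅ hW₅ hs2₅ hM₅ hP₅ hpow₅)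
    (T₂ := totalTime c - 200 - 40 * c.W0 - 20 * c.n - 30 * c.s - 40 * c.s2)
    (by unfold totalTime; omega) ?_
  rintro s₆ hf₆ ⟨hm₆, hB₆, hF₆, hT₆, hI₆, hD₆⟩
  have henv₆ : Env₀ c s₆ := by
    refine ⟨?_, ?_, ?_, (hf₆ _ rfl).trans hW₅, ?_, (hf₆ _ rfl).trans hs2₅, (hf₆ _ rfl).trans hM₅,
      (hf₆ _ rfl).trans hP₅, hB₆, hF₆, hT₆, hI₆, hD₆⟩
    · rw [hf₆ _ rfl, hf₅ _ rfl, hn₄]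
    · rw [hf₆ _ rfl, hf₅ _ rfl, hf₄ _ rfl, hf₃ _ rfl, hf₂ _ rfl, hini₁]
    · rw [hf₆ _ rfl, hf₅ _ rfl, hf₄ _ rfl, hf₃ _ rfl, hf₂ _ rfl, hR₁]
    · rw [hf₆ _ rfl, hf₅ _ rfl, hs₄]
  rw [← hm₆] at hinp₅ hpow₅ hz₅
  refine Tri.seq (buildId_spec hW henv₆ hpow₅)
    (T₂ := totalTime c - 220 - 40 * c.W0 - 20 * c.n - 30 * c.s - 100 * c.s2)
    (by unfold totalTime; omega) ?_
  rintro s₇ hf₇ ⟨hm₇, hid₇⟩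
  have henv₇ : Env c s₇ := ⟨henv₆.frame hf₇ rfl, hid₇⟩
  rw [← hm₇] at hinp₅ hpow₅ hz₅
  refine Tri.seq (buildTable_spec hW henv₇.toEnv₀ hpow₅ hz₅)
    (T₂ := 120 * c.n + 20 + (c.M * (c.M * (blockTime c + 20) + 30) + 10 + 80))
    (by unfold totalTime; omega) ?_
  rintro s₈ hf₈ ⟨heq₈, htab₈, hz₈⟩
  have henv₈ : Env c s₈ := henv₇.frame hf₈ rfl
  have hpow₈ : c.Pow s₈.mem := hpow₅.congr heq₈
  have hinp₈ : c.Inp s₈.mem := hinp₅.congr fun a ha => heq₈ a (by have := c.P0_lt_F0; omega)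
  refine Tri.seq (buildLetters_spec hc hW henv₈.toEnv₀ hinp₈ hpow₈ hz₈) le_rfl ?_
  rintro s₉ hf₉ ⟨heq₉, hlet₉, hrng₉, hz₉⟩
  have henv₉ : Env c s₉ := henv₈.frame hf₉ rfl
  -- No row is filled yet: completeness is vacuous, and soundness holds because all nonterminal
  -- blocks are zero.
  have hfill : Filled c c.M s₉.mem := by
    have h1 := c.P0_lt_F0
    have h2 := c.F0_le_T0
    refine ⟨⟨hinp₈.congr fun a ha => heq₉ a (by omega), hpow₈.congr fun a ha => heq₉ a (by omega),
      htab₈.congr heq₉, hlet₉⟩, hrng₉, ?_, fun I' J' h1 h2 => by omega⟩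
    intro A hA i j hi hj hb
    rw [hz₉ _ (by have := c.le_aNt A (i / c.s) (j / c.s); have := c.I0_le_D0; omega)] at hb
    simp [Inst.bit] at hb
  refine Tri.seq (fill_spec hc hW henv₉ hfill) le_rfl ?_
  rintro s₁₀ hf₁₀ hfill₁₀
  exact answer_spec hc hW (henv₉.frame hf₁₀ rfl) hfill₁₀

end CFRec

namespace CFRec

open Imp

/-! ## From grammars to numerical instances -/

section derivations

variable {T : Type} {G : ContextFreeGrammar T}

/-- `Gen α u`: the sentential form `α` derives the string `u`, by way of a forest of parse trees. -/
inductive Gen (G : ContextFreeGrammar T) : List (Symbol T G.NT) → List T → Prop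
  | nil : Gen G [] []
  | term (a : T) {α : List (Symbol T G.NT)} {u : List T} (h : Gen G α u) :
      Gen G (.terminal a :: α) (a :: u)
  | nont {r : ContextFreeRule T G.NT} (hr : r ∈ G.rules) {α : List (Symbol T G.NT)} {u v : List T}
      (h : Gen G r.output u) (h' : Gen G α v) : Gen G (.nonterminal r.input :: α) (u ++ v)

theorem Gen.append {α β : List (Symbol T G.NT)} {u v : List T} (h : Gen G α u) (h' : Gen G β v) :
    Gen G (α ++ β) (u ++ v) := by
  induction h with
  | nil => exact h'
  | term a _ ih => exact .term a ih
  | nont hr h _ _ ih => rw [List.append_assoc]; exact .nont hr h ih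

theorem Gen.split {α β : List (Symbol T G.NT)} {u : List T} (h : Gen G (α ++ β) u) :
    ∃ v w, u = v ++ w ∧ Gen G α v ∧ Gen G β w := by
  induction α generalizing u with
  | nil => exact ⟨[], u, rfl, .nil, h⟩
  | cons X α ih =>
    rw [List.cons_append] at h
    cases h with
    | term a h =>
      obtain ⟨v, w, rfl, h1, h2⟩ := ih h
      exact ⟨a :: v, w, rfl, .term a h1, h2⟩
    | nont hr h h' =>
      obtain ⟨v, w, rfl, h1, h2⟩ := ih h'
      exact ⟨_, w, (List.append_assoc _ _ _).symm, .nont hr h h1, h2⟩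

theorem Gen.terminals (u : List T) : Gen G (u.map .terminal) u := by
  induction u with
  | nil => exact .nil
  | cons a u ih => exact .term a ih

/-- Induction backwards from the terminal string, whose forest is trivial: to undo a rule
application, the forest is split around the right-hand side, and the middle part is placed under a
new root. -/
theorem gen_of_derives {α : List (Symbol T G.NT)} {u : List T}
    (h : G.Derives α (u.map .terminal)) : Gen G α u := by
  induction h using Relation.ReflTransGen.head_induction_on with
  | refl => exact .terminals u
  | head hab _ ih =>
    obtain ⟨r, hr, hrw⟩ := hab
    obtain ⟨p, q, rfl, rfl⟩ := hrw.exists_parts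
    obtain ⟨v, w, rfl, h1, h2⟩ := ih.split
    obtain ⟨v', w', rfl, h3, h4⟩ := h1.split
    refine (h3.append ?_).append h2
    have := Gen.nont hr h4 .nil
    rwa [List.append_nil] at this

end derivations

section instances

variable {T : Type} {G : ContextFreeGrammar T} (p : GrammarPresentation G) (w : List T)

/-- The numerical instance that belongs to a presentation of a grammar and a string. -/
def instOf : Inst where
  n := w.length
  nt := p.numT
  g := p.numN
  ini := p.nonterminal G.initial
  R := p.ruleList.length
  lhs r := (p.ruleList[r]?).elim 0 fun ρ => p.nonterminal ρ.input
  len r := (p.ruleList[r]?).elim 0 fun ρ => ρ.output.length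
  sym r t := ((p.ruleList[r]?).bind fun ρ => ρ.output[t]?).elim 0 p.encodeSymbol
  w k := (w[k]?).elim 0 fun a => p.terminal a

variable {p w}

theorem instOf_lhs {r : ℕ} {ρ : ContextFreeRule T G.NT} (h : p.ruleList[r]? = some ρ) :
    (instOf p w).lhs r = p.nonterminal ρ.input := by simp [instOf, h]

theorem instOf_len {r : ℕ} {ρ : ContextFreeRule T G.NT} (h : p.ruleList[r]? = some ρ) :
    (instOf p w).len r = ρ.output.length := by simp [instOf, h]

theorem instOf_sym {r t : ℕ} {ρ : ContextFreeRule T G.NT} {X : Symbol T G.NT}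
    (h : p.ruleList[r]? = some ρ) (hX : ρ.output[t]? = some X) :
    (instOf p w).sym r t = p.encodeSymbol X := by simp [instOf, h, hX]

theorem instOf_w {k : ℕ} {a : T} (h : w[k]? = some a) :
    (instOf p w).w k = p.terminal a := by simp [instOf, h]

theorem instOf_rule {r : ℕ} (hr : r < (instOf p w).R) :
    ∃ ρ, p.ruleList[r]? = some ρ ∧ ρ ∈ G.rules := by
  have hr' : r < p.ruleList.length := hr
  exact ⟨p.ruleList[r], List.getElem?_eq_getElem hr', (p.mem_iff _).1 (List.getElem_mem hr')⟩

theorem instOf_valid : (instOf p w).Valid where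
  ini_lt := (p.nonterminal G.initial).2
  lhs_lt r hr := by
    obtain ⟨ρ, hρ, -⟩ := instOf_rule hr
    rw [instOf_lhs hρ]
    exact (p.nonterminal ρ.input).2
  odd_lt r hr t ht hodd := by
    obtain ⟨ρ, hρ, -⟩ := instOf_rule hr
    rw [instOf_len hρ] at ht
    rw [instOf_sym hρ (List.getElem?_eq_getElem ht)] at hodd ⊢
    rcases hX : ρ.output[t] with a | A <;> rw [hX] at hodd
    · simp only [GrammarPresentation.encodeSymbol] at hodd; omega
    · have := (p.nonterminal A).2
      simp only [GrammarPresentation.encodeSymbol, instOf]; omega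
  even_lt r hr t ht heven := by
    obtain ⟨ρ, hρ, -⟩ := instOf_rule hr
    rw [instOf_len hρ] at ht
    rw [instOf_sym hρ (List.getElem?_eq_getElem ht)] at heven ⊢
    rcases hX : ρ.output[t] with a | A <;> rw [hX] at heven
    · have := (p.terminal a).2
      simp only [GrammarPresentation.encodeSymbol, instOf]; omega
    · simp only [GrammarPresentation.encodeSymbol] at heven; omega
  w_lt k hk := by
    rw [instOf_w (List.getElem?_eq_getElem hk)]
    exact (p.terminal _).2

theorem derives_snoc {α : List (Symbol T G.NT)} {X : Symbol T G.NT} {u v : List T}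
    (h : G.Derives α (u.map .terminal)) (h' : G.Derives [X] (v.map .terminal)) :
    G.Derives (α ++ [X]) ((u ++ v).map .terminal) := by
  rw [List.map_append]
  exact (h.append_right _).trans (h'.append_left _)

/-- Soundness of `Inst.DerP`. -/
theorem derives_of_derP {r t i j : ℕ} (h : (instOf p w).DerP r t i j)
    {ρ : ContextFreeRule T G.NT} (hρ : p.ruleList[r]? = some ρ) :
    ∃ u, G.Derives (ρ.output.take t) (u.map .terminal) ∧ u <+: w.drop i ∧ j = i + u.length := by
  induction h generalizing ρ with
  | nil r i hr =>
    exact ⟨[], by simpa using ContextFreeGrammar.Derives.refl _, List.nil_prefix, rfl⟩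
  | @term r t i k h ht hk hs ih =>
    obtain ⟨u, hu, hpre, rfl⟩ := ih hρ
    rw [instOf_len hρ] at ht
    rw [instOf_sym hρ (List.getElem?_eq_getElem ht), instOf_w (List.getElem?_eq_getElem hk)] at hs
    have hX : ρ.output[t] = .terminal w[i + u.length] := by
      rcases hX : ρ.output[t] with a | A
      · rw [hX] at hs
        simp only [GrammarPresentation.encodeSymbol] at hs
        have : a = w[i + u.length] := p.terminal.injective (Fin.ext (by omega))
        rw [this]
      · rw [hX] at hs
        simp only [GrammarPresentation.encodeSymbol] at hs
        omega
    refine ⟨u ++ [w[i + u.length]], ?_, ?_, by simp; omega⟩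
    · rw [List.take_succ_eq_append_getElem ht, hX]
      exact derives_snoc hu (ContextFreeGrammar.Derives.refl _)
    · rw [List.prefix_iff_eq_take] at hpre ⊢
      rw [List.length_append, List.length_singleton, List.take_succ_eq_append_getElem
        (by rw [List.length_drop]; have : (instOf p w).n = w.length := rfl; omega), ← hpre,
        List.getElem_drop]
      rfl
  | @nont r t i k r' j h ht hs h' ih ih' =>
    obtain ⟨u, hu, hpre, rfl⟩ := ih hρ
    obtain ⟨ρ', hρ', hmem⟩ := instOf_rule h'.rule_lt
    obtain ⟨v, hv, hpre', rfl⟩ := ih' hρ'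
    rw [instOf_len hρ] at ht
    rw [instOf_len hρ', List.take_length] at hv
    rw [instOf_sym hρ (List.getElem?_eq_getElem ht), instOf_lhs hρ'] at hs
    have hX : ρ.output[t] = .nonterminal ρ'.input := by
      rcases hX : ρ.output[t] with a | A
      · rw [hX] at hs
        simp only [GrammarPresentation.encodeSymbol] at hs
        omega
      · rw [hX] at hs
        simp only [GrammarPresentation.encodeSymbol] at hs
        have : A = ρ'.input := p.nonterminal.injective (Fin.ext (by omega))
        rw [this]
    refine ⟨u ++ v, ?_, ?_, by simp; omega⟩
    · rw [List.take_succ_eq_append_getElem ht, hX]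
      refine derives_snoc hu (ContextFreeGrammar.Produces.trans_derives ?_ hv)
      exact ⟨ρ', hmem, ContextFreeRule.Rewrites.input_output⟩
    · obtain ⟨x, hx⟩ := hpre
      rw [← List.drop_drop, ← hx, List.drop_left] at hpre'
      rw [← hx]
      exact (List.prefix_append_right_inj u).2 hpre'

/-- Completeness of `Inst.DerP`. -/
theorem derP_of_gen {α : List (Symbol T G.NT)} {u : List T} (h : Gen G α u)
    {r t i₀ i : ℕ} {ρ : ContextFreeRule T G.NT} (hρ : p.ruleList[r]? = some ρ)
    {post : List (Symbol T G.NT)} (hout : ρ.output.drop t = α ++ post)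
    (hd : (instOf p w).DerP r t i₀ i) (hu : u <+: w.drop i) :
    (instOf p w).DerP r (t + α.length) i₀ (i + u.length) := by
  -- The forest is consumed from the left while the prefix grows, so the prefix already built and
  -- its endpoint must vary.
  induction h generalizing r t i₀ i ρ post with
  | nil => simpa using hd
  | @term a α u h ih =>
    have hX : ρ.output[t]? = some (.terminal a) := by
      rw [← List.head?_drop, hout]; rfl
    have hw : w[i]? = some a := by
      obtain ⟨x, hx⟩ := hu
      rw [← List.head?_drop, ← hx]; rfl
    have ht : t < ρ.output.length := (List.getElem?_eq_some_iff.1 hX).1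
    have hi : i < w.length := (List.getElem?_eq_some_iff.1 hw).1
    have hd' : (instOf p w).DerP r (t + 1) i₀ (i + 1) := by
      refine hd.term (by rwa [instOf_len hρ]) hi ?_
      rw [instOf_sym hρ hX, instOf_w hw]; rfl
    have := ih hρ (post := post) (by rw [← List.tail_drop, hout]; rfl) hd' (by
      rw [← List.tail_drop]
      obtain ⟨x, hx⟩ := hu
      rw [← hx]
      exact List.prefix_append _ _)
    rw [List.length_cons, List.length_cons, show t + (α.length + 1) = t + 1 + α.length by ring,
      show i + (u.length + 1) = i + 1 + u.length by ring]
    exact this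
  | @nont ρ' hmem α u v h h' ih ih' =>
    have hX : ρ.output[t]? = some (.nonterminal ρ'.input) := by
      rw [← List.head?_drop, hout]; rfl
    have ht : t < ρ.output.length := (List.getElem?_eq_some_iff.1 hX).1
    obtain ⟨r', hr'⟩ := List.getElem?_of_mem ((p.mem_iff ρ').2 hmem)
    have hlt : r' < p.ruleList.length := (List.getElem?_eq_some_iff.1 hr').1
    -- The trees below the root start afresh from the empty prefix of the rule `r'` at position `i`.
    have hin : (instOf p w).DerP r' ((instOf p w).len r') i (i + u.length) := by
      have := ih hr' (t := 0) (i₀ := i) (i := i) (post := []) (by simp) (.nil r' i hlt)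
        ((List.prefix_append u v).trans hu)
      rw [instOf_len hr']
      simpa using this
    have hd' : (instOf p w).DerP r (t + 1) i₀ (i + u.length) := by
      refine hd.nont (by rwa [instOf_len hρ]) ?_ hin
      rw [instOf_sym hρ hX, instOf_lhs hr']; rfl
    have := ih' hρ (post := post) (by rw [← List.tail_drop, hout]; rfl) hd' (by
      obtain ⟨x, hx⟩ := hu
      rw [← List.drop_drop, ← hx, List.append_assoc, List.drop_left]
      exact List.prefix_append _ _)
    rw [List.length_cons, List.length_append, show t + (α.length + 1) = t + 1 + α.length by ring,
      ← add_assoc]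
    exact this

theorem derN_iff :
    (instOf p w).DerN (instOf p w).ini 0 (instOf p w).n ↔ w ∈ G.language := by
  rw [ContextFreeGrammar.mem_language_iff]
  constructor
  · rintro ⟨r, hr, hd⟩
    obtain ⟨ρ, hρ, hmem⟩ := instOf_rule hd.rule_lt
    obtain ⟨u, hu, hpre, hlen⟩ := derives_of_derP hd hρ
    rw [instOf_len hρ, List.take_length] at hu
    rw [instOf_lhs hρ] at hr
    have hw : u = w := by
      rw [List.drop_zero] at hpre
      exact hpre.eq_of_length (by have : (instOf p w).n = w.length := rfl; omega)
    subst hw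
    have hin : ρ.input = G.initial := p.nonterminal.injective (Fin.ext hr)
    rw [← hin]
    exact ContextFreeGrammar.Produces.trans_derives
      ⟨ρ, hmem, ContextFreeRule.Rewrites.input_output⟩ hu
  · intro h
    have hg := gen_of_derives h
    generalize hS : ([Symbol.nonterminal G.initial] : List (Symbol T G.NT)) = β at hg
    cases hg with
    | nil => simp at hS
    | term a h => simp at hS
    | @nont ρ hmem α u v h1 h2 =>
      simp only [List.cons.injEq, Symbol.nonterminal.injEq] at hS
      obtain ⟨hS, rfl⟩ := hS
      cases h2
      obtain ⟨r, hr⟩ := List.getElem?_of_mem ((p.mem_iff ρ).2 hmem)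
      have hlt : r < p.ruleList.length := (List.getElem?_eq_some_iff.1 hr).1
      refine ⟨r, ?_, ?_⟩
      · rw [instOf_lhs hr, ← hS]; rfl
      · have := derP_of_gen (w := u ++ []) h1 hr (t := 0) (i₀ := 0) (i := 0) (post := []) (by simp)
          (.nil r 0 hlt) (by simp)
        rw [instOf_len hr]
        simpa [instOf] using this

/-! ## The input in memory -/

theorem off_instOf {r : ℕ} (hr : r ≤ p.ruleList.length) :
    (instOf p w).off r = ((p.ruleList.take r).flatMap p.encodeRule).length := by
  induction r with
  | zero => simp [Inst.off]
  | succ r ih =>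
    have hr' : r < p.ruleList.length := hr
    rw [Inst.off_succ, ih (by omega), instOf_len (List.getElem?_eq_getElem hr'),
      List.take_succ_eq_append_getElem hr', List.flatMap_append, List.length_append]
    simp [GrammarPresentation.encodeRule]
    omega

theorem encode_rule {r i : ℕ} {ρ : ContextFreeRule T G.NT} (hρ : p.ruleList[r]? = some ρ)
    (hi : i < (p.encodeRule ρ).length) :
    (p.encode w)[5 + (instOf p w).off r + i]? = (p.encodeRule ρ)[i]? := by
  obtain ⟨hr, rfl⟩ := List.getElem?_eq_some_iff.1 hρ
  have hsplit : p.ruleList.flatMap p.encodeRule = (p.ruleList.take r).flatMap p.encodeRule ++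
      (p.encodeRule p.ruleList[r] ++ (p.ruleList.drop (r + 1)).flatMap p.encodeRule) := by
    rw [← List.flatMap_cons, ← List.drop_eq_getElem_cons hr, ← List.flatMap_append,
      List.take_append_drop]
  have hoff := off_instOf (w := w) hr.le
  unfold GrammarPresentation.encode
  rw [hsplit, List.append_assoc, List.getElem?_append_right (by simp; omega), List.append_assoc,
    List.getElem?_append_right (by simp at *; omega), List.append_assoc,
    List.getElem?_append_left (by simp at *; omega)]
  congr 1
  simp at *
  omega

theorem encode_length : (p.encode w).length = (instOf p w).P0 := by
  have hoff := off_instOf (w := w) (p := p) le_rfl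
  rw [List.take_length] at hoff
  unfold GrammarPresentation.encode Inst.P0 Inst.W0
  rw [List.length_append, List.length_append, List.length_map, ← hoff]
  simp [instOf]

theorem input_instOf : Input (instOf p w) (fun a => (p.encode w).getD a 0) where
  n := rfl
  nt := rfl
  ini := rfl
  R := rfl
  inp := by
    refine ⟨fun r hr => ?_, fun r hr => ?_, fun r hr t ht => ?_, fun k hk => ?_⟩
    · obtain ⟨ρ, hρ, -⟩ := instOf_rule hr
      have := encode_rule (w := w) hρ (i := 0) (by simp [GrammarPresentation.encodeRule])
      rw [add_zero] at this
      change (p.encode w).getD _ 0 = _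
      rw [List.getD_eq_getElem?_getD, this, instOf_lhs hρ]
      simp [GrammarPresentation.encodeRule]
    · obtain ⟨ρ, hρ, -⟩ := instOf_rule hr
      have := encode_rule (w := w) hρ (i := 1) (by simp [GrammarPresentation.encodeRule])
      change (p.encode w).getD _ 0 = _
      rw [List.getD_eq_getElem?_getD, this, instOf_len hρ]
      simp [GrammarPresentation.encodeRule]
    · obtain ⟨ρ, hρ, -⟩ := instOf_rule hr
      rw [instOf_len hρ] at ht
      have := encode_rule (w := w) hρ (i := t + 2) (by simp [GrammarPresentation.encodeRule]; omega)
      change (p.encode w).getD _ 0 = _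
      rw [show (instOf p w).pos r t + 1 = 5 + (instOf p w).off r + (t + 2) by
        unfold Inst.pos; ring, List.getD_eq_getElem?_getD, this,
        instOf_sym hρ (List.getElem?_eq_getElem ht)]
      simp [GrammarPresentation.encodeRule, List.getElem?_eq_getElem ht]
    · have hk' : k < w.length := hk
      have hoff := off_instOf (w := w) (p := p) le_rfl
      rw [List.take_length] at hoff
      change (p.encode w).getD _ 0 = _
      rw [instOf_w (List.getElem?_eq_getElem hk'), List.getD_eq_getElem?_getD]
      have hW0 : (instOf p w).W0 = 5 + (instOf p w).off p.ruleList.length := rfl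
      unfold GrammarPresentation.encode
      rw [List.getElem?_append_right (by simp at *; omega)]
      have e : (instOf p w).W0 + k - ([w.length, p.numT, p.numN, ↑(p.nonterminal G.initial),
          p.ruleList.length] ++ List.flatMap p.encodeRule p.ruleList).length = k := by
        rw [List.length_append, ← hoff, hW0]
        simp
      rw [e]
      simp [List.getElem?_eq_getElem hk']
  zero := by
    intro a ha
    rw [List.getD_eq_getElem?_getD, List.getElem?_eq_none (by rw [encode_length]; exact ha)]
    rfl

end instances

end CFRec

namespace CFRec

open Imp

/-! ## Asymptotics -/

namespace Inst

variable {c : Inst}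

/-- The string is long in comparison with the grammar. -/
def Long (c : Inst) : Prop := 2 ^ (16 * (c.W0 + c.nt + c.g) ^ 2) ≤ c.n

theorem Long.le_log (h : c.Long) : 16 * (c.W0 + c.nt + c.g) ^ 2 ≤ Nat.log 2 c.n :=
  Nat.le_log_of_pow_le (by norm_num) h

theorem Long.n_ne (h : c.Long) : c.n ≠ 0 := by
  have : 0 < 2 ^ (16 * (c.W0 + c.nt + c.g) ^ 2) := by positivity
  unfold Long at h
  omega

theorem Long.le_sqrt (h : c.Long) : c.W0 + c.nt + c.g ≤ Nat.sqrt (Nat.log 2 c.n / 16) := by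
  rw [Nat.le_sqrt, Nat.le_div_iff_mul_le (by norm_num)]
  have := h.le_log
  nlinarith

theorem Long.s_eq (h : c.Long) : c.s = Nat.sqrt (Nat.log 2 c.n / 16) := by
  have := h.le_sqrt
  have := c.five_le_W0
  exact max_eq_right (by omega)

theorem Long.le_s (h : c.Long) : c.W0 + c.nt + c.g ≤ c.s := h.s_eq ▸ h.le_sqrt

theorem Long.s2_le (h : c.Long) : 16 * c.s2 ≤ Nat.log 2 c.n := by
  have := Nat.sqrt_le (Nat.log 2 c.n / 16)
  rw [← h.s_eq] at this
  unfold s2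
  omega

/-- Rounding down in the square root loses at most a factor 4, because `s + 1 ≤ 2 * s`; together
with the 16 in the definition of `s` this gives 64. -/
theorem Long.log_lt (h : c.Long) : Nat.log 2 c.n + 1 ≤ 64 * c.s2 := by
  have h1 := Nat.lt_succ_sqrt (Nat.log 2 c.n / 16)
  rw [← h.s_eq, Nat.succ_eq_add_one] at h1
  have h2 := c.s_pos
  have h3 : (c.s + 1) * (c.s + 1) ≤ 4 * c.s2 := by unfold s2; nlinarith
  omega

/-- The purpose of the 16 in the definition of `s`: fixed powers of `B`, from the table and the
saturation rounds, disappear below `n`. -/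
theorem Long.B_pow_le (h : c.Long) : c.B ^ 16 ≤ c.n := by
  unfold B
  rw [← pow_mul, mul_comm]
  exact (Nat.pow_le_pow_right (by norm_num) h.s2_le).trans (Nat.pow_log_le_self 2 h.n_ne)

theorem s2_le_B : c.s2 ≤ c.B := Nat.lt_two_pow_self.le

theorem Long.B_pow_le_of_le (h : c.Long) {k : ℕ} (hk : k ≤ 16) : c.B ^ k ≤ c.n :=
  (Nat.pow_le_pow_right c.B_pos hk).trans h.B_pow_le

theorem Long.s_mul_M_le (h : c.Long) : c.s * c.M ≤ 2 * c.n := by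
  have h1 : c.s * (c.n / c.s) ≤ c.n := Nat.mul_div_le _ _
  have h2 : c.B ^ 1 ≤ c.n := h.B_pow_le_of_le (by norm_num)
  have h3 := c.s2_le_B
  have h4 := c.s_le_s2
  unfold M
  rw [pow_one] at h2
  rw [mul_add]
  omega

/-- Multiplication by `s2` stands for division by the logarithm. The main term is `g * M²`, where `s
* M ≤ 2 * n` is used twice; everything else is of order `n²`. -/
theorem Long.s2_mul_S_le (h : c.Long) (hg : 1 ≤ c.g) : c.s2 * c.S ≤ 20 * (c.g * c.n ^ 2) := by
  have hs := h.le_s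
  have hM := h.s_mul_M_le
  have h1 := c.s2_le_B
  have h2 := c.s_le_s2
  have h4 := h.B_pow_le_of_le (k := 4) (by norm_num)
  have hn : c.n ^ 2 ≤ c.g * c.n ^ 2 := Nat.le_mul_of_pos_left _ hg
  have hB := c.B_pos
  have hB4 : c.B * c.B ≤ c.B ^ 4 := by
    rw [← pow_two]; exact Nat.pow_le_pow_right hB (by norm_num)
  have hB1 : c.B ≤ c.B ^ 4 := Nat.le_self_pow (by norm_num) _
  have hnn : c.n ≤ c.n ^ 2 := Nat.le_self_pow (by norm_num) _
  have e1 : c.s2 * c.W0 ≤ c.n ^ 2 :=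
    (Nat.mul_le_mul h1 (by omega : c.W0 ≤ c.B)).trans (by omega)
  have e2 : c.s2 * c.n ≤ c.n ^ 2 := by
    rw [pow_two]; exact Nat.mul_le_mul_right _ (by omega)
  have e3 : c.s2 * c.s2 ≤ c.n ^ 2 := (Nat.mul_le_mul h1 h1).trans (by omega)
  have e4 : c.s2 ≤ c.n ^ 2 := by omega
  have e5 : c.s2 * (c.B * c.B * c.B) ≤ c.n ^ 2 :=
    (Nat.mul_le_mul_right _ h1).trans (by
      rw [show c.B * (c.B * c.B * c.B) = c.B ^ 4 by ring]; omega)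
  -- One factor `s` goes to `M`; what is left, `s * a ≤ B²`, is below `n`. This covers the terminal
  -- and the prefix blocks.
  have key : ∀ a ≤ c.B, c.s2 * (a * c.M) ≤ 2 * c.n ^ 2 := fun a ha => by
    calc c.s2 * (a * c.M) = c.s * a * (c.s * c.M) := by unfold s2; ring
      _ ≤ c.n * (2 * c.n) := Nat.mul_le_mul
          ((Nat.mul_le_mul (by omega : c.s ≤ c.B) ha).trans (by omega)) hM
      _ = 2 * c.n ^ 2 := by ring
  have e6 := key c.nt (by omega)
  have e7 := key c.W0 (by omega)
  have e8 : c.s2 * (c.g * c.M * c.M) ≤ 4 * (c.g * c.n ^ 2) := by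
    calc c.s2 * (c.g * c.M * c.M) = c.g * ((c.s * c.M) * (c.s * c.M)) := by unfold s2; ring
      _ ≤ c.g * ((2 * c.n) * (2 * c.n)) := Nat.mul_le_mul_left _ (Nat.mul_le_mul hM hM)
      _ = 4 * (c.g * c.n ^ 2) := by ring
  have : c.s2 * c.S = c.s2 * c.W0 + c.s2 * c.n + c.s2 * c.s2 + c.s2 + c.s2 * (c.B * c.B * c.B) +
      2 * (c.s2 * (c.nt * c.M)) + c.s2 * (c.W0 * c.M) + c.s2 * (c.g * c.M * c.M) := by
    unfold S D0 I0 T0 F0 P0; ring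
  omega

/-- The main term is `M²` blocks times the work per block. The factor `s2` is absorbed by `M²`, so
it remains to bound the work per block by a constant times `n`, independently of the grammar. -/
theorem Long.s2_mul_totalTime_le (h : c.Long) (hg : 1 ≤ c.g) :
    c.s2 * totalTime c ≤ 20000 * (c.g * c.n ^ 3) := by
  have hs := h.le_s
  have hM := h.s_mul_M_le
  have h1 := c.s2_le_B
  have h2 := c.s_le_s2
  have h6 := h.B_pow_le_of_le (k := 6) (by norm_num)
  have hB := c.B_pos
  have hBk : ∀ k ≤ 6, c.B ^ k ≤ c.n := fun k hk => h.B_pow_le_of_le (by omega)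
  have hB1 := hBk 1 (by norm_num)
  rw [pow_one] at hB1
  have hn3 : c.n ^ 3 ≤ c.g * c.n ^ 3 := Nat.le_mul_of_pos_left _ hg
  have hn2 : c.n ^ 2 ≤ c.n ^ 3 := Nat.pow_le_pow_right (by omega) (by norm_num)
  have hn1 : c.n ≤ c.n ^ 2 := Nat.le_self_pow (by norm_num) _
  have e1 : c.s2 * (1000 * (c.W0 + c.n + c.s2)) ≤ 3000 * c.n ^ 2 := by
    calc c.s2 * (1000 * (c.W0 + c.n + c.s2)) ≤ c.n * (1000 * (c.n + c.n + c.n)) := by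
          gcongr <;> omega
      _ = 3000 * c.n ^ 2 := by ring
  have e2 : c.s2 * (c.B * c.B * c.B * (c.s2 * (100 * c.s + 110) + 100)) ≤ 310 * c.n := by
    calc c.s2 * (c.B * c.B * c.B * (c.s2 * (100 * c.s + 110) + 100))
        ≤ c.B * (c.B * c.B * c.B * (c.B * (100 * c.B + 110 * c.B) + 100 * c.B * c.B)) := by
          gcongr
          · omega
          · omega
          · nlinarith
      _ = 310 * c.B ^ 6 := by ring
      _ ≤ 310 * c.n := by omega
  -- Here the grammar size disappears: `W0 ≤ s` gives `W0 * M ≤ 2 * n`, and the saturation is paid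
  -- by `B ^ 3 ≤ n`.
  have e3 : c.W0 * (c.M + ((c.W0 + c.g) * c.B + 2)) ≤ 6 * c.n := by
    have a1 : c.W0 * c.M ≤ 2 * c.n := (Nat.mul_le_mul_right _ (by omega)).trans hM
    have a2 : c.W0 * ((c.W0 + c.g) * c.B) ≤ c.n := by
      calc c.W0 * ((c.W0 + c.g) * c.B) ≤ c.B * (c.B * c.B) := by gcongr <;> omega
        _ = c.B ^ 3 := by ring
        _ ≤ c.n := hBk 3 (by norm_num)
    rw [mul_add, mul_add]
    omega
  have e4 : c.s2 * (c.M * (c.M * (blockTime c + 20) + 30)) ≤ 12000 * c.n ^ 3 + 140 * c.n ^ 2 := by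
    calc c.s2 * (c.M * (c.M * (blockTime c + 20) + 30))
        = (c.s * c.M) * ((c.s * c.M) * (500 * (c.W0 * (c.M + ((c.W0 + c.g) * c.B + 2))) + 20) +
            30 * c.s) := by unfold s2 blockTime; ring
      _ ≤ (2 * c.n) * ((2 * c.n) * (500 * (6 * c.n) + 20) + 30 * c.n) := by gcongr; omega
      _ = 12000 * c.n ^ 3 + 140 * c.n ^ 2 := by ring
  have : c.s2 * totalTime c = c.s2 * (1000 * (c.W0 + c.n + c.s2)) +
      c.s2 * (c.B * c.B * c.B * (c.s2 * (100 * c.s + 110) + 100)) +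
      c.s2 * (c.M * (c.M * (blockTime c + 20) + 30)) := by unfold totalTime; ring
  omega

/-- The exponent 20 is generous: `S + 1 ≤ n ^ 5` contributes 10 after squaring, and `64 ≤ n ^ 10`
the other 10. -/
theorem Long.fits (h : c.Long) (hg : 1 ≤ c.g) : c.Fits (20 * Nat.clog 2 c.n) := by
  have hS := h.s2_mul_S_le hg
  have hs : 0 < c.s2 := Nat.mul_pos c.s_pos c.s_pos
  have hS' : c.S ≤ c.s2 * c.S := Nat.le_mul_of_pos_left _ hs
  have hB := h.B_pow_le_of_le (k := 1) (by norm_num)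
  have h1 := c.s2_le_B
  have h2 := c.s_le_s2
  have h3 := h.le_s
  have h5 := c.five_le_W0
  rw [pow_one] at hB
  have hn : 5 ≤ c.n := by omega
  have hgn : c.g * c.n ^ 2 ≤ c.n ^ 3 := by
    rw [pow_succ' c.n 2]; exact Nat.mul_le_mul_right _ (by omega)
  have h25 : 25 ≤ c.n ^ 2 := Nat.pow_le_pow_left hn 2
  have h3' : 0 < c.n ^ 3 := by positivity
  have hS5 : c.S + 1 ≤ c.n ^ 5 := by
    have : 25 * c.n ^ 3 ≤ c.n ^ 5 := by
      rw [show c.n ^ 5 = c.n ^ 2 * c.n ^ 3 by ring]; exact Nat.mul_le_mul_right _ h25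
    omega
  calc 64 * (c.S + 1) ^ 2 ≤ c.n ^ 10 * (c.n ^ 5) ^ 2 := by
        gcongr
        exact (by norm_num : 64 ≤ 5 ^ 10).trans (Nat.pow_le_pow_left hn 10)
    _ = c.n ^ 20 := by ring
    _ ≤ (2 ^ Nat.clog 2 c.n) ^ 20 := Nat.pow_le_pow_left (Nat.le_pow_clog (by norm_num) _) _
    _ = 2 ^ (20 * Nat.clog 2 c.n) := by rw [← pow_mul, mul_comm]

theorem Long.logb_pos (h : c.Long) : 0 < Real.logb 2 c.n := by
  have := h.le_log
  have h5 := c.five_le_W0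
  have hlog : 0 < Nat.log 2 c.n := by
    have : 0 < (c.W0 + c.nt + c.g) ^ 2 := by positivity
    omega
  refine Real.logb_pos (by norm_num) ?_
  exact_mod_cast (Nat.log_pos_iff.1 hlog).1.trans_lt' (by norm_num)

theorem Long.logb_le (h : c.Long) : Real.logb 2 c.n ≤ 64 * c.s2 := by
  have h1 : c.n < 2 ^ (Nat.log 2 c.n + 1) := Nat.lt_pow_succ_log_self (by norm_num) _
  have h2 : Real.logb 2 c.n ≤ (Nat.log 2 c.n + 1 : ℕ) := by
    rw [Real.logb_le_iff_le_rpow (by norm_num) (by exact_mod_cast Nat.pos_of_ne_zero h.n_ne),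
      Real.rpow_natCast]
    exact_mod_cast h1.le
  exact h2.trans (by exact_mod_cast h.log_lt)

theorem Long.le_div_logb (h : c.Long) {a b k : ℕ} (hab : c.s2 * a ≤ k * b) :
    (a : ℝ) ≤ 64 * k * (b / Real.logb 2 c.n) := by
  rw [← mul_div_assoc, le_div_iff₀ h.logb_pos]
  have h1 : (c.s2 : ℝ) * a ≤ k * b := by exact_mod_cast hab
  have h2 := mul_le_mul_of_nonneg_left h.logb_le (Nat.cast_nonneg (α := ℝ) a)
  linarith

end Inst

end CFRec

namespace CFRec

open Imp WordRAM

/-! ## The machine program -/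

section machine

variable {T : Type} {G : ContextFreeGrammar T} {p : GrammarPresentation G} {w : List T} {W : ℕ}

theorem encodeSymbol_le (X : Symbol T G.NT) : p.encodeSymbol X ≤ 2 * (p.numT + p.numN) := by
  rcases X with a | A
  · have := (p.terminal a).2
    simp only [GrammarPresentation.encodeSymbol]; omega
  · have := (p.nonterminal A).2
    simp only [GrammarPresentation.encodeSymbol]; omega

theorem encode_le {v : ℕ} (hv : v ∈ p.encode w) : v ≤ 4 * (instOf p w).S := by
  set c := instOf p w with hc
  have hg : p.numN ≤ c.S := c.g_le_S
  have hnt : p.numT ≤ c.S := c.nt_le_S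
  have hW0 := c.W0_le_S
  have hP0 := c.P0_le_S
  have hn : w.length ≤ c.P0 := Nat.le_add_left _ _
  have hR := c.le_off c.R
  have hR' : p.ruleList.length = c.R := rfl
  have hini := (p.nonterminal G.initial).2
  have hW0' : c.W0 = 5 + c.off c.R := rfl
  simp only [GrammarPresentation.encode, List.mem_append, List.mem_cons, List.not_mem_nil, or_false,
    List.mem_flatMap, List.mem_map] at hv
  rcases hv with ((rfl | rfl | rfl | rfl | rfl) | ⟨ρ, hρ, hv⟩) | ⟨a, -, rfl⟩
  · omega
  · omega
  · omega
  · omega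
  · omega
  · simp only [GrammarPresentation.encodeRule, List.mem_cons, List.mem_map] at hv
    rcases hv with rfl | rfl | ⟨X, -, rfl⟩
    · have := (p.nonterminal ρ.input).2
      omega
    · obtain ⟨r, hr⟩ := List.getElem?_of_mem hρ
      have hlt : r < c.R := (List.getElem?_eq_some_iff.1 hr).1
      have := c.off_lt hlt
      rw [instOf_len hr] at this
      omega
    · have := encodeSymbol_le (p := p) X
      omega
  · have := (p.terminal a).2
    omega

/-- The compiled recognizer. -/
def machine : Cmd := recognizer.code Var.ctorIdx

theorem machine_computes (hW : (instOf p w).Fits W) :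
    ∃ t out, machine.Computes W (instOf p w).S (p.encode w) t out ∧
      (out ≠ 0 ↔ w ∈ G.language) ∧ t ≤ totalTime (instOf p w) := by
  have hpos : 0 < 2 ^ W := by positivity
  have hlt : ∀ v ∈ p.encode w, v < 2 ^ W := fun v hv =>
    hW.lt (by have := encode_le hv; omega)
  obtain ⟨t, ht, s', hrun, hout⟩ := recognizer_spec instOf_valid hW
    (s := ⟨fun _ => 0, fun a => (p.encode w).getD a 0⟩) input_instOf
  have hν : Function.Injective Var.ctorIdx := fun u₁ u₂ h => by
    cases u₁ <;> cases u₂ <;> first | rfl | (exfalso; revert h; decide)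
  obtain ⟨σ', hexec, hrep⟩ := hrun.simulate hν (σ := State.init (p.encode w))
    { reg := fun _ => rfl
      mem := rfl
      reg_lt := fun _ => hpos
      mem_lt := fun a => by
        change (p.encode w).getD a 0 < 2 ^ W
        rw [List.getD_eq_getElem?_getD]
        rcases h : (p.encode w)[a]? with _ | v
        · exact hpos
        · exact hlt v (List.mem_of_getElem? h) }
  refine ⟨t, s'.reg .out, ⟨?_, hlt, σ', hexec, hrep.reg .out⟩, ?_, ht⟩
  · rw [encode_length]
    have := (instOf p w).P0_le_S
    omega
  · rw [hout, derN_iff]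

end machine

end CFRec

open CFRec in
theorem mainTheorem4 :
    ∃ (P : WordRAM.Cmd) (c : ℕ) (C : ℝ),
      ∀ (T : Type) (G : ContextFreeGrammar T) (p : GrammarPresentation G),
        (∀ w : List T, ∃ W S t out : ℕ,
          P.Computes W S (p.encode w) t out ∧ (out ≠ 0 ↔ w ∈ G.language)) ∧
        ∃ n₀ : ℕ, ∀ w : List T, n₀ ≤ w.length →
          ∃ S t out : ℕ,
            P.Computes (c * Nat.clog 2 w.length) S (p.encode w) t out ∧
            (out ≠ 0 ↔ w ∈ G.language) ∧
            (t : ℝ) ≤ C * (Nat.card G.NT * (w.length : ℝ) ^ 3 / Real.logb 2 w.length) ∧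
            (S : ℝ) ≤ C * (Nat.card G.NT * (w.length : ℝ) ^ 2 / Real.logb 2 w.length) := by
  -- 20 comes from `Long.fits`, 64 from comparing `log n` with `s2`, and 20000 from the time bound,
  -- which also exceeds the constant for space.
  refine ⟨machine, 20, 64 * (20000 : ℕ), fun T G p => ⟨fun w => ?_, ?_⟩⟩
  -- Without a limit on the word length, `k < 2 ^ k` makes the words long enough.
  · obtain ⟨t, out, h, h', -⟩ := machine_computes (p := p) (w := w)
      (W := 64 * ((instOf p w).S + 1) ^ 2) Nat.lt_two_pow_self.le
    exact ⟨_, _, t, out, h, h'⟩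
  -- `W0`, `nt` and `g` do not depend on the string, so the empty string serves to define the
  -- threshold, and `Long` is then the hypothesis by unfolding.
  · refine ⟨2 ^ (16 * ((instOf p []).W0 + p.numT + p.numN) ^ 2), fun w hw => ?_⟩
    have hlong : (instOf p w).Long := hw
    have hg : 1 ≤ (instOf p w).g := Nat.zero_lt_of_lt instOf_valid.ini_lt
    have hcard : Nat.card G.NT = (instOf p w).g := by
      rw [Nat.card_congr p.nonterminal, Nat.card_fin]; rfl
    obtain ⟨t, out, h, h', ht⟩ := machine_computes (hlong.fits hg)
    refine ⟨_, t, out, h, h', ?_, ?_⟩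
    · have := hlong.le_div_logb ((Nat.mul_le_mul_left _ ht).trans (hlong.s2_mul_totalTime_le hg))
      rw [hcard]
      push_cast at this ⊢
      exact this
    · have := hlong.le_div_logb (k := 20000) ((hlong.s2_mul_S_le hg).trans (Nat.mul_le_mul_right _ (by norm_num)))
      rw [hcard]
      push_cast at this ⊢
      exact this
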